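/- Let $X$ be the line $\mathbb R$ or the torus $\mathbb T=\mathbb R/2\pi\mathbb Z$, and write $\langle f,g\rangle=\int_X \bar f g\,dx$, $\hat f(\xi)=\frac1{2\pi}\int e^{-i\xi x}f(x)\,dx$, $L^2_\pm=\{f\in L^2(X):\hat f(\xi)=0 \text{ whenever } \mp\xi>0\}$; $C_\pm$ are the orthogonal projections of $L^2$ onto $L^2_\pm$, and $H^1_+=\{u\in L^2_+: u'\in L^2\}$. In $\pm,\mp$ the upper sign is the focusing case, the lower sign the defocusing case. Let $M_*=2\pi$ (focusing) or $M_*=\infty$ (defocusing) and $B_{M_*}=\{q\in L^2_+:\int|q|^2\,dx<M_*\}$. For $q\in B_{M_*}$ let $\mathcal L_q u=-iu'\mp qC_+(\bar q u)$ with domain $H^1_+$, and for $\kappa\ge1$ $$m_\kappa=(\mathcal L_q+\kappa)^{-1}q,\qquad \beta_\kappa(q)=\langle q,m_\kappa\rangle .$$ The Wirtinger derivatives of $F$ are the unique $\frac{\delta F}{\delta\bar q}\in L^2_+$, $\frac{\delta F}{\delta q}\in L^2_-$ with $dF|_q(f)=\langle\bar f,\frac{\delta F}{\delta q}\rangle+\langle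 f,\frac{\delta F}{\delta\bar q}\rangle$ for all $f\in L^2_+$. The symplectic form is $$\omega_q(f,g)=\mathrm{Re}\,\langle f,\Omega(q)g\rangle,\quad \Omega(q)g=i\bigl(g\mp2C_+\Theta(q)g\bigr),\quad \Theta(q)g=iq\,\tilde\partial^{-1}\mathrm{Re}(\bar qg),$$ where $[\tilde\partial^{-1}f](x)=\frac12\int_{\mathbb R}\mathrm{sgn}(x-y)f(y)\,dy$ on $\mathbb R$ and $[\tilde\partial^{-1}f](x)=\frac12\int_0^{2\pi}(1-\frac y\pi)f(x-y)\,dy$ on $\mathbb T$; the symplectic gradient $\nabla_\omega F(q)\in L^2_+$ of a real-valued $F$ is the unique vector with $dF|_q(f)=\omega_q(f,\nabla_\omega F(q))$ for all $f\in L^2_+$. **Proposition.** Fix $\kappa\ge1$. For every $q\in B_{M_*}$: $H^1_+\subset L^\infty$ and $\mathcal L_q$ maps $H^1_+$ into $L^2$, $\mathcal L_q+\kappa:H^1_+\to L^2_+$ is a bijection, $\beta_\kappa$ is real-valued and is a $C^1$ function on $B_{M_*}$, and $$\frac{\delta\beta_\kappa}{\delta\bar q}=m_\kappa\pm C_+\bigl[m_\kappa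 C_-(q\overline{m}_\kappa)\bigr],$$ $$\nabla_\omega\beta_\kappa=-2im_\kappa\pm2im_\kappa C_+(q\overline m_\kappa)\quad\text{on }\mathbb R,$$ $$\nabla_\omega\beta_\kappa=-2im_\kappa\pm2im_\kappa C_+(q\overline m_\kappa)\mp\tfrac i\pi\beta_\kappa m_\kappa\mp\tfrac i\pi\|m_\kappa\|_{L^2}^2\,q\quad\text{on }\mathbb T,$$ each of these being the unique vector with the defining property above. Let $$\mathcal P^\kappa_\beta=-2i(\mathcal L_q+\kappa)^{-1}\pm2im_\kappa C_+\overline m_\kappa\quad\text{on }\mathbb R,$$ $$\mathcal P^\kappa_\beta=-2i(\mathcal L_q+\kappa)^{-1}\pm2im_\kappa C_+\overline m_\kappa\mp\tfrac i\pi\beta_\kappa(\mathcal L_q+\kappa)^{-1}\mp\tfrac i\pi\|m_\kappa\|_{L^2}^2\quad\text{on }\mathbb T;$$ it maps $H^1_+$ into itself. Let $J\subseteq\mathbb R$ be an open interval and $q:J\to B_{M_*}$ a curve. Then: 1. $q$ solves $\partial_tq=\nabla_\omega\beta_\kappa(q)$ on $J$ if and only if $\partial_tq=\mathcal P^\kappa_\beta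 q$ on $J$. 2. If $q$ solves $\partial_tq=\nabla_\omega\beta_\kappa(q)$ on $J$, then $\partial_t\mathcal L_q=[\mathcal P^\kappa_\beta,\mathcal L_q]$ on $J$, that is, $\frac{d}{dt}(\mathcal L_{q(t)}u)=\mathcal P^\kappa_\beta\mathcal L_{q(t)}u-\mathcal L_{q(t)}\mathcal P^\kappa_\beta u$ in $L^2$ for every $u\in H^1_+$ and $t\in J$. 3. Conversely, up to a phase (which $\mathcal L_q$ does not see): if $q\in C^1(J;L^2)$, then $\partial_t\mathcal L_q=[\mathcal P^\kappa_\beta,\mathcal L_q]$ on $J$ if and only if there is a real-valued $\theta\in C^1(J)$ such that $e^{i\theta(t)}q(t)$ solves $\partial_tq=\nabla_\omega\beta_\kappa(q)$ on $J$. -/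

import Mathlib

open MeasureTheory Set
open scoped ENNReal Real FourierTransform ComplexConjugate

noncomputable section

namespace CalogeroMoser

/-- The complex Hilbert space `L²(X)`; its inner product is linear in the second argument. -/
abbrev L2 (X : Type) [MeasureSpace X] : Type := Lp ℂ 2 (volume : Measure X)

/-- The torus `ℝ / 2πℤ`, with Lebesgue measure of total mass `2π`. -/
abbrev Torus : Type := AddCircle (2 * π)

instance : Fact (0 < 2 * π) := ⟨Real.two_pi_pos⟩

/-- The class of a square integrable function in `L²` (and `0` if the function is not square
integrable). -/
def toL2 {X : Type} [MeasureSpace X] (f : X → ℂ) : L2 X :=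
  open Classical in if h : MemLp f 2 volume then h.toLp f else 0

/-- The pointwise product `f g` of two elements of `L²`, when it lies in `L²` again. -/
def mulL2 {X : Type} [MeasureSpace X] (f g : L2 X) : L2 X := toL2 fun x => f x * g x

infixl:72 " ⊙ " => mulL2

/-! ### Hardy spaces and derivatives through the Fourier transform -/

/-- `{f ∈ L²(ℝ) : f̂ = 0 a.e. on S}`. -/
def vanishLine (S : Set ℝ) : Submodule ℂ (L2 ℝ) where
  carrier := {f | ∀ᵐ ξ : ℝ, ξ ∈ S → (𝓕 f : L2 ℝ) ξ = 0}
  zero_mem' := by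
    have h : (𝓕 (0 : L2 ℝ) : L2 ℝ) = 0 := (Lp.fourierTransformₗᵢ ℝ ℂ).map_zero
    simp only [Set.mem_ofPred_eq, h]
    filter_upwards [Lp.coeFn_zero ℂ 2 (volume : Measure ℝ)] with x hx _
    simp
  add_mem' := by
    intro f g hf hg
    have h : (𝓕 (f + g) : L2 ℝ) = 𝓕 f + 𝓕 g := (Lp.fourierTransformₗᵢ ℝ ℂ).map_add f g
    simp only [Set.mem_ofPred_eq, h] at hf hg ⊢
    filter_upwards [hf, hg, Lp.coeFn_add (𝓕 f : L2 ℝ) (𝓕 g)] with x h1 h2 h3 hx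
    rw [h3, Pi.add_apply, h1 hx, h2 hx, add_zero]
  smul_mem' := by
    intro c f hf
    have h : (𝓕 (c • f) : L2 ℝ) = c • 𝓕 f := (Lp.fourierTransformₗᵢ ℝ ℂ).map_smul c f
    simp only [Set.mem_ofPred_eq, h] at hf ⊢
    filter_upwards [hf, Lp.coeFn_smul c (𝓕 f : L2 ℝ)] with x h1 h3 hx
    rw [h3, Pi.smul_apply, h1 hx, smul_zero]

lemma isClosed_vanishLine {S : Set ℝ} (hS : MeasurableSet S) :
    IsClosed (vanishLine S : Set (L2 ℝ)) := by
  have key : (vanishLine S : Set (L2 ℝ)) = {f : L2 ℝ |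
      LpToLpRestrictCLM ℝ ℂ ℂ volume 2 S (Lp.fourierTransformₗᵢ ℝ ℂ f) = 0} := by
    ext f
    change (∀ᵐ ξ : ℝ, ξ ∈ S → (𝓕 f : L2 ℝ) ξ = 0) ↔ _
    rw [← ae_restrict_iff' hS, Set.mem_ofPred_eq, Lp.eq_zero_iff_ae_eq_zero]
    have h := LpToLpRestrictCLM_coeFn (F := ℂ) (p := 2) (μ := (volume : Measure ℝ)) ℂ S (𝓕 f : L2 ℝ)
    constructor
    · intro h1
      exact h.trans h1
    · intro h1
      exact h.symm.trans h1
  rw [key]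
  exact isClosed_eq (by fun_prop) continuous_const

/-- The Fourier coefficient `(2π)⁻¹ ∫ e^{-inx} f(x) dx` is a continuous functional on `L²`. -/
lemma fourierCoeff_eq_inner (f : L2 Torus) (n : ℤ) :
    fourierCoeff (f : Torus → ℂ) n = ((2 * π)⁻¹ : ℝ) *
      inner ℂ (ContinuousMap.toLp (E := ℂ) 2 (volume : Measure Torus) ℂ (fourier n)) f := by
  have h1 : inner ℂ (ContinuousMap.toLp (E := ℂ) 2 (volume : Measure Torus) ℂ (fourier n)) f
      = ∫ x : Torus, fourier (-n) x • f x := by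
    rw [L2.inner_def]
    refine integral_congr_ae ?_
    filter_upwards [ContinuousMap.coeFn_toLp (p := 2) (𝕜 := ℂ) (volume : Measure Torus)
      (fourier n : C(Torus, ℂ))] with x hx
    rw [hx, RCLike.inner_apply, fourier_neg, smul_eq_mul, mul_comm]
  have h2 : ∀ g : Torus → ℂ, ∫ x : Torus, g x
      = ((2 * π : ℝ) : ℂ) * ∫ x : Torus, g x ∂AddCircle.haarAddCircle := by
    intro g
    rw [AddCircle.volume_eq_smul_haarAddCircle, integral_smul_measure,
      ENNReal.toReal_ofReal Real.two_pi_pos.le, Complex.real_smul]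
  have h3 : ((2 * π : ℝ) : ℂ) ≠ 0 := by exact_mod_cast Real.two_pi_pos.ne'
  rw [h1, h2, fourierCoeff, ← mul_assoc, Complex.ofReal_inv, inv_mul_cancel₀ h3, one_mul]

/-- `{f ∈ L²(𝕋) : f̂ = 0 on S}`. -/
def vanishTorus (S : Set ℤ) : Submodule ℂ (L2 Torus) where
  carrier := {f | ∀ n ∈ S, fourierCoeff (f : Torus → ℂ) n = 0}
  zero_mem' := by
    intro n _
    rw [fourierCoeff_eq_inner, inner_zero_right, mul_zero]
  add_mem' := by
    intro f g hf hg n hn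
    have h1 := hf n hn
    have h2 := hg n hn
    rw [fourierCoeff_eq_inner] at h1 h2 ⊢
    rw [inner_add_right, mul_add, h1, h2, add_zero]
  smul_mem' := by
    intro c f hf n hn
    have h1 := hf n hn
    rw [fourierCoeff_eq_inner] at h1 ⊢
    rw [inner_smul_right, mul_left_comm, h1, mul_zero]

lemma isClosed_vanishTorus (S : Set ℤ) : IsClosed (vanishTorus S : Set (L2 Torus)) := by
  have key : (vanishTorus S : Set (L2 Torus)) =
      ⋂ n ∈ S, {f : L2 Torus | fourierCoeff (f : Torus → ℂ) n = 0} := by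
    ext f
    simp [vanishTorus]
  rw [key]
  refine isClosed_biInter fun n _ => ?_
  simp only [fourierCoeff_eq_inner]
  exact isClosed_eq (by fun_prop) continuous_const

/-- The objects that depend on the geometry. The only two instances, given below, are the line
`ℝ` and the torus `ℝ / 2πℤ`. -/
class GeometryData (X : Type) [MeasureSpace X] where
  /-- the Hardy space `L²₊` -/
  hardyPlus : Submodule ℂ (L2 X)
  /-- the Hardy space `L²₋` -/
  hardyMinus : Submodule ℂ (L2 X)
  isClosed_hardyPlus : IsClosed (hardyPlus : Set (L2 X))
  isClosed_hardyMinus : IsClosed (hardyMinus : Set (L2 X))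
  /-- `IsDeriv f g` : the distributional derivative of `f ∈ L²` is `g ∈ L²` -/
  IsDeriv : L2 X → L2 X → Prop
  /-- the operator `∂̃⁻¹` on integrable real functions -/
  antideriv : (X → ℝ) → X → ℝ

/-- The line. With Mathlib's normalization `𝓕 f ξ = ∫ e^{-2πixξ} f(x) dx`, differentiation is
multiplication by `2πiξ` on the Fourier side. -/
instance : GeometryData ℝ where
  hardyPlus := vanishLine (Iio 0)
  hardyMinus := vanishLine (Ioi 0)
  isClosed_hardyPlus := isClosed_vanishLine measurableSet_Iio
  isClosed_hardyMinus := isClosed_vanishLine measurableSet_Ioi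
  IsDeriv f g := ∀ᵐ ξ : ℝ, (𝓕 g : L2 ℝ) ξ = 2 * π * Complex.I * ξ * (𝓕 f : L2 ℝ) ξ
  antideriv f x := (1 / 2) * ∫ y : ℝ, Real.sign (x - y) * f y

/-- The torus. -/
instance : GeometryData Torus where
  hardyPlus := vanishTorus (Iio 0)
  hardyMinus := vanishTorus (Ioi 0)
  isClosed_hardyPlus := isClosed_vanishTorus _
  isClosed_hardyMinus := isClosed_vanishTorus _
  IsDeriv f g := ∀ n : ℤ, fourierCoeff (g : Torus → ℂ) n
    = Complex.I * n * fourierCoeff (f : Torus → ℂ) n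
  antideriv f x := (1 / 2) * ∫ y in (0 : ℝ)..(2 * π), (1 - y / π) * f (x - (y : Torus))

open GeometryData

/-- The sign in the equation: the upper sign is the focusing case, the lower sign the defocusing
case. -/
inductive Sign : Type
  | focusing
  | defocusing

/-- The value of `±`. -/
def Sign.val : Sign → ℂ
  | .focusing => 1
  | .defocusing => -1

/-- The critical mass `M_*`. -/
def Sign.critMass : Sign → ℝ≥0∞
  | .focusing => ENNReal.ofReal (2 * π)
  | .defocusing => ⊤

section

variable {X : Type} [MeasureSpace X] [GeometryData X]

instance : CompleteSpace (hardyPlus (X := X)) :=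
  (isClosed_hardyPlus (X := X)).completeSpace_coe

instance : CompleteSpace (hardyMinus (X := X)) :=
  (isClosed_hardyMinus (X := X)).completeSpace_coe

/-- The Cauchy--Szegő projection `C₊`, the orthogonal projection of `L²` onto `L²₊`. -/
def Cplus (f : L2 X) : L2 X := (hardyPlus (X := X)).starProjection f

/-- The Cauchy--Szegő projection `C₋`, the orthogonal projection of `L²` onto `L²₋`. -/
def Cminus (f : L2 X) : L2 X := (hardyMinus (X := X)).starProjection f

/-- The mass `M(q) = ∫ |q|²`. -/
def mass (q : L2 X) : ℝ := ∫ x, ‖q x‖ ^ 2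

/-- The phase space `B_{M_*} = {q ∈ L²₊ : M(q) < M_*}`. -/
def phaseSpace (X : Type) [MeasureSpace X] [GeometryData X] (s : Sign) : Set (L2 X) :=
  {q | q ∈ hardyPlus (X := X) ∧ ENNReal.ofReal (mass q) < s.critMass}

/-- The Hardy--Sobolev space `H¹₊`, the domain of the Lax operator. -/
def sobolevPlus (X : Type) [MeasureSpace X] [GeometryData X] : Set (L2 X) :=
  {u | u ∈ hardyPlus (X := X) ∧ ∃ v, IsDeriv u v}

/-- The derivative `u'` (and `0` if `u` has no derivative in `L²`). -/
def dx (u : L2 X) : L2 X :=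
  open Classical in if h : ∃ v, IsDeriv u v then h.choose else 0

/-- The Lax operator `𝓛_q u = -i u' ∓ q C₊(q̄ u)`, for `u ∈ H¹₊`. -/
def lax (s : Sign) (q u : L2 X) : L2 X :=
  -(Complex.I • dx u) - s.val • (q ⊙ Cplus (star q ⊙ u))

/-- The resolvent `(𝓛_q + κ)⁻¹`: the solution `u ∈ H¹₊` of `𝓛_q u + κ u = f`
(and `0` if there is none). -/
def resolv (s : Sign) (κ : ℝ) (q f : L2 X) : L2 X :=
  open Classical in
  if h : ∃ u, u ∈ sobolevPlus X ∧ lax s q u + (κ : ℂ) • u = f then h.choose else 0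

/-- `m(κ, q) = (𝓛_q + κ)⁻¹ q`. -/
def mkappa (s : Sign) (κ : ℝ) (q : L2 X) : L2 X := resolv s κ q q

/-- `β(κ, q) = ⟨q, m(κ, q)⟩`. -/
def beta (s : Sign) (κ : ℝ) (q : L2 X) : ℂ := inner ℂ q (mkappa s κ q)

/-- `a` is the Wirtinger derivative `δF/δq̄` at `q`: `a ∈ L²₊` and, for some `b ∈ L²₋` (namely
`b = δF/δq`), the derivative of `F` at `q` in each direction `f ∈ L²₊` is `⟨f̄, b⟩ + ⟨f, a⟩`. -/
def IsWirtingerBar (F : L2 X → ℂ) (q a : L2 X) : Prop :=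
  a ∈ hardyPlus (X := X) ∧ ∃ b ∈ hardyMinus (X := X), ∀ f ∈ hardyPlus (X := X),
    HasDerivAt (fun ε : ℝ => F (q + (ε : ℂ) • f)) (inner ℂ (star f) b + inner ℂ f a) 0

/-- `Θ(q) g = i q ∂̃⁻¹ Re(q̄ g)`. -/
def Theta (q g : L2 X) : L2 X :=
  toL2 fun x => Complex.I * q x * (antideriv (fun y => (conj (q y) * g y).re) x : ℝ)

/-- `Ω(q) g = i (1 ∓ 2 C₊ Θ(q)) g`. -/
def Omega (s : Sign) (q g : L2 X) : L2 X :=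
  Complex.I • (g - (2 * s.val) • Cplus (Theta q g))

/-- The symplectic form `ω_q(f, g) = Re ⟨f, Ω(q) g⟩`. -/
def omega (s : Sign) (q f g : L2 X) : ℝ := (inner ℂ f (Omega s q g)).re

/-- `v` is the symplectic gradient `∇_ω F` at `q`: `v ∈ L²₊` and `dF|_q(f) = ω_q(f, v)` for all
`f ∈ L²₊`. -/
def IsSympGrad (s : Sign) (F : L2 X → ℂ) (q v : L2 X) : Prop :=
  v ∈ hardyPlus (X := X) ∧ ∀ f ∈ hardyPlus (X := X),
    HasDerivAt (fun ε : ℝ => F (q + (ε : ℂ) • f)) ((omega s q f v : ℝ) : ℂ) 0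

/-- The curve `q` solves the Hamiltonian flow `∂_t q = ∇_ω β_κ(q)` on the set `J` of times. -/
def SolvesFlow (s : Sign) (κ : ℝ) (J : Set ℝ) (q : ℝ → L2 X) : Prop :=
  ∀ t ∈ J, ∃ v, IsSympGrad s (beta s κ) (q t) v ∧ HasDerivAt q v t

/-- The Lax equation `∂_t 𝓛_q = [P, 𝓛_q]` on the set `J` of times, as an identity between operators
with domain `H¹₊`; here `P` may depend on `q`. -/
def LaxEquation (s : Sign) (P : L2 X → L2 X → L2 X) (J : Set ℝ) (q : ℝ → L2 X) : Prop :=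
  ∀ t ∈ J, ∀ u ∈ sobolevPlus X, HasDerivAt (fun τ : ℝ => lax s (q τ) u)
    (P (q t) (lax s (q t) u) - lax s (q t) (P (q t) u)) t

end

/-- The Peter operator `-2i(𝓛_q+κ)⁻¹ ± 2i m_κ C₊ m̄_κ` on the line, applied to `f`. -/
def peterLine (s : Sign) (κ : ℝ) (q f : L2 ℝ) : L2 ℝ :=
  -((2 * Complex.I) • resolv s κ q f)
    + (2 * Complex.I * s.val) • (mkappa s κ q ⊙ Cplus (star (mkappa s κ q) ⊙ f))

/-- The Peter operator
`-2i(𝓛_q+κ)⁻¹ ± 2i m_κ C₊ m̄_κ ∓ (i/π) β_κ (𝓛_q+κ)⁻¹ ∓ (i/π) ‖m_κ‖²` on the torus, applied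
to `f`. -/
def peterTorus (s : Sign) (κ : ℝ) (q f : L2 Torus) : L2 Torus :=
  -((2 * Complex.I) • resolv s κ q f)
    + (2 * Complex.I * s.val) • (mkappa s κ q ⊙ Cplus (star (mkappa s κ q) ⊙ f))
    - (s.val * (Complex.I / π) * beta s κ q) • resolv s κ q f
    - (s.val * (Complex.I / π) * (‖mkappa s κ q‖ ^ 2 : ℝ)) • f

end CalogeroMoser

end

open CalogeroMoser CalogeroMoser.GeometryData

/-!
The line and the torus are treated at once. A `FourierModel` of `X` is a unitary Fourier transform
from `L²(X)` onto `L²` of a dual group (`ℝ` for the line, `ℤ` for the torus) carrying a Haar measure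
and a frequency map, in terms of which the Hardy spaces and the derivative are described; an
`AntiderivModel` adds what is needed about `∂̃⁻¹`. The two geometries then differ only by the weight
`c₀` of the mean, `0` on the line and `1 / 2π` on the torus, and both cases of the theorem are
instances of `proposition_of_model`. Below, `D = -i∂`, `m = m_κ` and `C_>` is the projection to the
strictly positive frequencies.

*The Lax operator.* Elements of `H¹₊` have integrable Fourier transform, that is, they lie in the
Wiener algebra. By Hardy's inequality `u ↦ C₊(q̄ u)` maps `H¹₊` to the Wiener algebra as well
(`wiener_hankel`), so that `q C₊ q̄` maps `H¹₊` to `L²`. A Cauchy--Schwarz argument on the Fourier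
side gives `‖C₊(q̄ u)‖² ≤ ‖q‖² / 2π · (⟨u, D u⟩ + ‖u‖²)` (`norm_sq_hankel_le`), hence `𝓛_q > -1`
below the critical mass (`exists_form_bound`). A Neumann series inverts `𝓛_q + κ` for large `κ`, and
the form bound carries this down to `κ ≥ 1` (`exists_lax_eq`). Since `(𝓛_q + κ)(D + 1)⁻¹` is a
polynomial in `q ∈ L²` (`laxFactor`), `m` depends smoothly on `q`, and the derivative of `β_κ` is
found by differentiating the resolvent equation (`hasDerivAt_beta`).

*The symplectic gradient.* Write `v` for the asserted gradient. The equation for `m` gives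
`Re(q̄ v) = ∂|m|²`, so that `∂̃⁻¹ Re(q̄ v)` is `|m|²` minus its mean, and `Ω(q) v` equals twice the
derivative `δβ_κ/δq̄` (`Omega_hamVec`); this says that `v` is a symplectic gradient. It is the only
one because `Ω(q)` is injective: a kernel element leads to a fixed point of `± C_> q̄ D⁻¹ q`, and
this operator is negative in the defocusing case and has norm below one in the focusing case, where
the mass is subcritical (`Omega_injective`).

*The Lax pair.* The commutator of the Peter operator with `𝓛_q` is the variation of `𝓛_q` in the
direction `v` (`peter_commutator`), and the Peter operator maps `q` to `v` (`peter_self`). Hence a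
differentiable curve satisfies the Lax equation exactly when `e = q' - v(q)` does not change `𝓛_q`
to first order, that is, `e C₊(q̄ u) + q C₊(ē u) = 0` for all `u ∈ H¹₊` (`laxEquation_iff`). The
Szegő kernels `k` are common eigenvectors, `C₊(q̄ k) = ⟨q, k⟩ k`; testing with one of them shows that
`e` is an imaginary multiple of `q` (`exists_eq_smul_of_laxVariation_eq_zero`). It
follows that the mass is constant along the curve, that the multiple is continuous in time, and that
its integral is the phase which turns the curve into a solution of the flow
(`laxEquation_iff_exists_phase`).
-/

set_option linter.unusedSectionVars false

noncomputable section

namespace CalogeroMoser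

lemma inner_eq {X : Type} [MeasureSpace X] (f g : L2 X) : inner ℂ f g = ∫ x, conj (f x) * g x := by
  rw [L2.inner_def]
  refine integral_congr_ae (.of_forall fun ξ => ?_)
  simp only [RCLike.inner_apply]
  rw [mul_comm]

/-! ### Fourier models -/

/-- A description of `L²(X)` through a Fourier transform. The dual group `Γ` carries a Haar measure
`ν` and a frequency map `φ`; the transform `U` is normalized so that `f = ∫ U f(ξ) e_ξ dν(ξ)`. The
measure bounds encode `ν = dφ / 2π` on the line and `ν = (counting measure) / 2π` on the torus. -/
class FourierModel (X : Type) [MeasureSpace X] [GeometryData X] (Γ : outParam Type)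
    [AddCommGroup Γ] [MeasurableSpace Γ] where
  /-- the Haar measure of the dual group -/
  ν : Measure Γ
  sigmaFinite : SigmaFinite ν
  leftInvariant : ν.IsAddLeftInvariant
  negInvariant : ν.IsNegInvariant
  /-- the frequency -/
  φ : Γ →+ ℝ
  measurable_φ : Measurable φ
  /-- the characters -/
  e : Γ → X → ℂ
  measurable_e : Measurable (Function.uncurry e)
  e_add : ∀ ξ η x, e (ξ + η) x = e ξ x * e η x
  norm_e : ∀ ξ x, ‖e ξ x‖ = 1
  /-- the Fourier transform -/
  U : L2 X ≃ₗᵢ[ℂ] Lp ℂ 2 ν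
  inversion : ∀ f : L2 X, Integrable (U f : Γ → ℂ) ν → ∀ᵐ x, f x = ∫ ξ, U f ξ * e ξ x ∂ν
  mem_plus : ∀ f : L2 X, f ∈ hardyPlus (X := X) ↔ ∀ᵐ ξ ∂ν, φ ξ < 0 → U f ξ = 0
  mem_minus : ∀ f : L2 X, f ∈ hardyMinus (X := X) ↔ ∀ᵐ ξ ∂ν, 0 < φ ξ → U f ξ = 0
  isDeriv_iff : ∀ f g : L2 X, IsDeriv f g ↔ ∀ᵐ ξ ∂ν, U g ξ = Complex.I * φ ξ * U f ξ
  measure_pos_le : ∀ a, 0 ≤ a → ν {ξ | 0 < φ ξ ∧ φ ξ ≤ a} ≤ ENNReal.ofReal (a / (2 * π))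
  measure_nonneg_le : ∀ a, 0 ≤ a → ν {ξ | 0 ≤ φ ξ ∧ φ ξ ≤ a} ≤ ENNReal.ofReal ((a + 1) / (2 * π))
  poisson_ne_zero : ∀ x y : X,
    ∫ ξ in {ξ | 0 ≤ φ ξ}, (Real.exp (-φ ξ) : ℂ) * e (-ξ) x * e ξ y ∂ν ≠ 0

namespace FourierModel

section

variable (X : Type) {Γ : Type} [MeasureSpace X] [GeometryData X] [AddCommGroup Γ]
  [MeasurableSpace Γ] [FourierModel X Γ]

instance : SigmaFinite (ν X) := sigmaFinite
instance : (ν X).IsAddLeftInvariant := leftInvariant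
instance : (ν X).IsNegInvariant := negInvariant

end

section

variable {X Γ : Type} [MeasureSpace X] [GeometryData X] [AddCommGroup Γ]
  [MeasurableSpace Γ] [FourierModel X Γ]

lemma e_zero (x : X) : e (0 : Γ) x = 1 := by
  have h := e_add (0 : Γ) 0 x
  have h1 : e (0 : Γ) x ≠ 0 := by
    intro h0
    have := norm_e (0 : Γ) x
    rw [h0] at this
    simp at this
  rw [add_zero] at h
  exact (mul_eq_left₀ h1).1 h.symm

lemma e_neg (ξ : Γ) (x : X) : e (-ξ) x = conj (e ξ x) := by
  have h := e_add ξ (-ξ) x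
  rw [add_neg_cancel, e_zero] at h
  have h2 : e ξ x * conj (e ξ x) = 1 := by
    rw [Complex.mul_conj, Complex.normSq_eq_norm_sq, norm_e]; simp
  have h1 : e ξ x ≠ 0 := left_ne_zero_of_mul_eq_one h2
  exact mul_left_cancel₀ h1 (h.symm.trans h2.symm)

/-- Functions with equal Fourier transforms are equal. -/
lemma ext_U {f g : L2 X} (h : (U f : Γ → ℂ) =ᵐ[ν X] U g) : f = g :=
  U.injective (Lp.ext h)

lemma U_add (f g : L2 X) : (U (f + g) : Γ → ℂ) =ᵐ[ν X] fun ξ => U f ξ + U g ξ := by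
  rw [map_add]; exact Lp.coeFn_add _ _

lemma U_sub (f g : L2 X) : (U (f - g) : Γ → ℂ) =ᵐ[ν X] fun ξ => U f ξ - U g ξ := by
  rw [map_sub]; exact Lp.coeFn_sub _ _

lemma U_smul (c : ℂ) (f : L2 X) : (U (c • f) : Γ → ℂ) =ᵐ[ν X] fun ξ => c * U f ξ := by
  rw [map_smul]; exact Lp.coeFn_smul _ _

lemma memLp_U (f : L2 X) : MemLp (U f : Γ → ℂ) 2 (ν X) := Lp.memLp _

/-- The function with a prescribed square integrable Fourier transform. -/
def ofHat (X : Type) {Γ : Type} [MeasureSpace X] [GeometryData X] [AddCommGroup Γ]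
    [MeasurableSpace Γ] [FourierModel X Γ] {a : Γ → ℂ} (ha : MemLp a 2 (ν X)) : L2 X :=
  U.symm (ha.toLp a)

lemma U_ofHat {a : Γ → ℂ} (ha : MemLp a 2 (ν X)) : (U (ofHat X ha) : Γ → ℂ) =ᵐ[ν X] a := by
  rw [ofHat, LinearIsometryEquiv.apply_symm_apply]
  exact ha.coeFn_toLp

lemma inner_eq_U (f g : L2 X) : inner ℂ f g = ∫ ξ, conj (U f ξ) * U g ξ ∂(ν X) := by
  rw [← LinearIsometryEquiv.inner_map_map (U (X := X)) f g, L2.inner_def]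
  refine integral_congr_ae (.of_forall fun ξ => ?_)
  simp only [RCLike.inner_apply]
  rw [mul_comm]

lemma memLp_bdd_mul {b a : Γ → ℂ} (hb : Measurable b) {C : ℝ} (hC : ∀ ξ, ‖b ξ‖ ≤ C)
    (ha : MemLp a 2 (ν X)) : MemLp (fun ξ => b ξ * a ξ) 2 (ν X) := by
  refine MemLp.of_le_mul (c := C) ha (hb.aestronglyMeasurable.mul ha.1) (.of_forall fun ξ => ?_)
  rw [norm_mul]
  gcongr
  exact hC ξ

/-- The Fourier multiplier with a bounded symbol `b` (and `0` if `b` is not bounded and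
measurable). -/
def mult (X : Type) {Γ : Type} [MeasureSpace X] [GeometryData X] [AddCommGroup Γ]
    [MeasurableSpace Γ] [FourierModel X Γ] (b : Γ → ℂ) : L2 X →L[ℂ] L2 X :=
  open Classical in
  if h : Measurable b ∧ ∃ C : ℝ, ∀ ξ, ‖b ξ‖ ≤ C then
    LinearMap.mkContinuous
      { toFun := fun f => ofHat X (memLp_bdd_mul h.1 h.2.choose_spec (memLp_U f))
        map_add' := fun f g => ext_U <| by
          filter_upwards [U_ofHat (memLp_bdd_mul h.1 h.2.choose_spec (memLp_U (f + g))),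
            U_add (ofHat X (memLp_bdd_mul h.1 h.2.choose_spec (memLp_U f)))
              (ofHat X (memLp_bdd_mul h.1 h.2.choose_spec (memLp_U g))),
            U_ofHat (memLp_bdd_mul h.1 h.2.choose_spec (memLp_U f)),
            U_ofHat (memLp_bdd_mul h.1 h.2.choose_spec (memLp_U g)), U_add f g]
            with ξ h1 h2 h3 h4 h5
          rw [h1, h2, h3, h4, h5, mul_add]
        map_smul' := fun c f => ext_U <| by
          filter_upwards [U_ofHat (memLp_bdd_mul h.1 h.2.choose_spec (memLp_U (c • f))),
            U_smul c (ofHat X (memLp_bdd_mul h.1 h.2.choose_spec (memLp_U f))),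
            U_ofHat (memLp_bdd_mul h.1 h.2.choose_spec (memLp_U f)), U_smul c f]
            with ξ h1 h2 h3 h4
          simp only [RingHom.id_apply]
          rw [h1, h2, h3, h4, mul_left_comm] }
      h.2.choose (fun f => by
        change ‖ofHat X (memLp_bdd_mul h.1 h.2.choose_spec (memLp_U f))‖ ≤ _
        rw [← LinearIsometryEquiv.norm_map (U (X := X)) f,
          ← LinearIsometryEquiv.norm_map (U (X := X)) (ofHat X _)]
        refine Lp.norm_le_mul_norm_of_ae_le_mul ?_
        filter_upwards [U_ofHat (memLp_bdd_mul h.1 h.2.choose_spec (memLp_U f))] with ξ h1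
        rw [h1, norm_mul]
        gcongr
        exact h.2.choose_spec ξ)
  else 0

lemma U_mult {b : Γ → ℂ} (hb : Measurable b) {C : ℝ} (hC : ∀ ξ, ‖b ξ‖ ≤ C) (f : L2 X) :
    (U (mult X b f) : Γ → ℂ) =ᵐ[ν X] fun ξ => b ξ * U f ξ := by
  have h : Measurable b ∧ ∃ C : ℝ, ∀ ξ, ‖b ξ‖ ≤ C := ⟨hb, C, hC⟩
  rw [mult, dif_pos h]
  exact U_ofHat (memLp_bdd_mul h.1 h.2.choose_spec (memLp_U f))

/-- The multiplier with symbol the indicator function of a set of frequencies. -/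
lemma U_mult_indicator {s : Set ℝ} (hs : MeasurableSet s) (f : L2 X) :
    (U (mult X ((φ X ⁻¹' s).indicator 1) f) : Γ → ℂ) =ᵐ[ν X] (φ X ⁻¹' s).indicator (U f) := by
  have hm : Measurable ((φ X ⁻¹' s).indicator (1 : Γ → ℂ)) :=
    measurable_one.indicator (measurable_φ hs)
  refine (U_mult hm (C := 1) (fun ξ => ?_) f).trans (.of_forall fun ξ => ?_)
  · by_cases h : ξ ∈ φ X ⁻¹' s <;> simp [h]
  · by_cases h : ξ ∈ φ X ⁻¹' s <;> simp [h]

lemma eq_mult_indicator_of_starProjection {K : Submodule ℂ (L2 X)} [K.HasOrthogonalProjection]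
    {s : Set ℝ} (hs : MeasurableSet s)
    (hK : ∀ f : L2 X, f ∈ K ↔ ∀ᵐ ξ ∂(ν X), φ X ξ ∉ s → U f ξ = 0) (f : L2 X) :
    K.starProjection f = mult X ((φ X ⁻¹' s).indicator 1) f := by
  have hU := U_mult_indicator (X := X) hs f
  refine Submodule.eq_starProjection_of_mem_of_inner_eq_zero (K := K) ?_ ?_
  · rw [hK]
    filter_upwards [hU] with ξ h1 h2
    rw [h1]; exact indicator_of_notMem (s := φ X ⁻¹' s) h2 _
  · intro w hw
    rw [inner_eq_U]
    refine integral_eq_zero_of_ae ?_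
    filter_upwards [hU, (hK w).1 hw, U_sub f (mult X ((φ X ⁻¹' s).indicator 1) f)]
      with ξ h1 h2 h3
    rw [h3, h1]
    by_cases h : ξ ∈ φ X ⁻¹' s
    · simp [h]
    · simp [h2 h]

lemma Cplus_eq (f : L2 X) : Cplus f = mult X ((φ X ⁻¹' Ici 0).indicator 1) f :=
  eq_mult_indicator_of_starProjection (K := hardyPlus (X := X)) measurableSet_Ici
    (fun f => by simp [mem_plus]) f

lemma Cminus_eq (f : L2 X) : Cminus f = mult X ((φ X ⁻¹' Iic 0).indicator 1) f :=
  eq_mult_indicator_of_starProjection (K := hardyMinus (X := X)) measurableSet_Iic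
    (fun f => by simp [mem_minus]) f

lemma U_Cplus (f : L2 X) : (U (Cplus f) : Γ → ℂ) =ᵐ[ν X] (φ X ⁻¹' Ici 0).indicator (U f) := by
  rw [Cplus_eq]; exact U_mult_indicator measurableSet_Ici f

lemma U_Cminus (f : L2 X) : (U (Cminus f) : Γ → ℂ) =ᵐ[ν X] (φ X ⁻¹' Iic 0).indicator (U f) := by
  rw [Cminus_eq]; exact U_mult_indicator measurableSet_Iic f

/-- The projection onto the strictly positive frequencies. On the line it agrees with `C₊`. -/
def Cpos (f : L2 X) : L2 X := f - Cminus f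

lemma U_Cpos (f : L2 X) : (U (Cpos f) : Γ → ℂ) =ᵐ[ν X] (φ X ⁻¹' Ioi 0).indicator (U f) := by
  filter_upwards [U_sub f (Cminus f), U_Cminus f] with ξ h1 h2
  rw [Cpos, h1, h2]
  by_cases h : φ X ξ ≤ 0
  · simp [h]
  · simp [h, not_le.1 h]

end

end FourierModel

end CalogeroMoser

namespace CalogeroMoser

/-! ### Products in `L²` -/

section

variable {X : Type} [MeasureSpace X]

lemma coeFn_toL2 {f : X → ℂ} (h : MemLp f 2 volume) : (toL2 f : X → ℂ) =ᵐ[volume] f := by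
  rw [toL2, dif_pos h]
  exact h.coeFn_toLp

lemma coeFn_mul {f g : L2 X} (h : MemLp (fun x => f x * g x) 2 volume) :
    (f ⊙ g : X → ℂ) =ᵐ[volume] fun x => f x * g x :=
  coeFn_toL2 h

lemma mul_comm' (f g : L2 X) : f ⊙ g = g ⊙ f := by
  simp only [mulL2, mul_comm]

lemma coeFn_star' (f : L2 X) : ((star f : L2 X) : X → ℂ) =ᵐ[volume] fun x => conj (f x) :=
  Lp.coeFn_star f

lemma toL2_congr {f g : X → ℂ} (h : f =ᵐ[volume] g) : toL2 f = toL2 g := by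
  classical
  by_cases hf : MemLp f 2 volume
  · have hg := (memLp_congr_ae h).1 hf
    rw [toL2, toL2, dif_pos hf, dif_pos hg]
    exact (MemLp.toLp_eq_toLp_iff hf hg).2 h
  · have hg : ¬ MemLp g 2 volume := fun hg => hf ((memLp_congr_ae h).2 hg)
    rw [toL2, toL2, dif_neg hf, dif_neg hg]

lemma star_mul' {f g : L2 X} (h : MemLp (fun x => f x * g x) 2 volume) :
    star (f ⊙ g) = star f ⊙ star g := by
  have h2 : MemLp (fun x => (star f : L2 X) x * (star g : L2 X) x) 2 volume := by
    refine h.of_le ((Lp.aestronglyMeasurable _).mul (Lp.aestronglyMeasurable _)) ?_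
    filter_upwards [coeFn_star' f, coeFn_star' g] with x h1 h2
    rw [h1, h2]; simp
  refine Lp.ext ?_
  filter_upwards [coeFn_star' f, coeFn_star' g, coeFn_mul h, coeFn_mul h2, coeFn_star' (f ⊙ g)]
    with x h1 h2 h3 h4 h5
  rw [h5, h3, h4, h1, h2, map_mul]

lemma integrable_mul (f g : L2 X) : Integrable (fun x => f x * g x) volume :=
  (Lp.memLp f).integrable_mul (Lp.memLp g)

lemma integrable_conj_mul (f g : L2 X) : Integrable (fun x => conj (f x) * g x) volume := by
  refine (integrable_mul (star f) g).congr ?_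
  filter_upwards [coeFn_star' f] with x h1
  rw [h1]

lemma inner_star_star (f g : L2 X) : inner ℂ (star f) (star g) = inner ℂ g f := by
  rw [inner_eq, inner_eq]
  refine integral_congr_ae ?_
  filter_upwards [coeFn_star' f, coeFn_star' g] with x h1 h2
  rw [h1, h2, Complex.conj_conj, mul_comm]

lemma norm_star' (f : L2 X) : ‖(star f : L2 X)‖ = ‖f‖ := by
  rw [Lp.norm_def, Lp.norm_def]
  refine congrArg _ (eLpNorm_congr_norm_ae ?_)
  filter_upwards [coeFn_star' f] with x h1
  rw [h1, RCLike.norm_conj]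

lemma star_add' (f g : L2 X) : (star (f + g) : L2 X) = star f + star g := by
  refine Lp.ext ?_
  filter_upwards [coeFn_star' (f + g), coeFn_star' f, coeFn_star' g, Lp.coeFn_add f g,
    Lp.coeFn_add (star f : L2 X) (star g)] with x h1 h2 h3 h4 h5
  rw [h1, h5, Pi.add_apply, h2, h3, h4, Pi.add_apply, map_add]

lemma star_smul' (c : ℂ) (f : L2 X) : (star (c • f) : L2 X) = conj c • star f := by
  refine Lp.ext ?_
  filter_upwards [coeFn_star' (c • f), coeFn_star' f, Lp.coeFn_smul c f,
    Lp.coeFn_smul (conj c) (star f : L2 X)] with x h1 h2 h3 h4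
  rw [h1, h4, Pi.smul_apply, h2, h3, Pi.smul_apply, smul_eq_mul, smul_eq_mul, map_mul]

lemma star_sub' (f g : L2 X) : (star (f - g) : L2 X) = star f - star g := by
  have h : (star (-g) : L2 X) = -star g := by
    simpa using star_smul' (-1) g
  rw [sub_eq_add_neg, star_add', h, ← sub_eq_add_neg]

/-- Multiplication operators are moved across the inner product. -/
lemma inner_mul_right {f g h : L2 X} (h1 : MemLp (fun x => g x * h x) 2 volume)
    (h2 : MemLp (fun x => (star g : L2 X) x * f x) 2 volume) :
    inner ℂ f (g ⊙ h) = inner ℂ (star g ⊙ f) h := by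
  rw [inner_eq, inner_eq]
  refine integral_congr_ae ?_
  filter_upwards [coeFn_mul h1, coeFn_mul h2, coeFn_star' g] with x h3 h4 h5
  rw [h3, h4, h5, map_mul, Complex.conj_conj]
  ring

lemma norm_sq_eq_integral (f : L2 X) : ‖f‖ ^ 2 = ∫ x, ‖f x‖ ^ 2 := by
  have h := inner_self_eq_norm_sq (𝕜 := ℂ) f
  rw [← h, inner_eq]
  have h1 : ∀ x, conj (f x) * f x = ((‖f x‖ ^ 2 : ℝ) : ℂ) := fun x => by
    rw [← Complex.normSq_eq_conj_mul_self, Complex.normSq_eq_norm_sq]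
  simp only [h1]
  rw [integral_complex_ofReal]
  simp

end

namespace FourierModel

/-! ### The Wiener algebra -/

section

variable {X Γ : Type} [MeasureSpace X] [GeometryData X] [AddCommGroup Γ]
  [MeasurableSpace Γ] [FourierModel X Γ]

/-- `f ∈ L²` has an integrable Fourier transform. -/
def Wiener (f : L2 X) : Prop := Integrable (U f : Γ → ℂ) (ν X)

/-- The Wiener norm, the `L¹` norm of the Fourier transform. -/
def wnorm (f : L2 X) : ℝ := ∫ ξ, ‖U f ξ‖ ∂(ν X)

lemma measurable_U (f : L2 X) : Measurable (U f : Γ → ℂ) := (Lp.stronglyMeasurable _).measurable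

lemma Wiener.norm_le {f : L2 X} (hf : Wiener f) : ∀ᵐ x, ‖f x‖ ≤ wnorm f := by
  filter_upwards [inversion f hf] with x hx
  rw [hx, wnorm]
  refine (norm_integral_le_integral_norm _).trans_eq ?_
  simp only [norm_mul, norm_e, mul_one]

lemma Wiener.memLp_top {f : L2 X} (hf : Wiener f) : MemLp f ⊤ volume :=
  memLp_top_of_bound (Lp.aestronglyMeasurable _) _ hf.norm_le

lemma Wiener.memLp_mul {f : L2 X} (hf : Wiener f) (g : L2 X) :
    MemLp (fun x => f x * g x) 2 volume := by
  refine (Lp.memLp g).of_le_mul (c := wnorm f)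
    ((Lp.aestronglyMeasurable _).mul (Lp.aestronglyMeasurable _)) ?_
  filter_upwards [hf.norm_le] with x hx
  rw [norm_mul]
  gcongr

lemma Wiener.memLp_mul' {f : L2 X} (hf : Wiener f) (g : L2 X) :
    MemLp (fun x => g x * f x) 2 volume := by
  simpa only [mul_comm] using hf.memLp_mul g

lemma Wiener.norm_mul_le {f : L2 X} (hf : Wiener f) (g : L2 X) : ‖f ⊙ g‖ ≤ wnorm f * ‖g‖ := by
  refine Lp.norm_le_mul_norm_of_ae_le_mul ?_
  filter_upwards [hf.norm_le, coeFn_mul (hf.memLp_mul g)] with x hx h1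
  rw [h1, norm_mul]
  gcongr

lemma Wiener.of_ae {f : L2 X} {a : Γ → ℂ} (ha : Integrable a (ν X))
    (h : (U f : Γ → ℂ) =ᵐ[ν X] a) : Wiener f := ha.congr h.symm

lemma Wiener.of_le {f : L2 X} {a : Γ → ℝ} (ha : Integrable a (ν X))
    (h : ∀ᵐ ξ ∂(ν X), ‖U f ξ‖ ≤ a ξ) : Wiener f :=
  ha.mono' (Lp.aestronglyMeasurable _) h

lemma Wiener.indicator {f g : L2 X} {s : Set ℝ} (hs : MeasurableSet s)
    (h : (U g : Γ → ℂ) =ᵐ[ν X] (φ X ⁻¹' s).indicator (U f)) (hf : Wiener f) : Wiener g :=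
  Wiener.of_ae (Integrable.indicator hf (measurable_φ hs)) h

lemma Wiener.Cplus {f : L2 X} (hf : Wiener f) : Wiener (Cplus f) :=
  Wiener.indicator measurableSet_Ici (U_Cplus f) hf

lemma Wiener.add {f g : L2 X} (hf : Wiener f) (hg : Wiener g) : Wiener (f + g) :=
  Wiener.of_ae (Integrable.add hf hg) (U_add f g)

lemma Wiener.sub {f g : L2 X} (hf : Wiener f) (hg : Wiener g) : Wiener (f - g) :=
  Wiener.of_ae (Integrable.sub hf hg) (U_sub f g)

/-- The Wiener algebra is dense in `L²`: approximate the Fourier transform by simple functions. -/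
lemma exists_wiener_near (f : L2 X) {ε : ℝ} (hε : 0 < ε) : ∃ g : L2 X, Wiener g ∧ ‖f - g‖ < ε := by
  obtain ⟨g, hg, hgm⟩ := (memLp_U f).exists_simpleFunc_eLpNorm_sub_lt (by simp)
    (ε := ENNReal.ofReal ε) (by simpa using hε)
  refine ⟨ofHat X hgm, ?_, ?_⟩
  · refine Wiener.of_ae ?_ (U_ofHat hgm)
    exact (SimpleFunc.memLp_iff_integrable (by simp) (by simp)).1 hgm
  · rw [← LinearIsometryEquiv.norm_map (U (X := X)), Lp.norm_def]
    rw [← ENNReal.lt_ofReal_iff_toReal_lt (Lp.eLpNorm_ne_top _)]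
    refine lt_of_eq_of_lt (eLpNorm_congr_ae ?_) hg
    filter_upwards [U_sub f (ofHat X hgm), U_ofHat hgm] with ξ h1 h2
    rw [h1, h2, Pi.sub_apply]

/-- Two additive contractions of `L²` that agree on the Wiener algebra are equal. -/
lemma eq_of_eqOn_wiener {A B : L2 X → L2 X} (hA : ∀ f g, A (f - g) = A f - A g)
    (hB : ∀ f g, B (f - g) = B f - B g) (hA' : ∀ f, ‖A f‖ ≤ ‖f‖) (hB' : ∀ f, ‖B f‖ ≤ ‖f‖)
    (h : ∀ f, Wiener f → A f = B f) (f : L2 X) : A f = B f := by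
  rw [← sub_eq_zero, ← norm_le_zero_iff]
  refine le_of_forall_pos_le_add fun ε hε => ?_
  obtain ⟨g, hg, hgε⟩ := exists_wiener_near f (half_pos hε)
  have h1 : A f - B f = A (f - g) - B (f - g) := by
    rw [hA, hB, h g hg]; abel
  rw [h1, zero_add]
  refine (norm_sub_le _ _).trans ?_
  linarith [hA' (f - g), hB' (f - g)]

end

section

variable {X Γ : Type} [MeasureSpace X] [GeometryData X] [AddCommGroup Γ]
  [MeasurableSpace Γ] [MeasurableAdd₂ Γ] [MeasurableNeg Γ] [FourierModel X Γ]

lemma memLp_sub_right {a : Γ → ℂ} (ha : MemLp a 2 (ν X)) (η : Γ) :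
    MemLp (fun ξ => a (ξ - η)) 2 (ν X) :=
  ha.comp_measurePreserving (measurePreserving_sub_right (ν X) η)

lemma memLp_neg {a : Γ → ℂ} (ha : MemLp a 2 (ν X)) : MemLp (fun ξ => a (-ξ)) 2 (ν X) :=
  ha.comp_measurePreserving (Measure.measurePreserving_neg (ν X))

lemma measurable_e_right (ξ : Γ) : Measurable (fun x : X => e ξ x) :=
  measurable_e.comp (measurable_const.prodMk measurable_id)

lemma measurable_e_left (x : X) : Measurable (fun ξ : Γ => e ξ x) :=
  measurable_e.comp (measurable_id.prodMk measurable_const)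

/-- The product of `g ∈ L²` with the character `e_η`. -/
def modulate (η : Γ) (g : L2 X) : L2 X := toL2 fun x => e η x * g x

lemma memLp_modulate (η : Γ) (g : L2 X) : MemLp (fun x => e η x * g x) 2 volume :=
  (Lp.memLp g).of_le ((measurable_e_right η).aestronglyMeasurable.mul (Lp.aestronglyMeasurable _))
    (.of_forall fun x => by rw [norm_mul, norm_e, one_mul])

lemma coeFn_modulate (η : Γ) (g : L2 X) :
    (modulate η g : X → ℂ) =ᵐ[volume] fun x => e η x * g x :=
  coeFn_toL2 (memLp_modulate η g)

/-- Modulation is translation on the Fourier side. It follows from the inversion formula for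
functions in the Wiener algebra, and in general by density. -/
lemma U_modulate (η : Γ) (g : L2 X) :
    (U (modulate η g) : Γ → ℂ) =ᵐ[ν X] fun ξ => U g (ξ - η) := by
  have key : ∀ g : L2 X, modulate η g = ofHat X (memLp_sub_right (memLp_U g) η) := by
    refine eq_of_eqOn_wiener ?_ ?_ ?_ ?_ ?_
    · intro f g
      refine Lp.ext ?_
      filter_upwards [coeFn_modulate η (f - g), coeFn_modulate η f, coeFn_modulate η g,
        Lp.coeFn_sub f g, Lp.coeFn_sub (modulate η f) (modulate η g)] with x h1 h2 h3 h4 h5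
      rw [h1, h5, Pi.sub_apply, h2, h3, h4, Pi.sub_apply, mul_sub]
    · intro f g
      refine ext_U ?_
      have hq := (measurePreserving_sub_right (ν X) η).quasiMeasurePreserving.ae (U_sub f g)
      filter_upwards [U_ofHat (memLp_sub_right (memLp_U (f - g)) η),
        U_sub (ofHat X (memLp_sub_right (memLp_U f) η)) (ofHat X (memLp_sub_right (memLp_U g) η)),
        U_ofHat (memLp_sub_right (memLp_U f) η), U_ofHat (memLp_sub_right (memLp_U g) η), hq]
        with ξ h1 h2 h3 h4 h5
      rw [h1, h2, h3, h4, h5]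
    · intro f
      refine Lp.norm_le_norm_of_ae_le ?_
      filter_upwards [coeFn_modulate η f] with x h1
      rw [h1, norm_mul, norm_e, one_mul]
    · intro f
      rw [← LinearIsometryEquiv.norm_map (U (X := X)) f,
        ← LinearIsometryEquiv.norm_map (U (X := X)) (ofHat X _), Lp.norm_def, Lp.norm_def]
      refine le_of_eq (congrArg _ ?_)
      rw [eLpNorm_congr_ae (U_ofHat _)]
      exact eLpNorm_comp_measurePreserving (memLp_U f).1 (measurePreserving_sub_right (ν X) η)
    · intro f hf
      have hw : Wiener (ofHat X (memLp_sub_right (memLp_U f) η)) :=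
        Wiener.of_ae (Integrable.comp_sub_right hf η) (U_ofHat _)
      refine Lp.ext ?_
      filter_upwards [coeFn_modulate η f, inversion f hf, inversion _ hw] with x h1 h2 h3
      rw [h1, h2, h3]
      have h4 : ∫ ξ, U (ofHat X (memLp_sub_right (memLp_U f) η)) ξ * e ξ x ∂(ν X)
          = ∫ ξ, U f (ξ - η) * e ((ξ - η) + η) x ∂(ν X) := by
        refine integral_congr_ae ?_
        filter_upwards [U_ofHat (memLp_sub_right (memLp_U f) η)] with ξ h5
        rw [h5, sub_add_cancel]
      rw [h4, integral_sub_right_eq_self (μ := ν X) (fun ξ => U f ξ * e (ξ + η) x),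
        ← integral_const_mul]
      refine integral_congr_ae (.of_forall fun ξ => ?_)
      simp only [e_add]
      ring
  rw [key]
  exact U_ofHat _

/-- Complex conjugation on the Fourier side. -/
lemma U_star (g : L2 X) : (U (star g) : Γ → ℂ) =ᵐ[ν X] fun ξ => conj (U g (-ξ)) := by
  have hm : ∀ g : L2 X, MemLp (fun ξ => conj (U g (-ξ))) 2 (ν X) := fun g =>
    (memLp_neg (memLp_U g)).star
  have key : ∀ g : L2 X, star g = ofHat X (hm g) := by
    refine eq_of_eqOn_wiener ?_ ?_ ?_ ?_ ?_
    · intro f g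
      exact star_sub' f g
    · intro f g
      refine ext_U ?_
      have hq := (Measure.measurePreserving_neg (ν X)).quasiMeasurePreserving.ae (U_sub f g)
      filter_upwards [U_ofHat (hm (f - g)), U_sub (ofHat X (hm f)) (ofHat X (hm g)),
        U_ofHat (hm f), U_ofHat (hm g), hq] with ξ h1 h2 h3 h4 h5
      rw [h1, h2, h3, h4, h5, map_sub]
    · intro f
      exact (norm_star' f).le
    · intro f
      rw [← LinearIsometryEquiv.norm_map (U (X := X)) f,
        ← LinearIsometryEquiv.norm_map (U (X := X)) (ofHat X _), Lp.norm_def, Lp.norm_def]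
      refine le_of_eq (congrArg _ ?_)
      rw [eLpNorm_congr_ae (U_ofHat _)]
      rw [← eLpNorm_comp_measurePreserving (memLp_U f).1 (Measure.measurePreserving_neg (ν X))]
      exact eLpNorm_congr_norm_ae (.of_forall fun ξ => by simp)
    · intro f hf
      have hw : Wiener (ofHat X (hm f)) :=
        Wiener.of_le (Integrable.norm (Integrable.comp_neg hf)) (by
          filter_upwards [U_ofHat (hm f)] with ξ h1
          rw [h1]; simp)
      refine Lp.ext ?_
      filter_upwards [coeFn_star' f, inversion f hf, inversion _ hw] with x h1 h2 h3
      rw [h1, h2, h3]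
      have h4 : ∫ ξ, U (ofHat X (hm f)) ξ * e ξ x ∂(ν X)
          = ∫ ξ, conj (U f (-ξ) * e (-ξ) x) ∂(ν X) := by
        refine integral_congr_ae ?_
        filter_upwards [U_ofHat (hm f)] with ξ h5
        rw [h5, e_neg, map_mul, Complex.conj_conj]
      rw [h4, integral_neg_eq_self (fun ξ => conj (U f ξ * e ξ x)) (ν X), integral_conj]
  rw [key]
  exact U_ofHat _

lemma Wiener.star {f : L2 X} (hf : Wiener f) : Wiener (star f) :=
  Wiener.of_le (Integrable.norm (Integrable.comp_neg hf)) (by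
    filter_upwards [U_star f] with ξ h1
    rw [h1]; simp)

/-! ### Products and convolutions -/

/-- The integrand of a convolution of an `L¹` function with an `L²` function, integrated over a set
of finite measure, where `L² ⊂ L¹`. -/
lemma integrable_convolution {a b : Γ → ℂ} (hb : Measurable b)
    (ha1 : Integrable a (ν X)) (hb2 : MemLp b 2 (ν X)) {s : Set Γ} (hs : ν X s < ⊤) :
    Integrable (fun p : Γ × Γ => a p.2 * b (p.1 - p.2)) (((ν X).restrict s).prod (ν X)) := by
  have hm : AEStronglyMeasurable (fun p : Γ × Γ => a p.2 * b (p.1 - p.2))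
      (((ν X).restrict s).prod (ν X)) :=
    (ha1.1.comp_snd).mul (hb.comp (measurable_fst.sub measurable_snd)).aestronglyMeasurable
  refine ⟨hm, ?_⟩
  rw [hasFiniteIntegral_iff_enorm, lintegral_prod_symm _ hm.enorm]
  have hb3 : ∫⁻ ξ, ‖b ξ‖ₑ ^ 2 ∂(ν X) < ⊤ := by
    have := lintegral_rpow_enorm_lt_top_of_eLpNorm_lt_top (by simp) (by simp) hb2.2
    simpa using this
  have hle : ∀ η, ∫⁻ ξ in s, ‖a η * b (ξ - η)‖ₑ ∂(ν X)
      ≤ ‖a η‖ₑ * (ν X s + ∫⁻ ξ, ‖b ξ‖ₑ ^ 2 ∂(ν X)) := by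
    intro η
    simp only [enorm_mul]
    rw [lintegral_const_mul' _ _ (by simp)]
    gcongr
    calc ∫⁻ ξ in s, ‖b (ξ - η)‖ₑ ∂(ν X)
        ≤ ∫⁻ ξ in s, (1 + ‖b (ξ - η)‖ₑ ^ 2) ∂(ν X) := by
          refine lintegral_mono fun ξ => ?_
          rcases le_total ‖b (ξ - η)‖ₑ 1 with h | h
          · exact h.trans le_self_add
          · refine le_trans ?_ le_add_self
            rw [pow_two]
            exact le_mul_of_one_le_left' h
      _ = ν X s + ∫⁻ ξ in s, ‖b (ξ - η)‖ₑ ^ 2 ∂(ν X) := by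
          rw [lintegral_add_left measurable_const]; simp
      _ ≤ ν X s + ∫⁻ ξ, ‖b (ξ - η)‖ₑ ^ 2 ∂(ν X) := by
          gcongr
          exact Measure.restrict_le_self
      _ = _ := by
          rw [lintegral_sub_right_eq_self (fun ξ => ‖b ξ‖ₑ ^ 2) η]
  calc ∫⁻ η, ∫⁻ ξ in s, ‖a η * b (ξ - η)‖ₑ ∂(ν X) ∂(ν X)
      ≤ ∫⁻ η, ‖a η‖ₑ * (ν X s + ∫⁻ ξ, ‖b ξ‖ₑ ^ 2 ∂(ν X)) ∂(ν X) := lintegral_mono hle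
    _ = (∫⁻ η, ‖a η‖ₑ ∂(ν X)) * (ν X s + ∫⁻ ξ, ‖b ξ‖ₑ ^ 2 ∂(ν X)) :=
        lintegral_mul_const' _ _ (ENNReal.add_lt_top.2 ⟨hs, hb3⟩).ne
    _ < ⊤ := ENNReal.mul_lt_top ha1.2 (ENNReal.add_lt_top.2 ⟨hs, hb3⟩)

lemma ae_integrable_convolution {f : L2 X} (hf : Wiener f) (g : L2 X) :
    ∀ᵐ ξ ∂(ν X), Integrable (fun η => U f η * U g (ξ - η)) (ν X) := by
  refine ae_of_forall_measure_lt_top_ae_restrict _ fun s hs hsf => ?_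
  exact (integrable_convolution (X := X) (measurable_U g) hf (memLp_U g) hsf).prod_right_ae

/-- The Fourier transform of a product is the convolution of the Fourier transforms. -/
lemma U_mul [SFinite (volume : Measure X)] {f : L2 X} (hf : Wiener f) (g : L2 X) :
    (U (f ⊙ g) : Γ → ℂ) =ᵐ[ν X] fun ξ => ∫ η, U f η * U g (ξ - η) ∂(ν X) := by
  have hc : ∀ s, MeasurableSet s → ν X s < ⊤ →
      Integrable (fun p : Γ × Γ => U f p.2 * U g (p.1 - p.2)) (((ν X).restrict s).prod (ν X)) :=
    fun s _ hs => integrable_convolution (measurable_U g) hf (memLp_U g) hs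
  refine ae_eq_of_forall_setIntegral_eq_of_sigmaFinite (fun s hs hsf => ?_)
    (fun s hs hsf => (hc s hs hsf).integral_prod_left) (fun s hs hsf => ?_)
  · have : IsFiniteMeasure ((ν X).restrict s) := ⟨by simpa using hsf⟩
    exact ((memLp_U (f ⊙ g)).restrict s).integrable (by norm_num)
  · -- Both sides have the same integral over every set `s` of finite measure: the transform of
    -- `f g` is paired with the indicator function of `s`, and `f` is expanded by Fourier inversion.
    have hi : MemLp (s.indicator fun _ => (1 : ℂ)) 2 (ν X) :=
      memLp_indicator_const 2 hs 1 (Or.inr hsf.ne)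
    set w : L2 X := ofHat X hi with hw
    have hinner : ∀ h : L2 X, inner ℂ w h = ∫ ξ in s, U h ξ ∂(ν X) := by
      intro h
      rw [inner_eq_U, ← integral_indicator hs]
      refine integral_congr_ae ?_
      filter_upwards [U_ofHat hi] with ξ h1
      rw [h1]
      by_cases h : ξ ∈ s <;> simp [h]
    have hI : Integrable (fun p : X × Γ => (conj (w p.1) * g p.1) * U f p.2)
        (volume.prod (ν X)) := (integrable_conj_mul w g).mul_prod hf
    have hI2 : Integrable (fun p : X × Γ => (conj (w p.1) * g p.1) * U f p.2 * e p.2 p.1)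
        (volume.prod (ν X)) := by
      refine hI.mono (hI.1.mul ?_) (.of_forall fun p => by simp [norm_e])
      exact (measurable_e.comp measurable_swap).aestronglyMeasurable
    rw [← hinner, inner_eq]
    calc ∫ x, conj (w x) * (f ⊙ g) x
        = ∫ x, ∫ η, (conj (w x) * g x) * U f η * e η x ∂(ν X) := by
          refine integral_congr_ae ?_
          filter_upwards [coeFn_mul (hf.memLp_mul g), inversion f hf] with x h1 h2
          rw [h1, h2]
          simp only [mul_assoc]
          rw [integral_const_mul, integral_const_mul]
          ring
      _ = ∫ η, (∫ x, (conj (w x) * g x) * U f η * e η x) ∂(ν X) := integral_integral_swap hI2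
      _ = ∫ η, (∫ ξ in s, U f η * U g (ξ - η) ∂(ν X)) ∂(ν X) := by
          refine integral_congr_ae (.of_forall fun η => ?_)
          simp only
          rw [integral_const_mul]
          have h1 : ∫ ξ in s, U g (ξ - η) ∂(ν X) = inner ℂ w (modulate η g) := by
            rw [hinner]
            refine (integral_congr_ae (ae_restrict_of_ae ?_)).symm
            exact U_modulate η g
          rw [h1, inner_eq, ← integral_const_mul]
          refine integral_congr_ae ?_
          filter_upwards [coeFn_modulate η g] with x h2
          rw [h2]; ring
      _ = ∫ ξ in s, ∫ η, U f η * U g (ξ - η) ∂(ν X) ∂(ν X) :=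
          (integral_integral_swap (hc s hs hsf)).symm

end

end FourierModel

end CalogeroMoser

namespace CalogeroMoser

namespace FourierModel

/-! ### Projections and frequency supports -/

section

variable {X Γ : Type} [MeasureSpace X] [GeometryData X] [AddCommGroup Γ]
  [MeasurableSpace Γ] [fm : FourierModel X Γ]

include fm

lemma Cplus_add (f g : L2 X) : Cplus (f + g) = Cplus f + Cplus g := map_add _ _ _

lemma Cplus_sub (f g : L2 X) : Cplus (f - g) = Cplus f - Cplus g := map_sub _ _ _

lemma Cplus_smul (c : ℂ) (f : L2 X) : Cplus (c • f) = c • Cplus f := map_smul _ _ _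

lemma norm_Cplus_le (f : L2 X) : ‖Cplus f‖ ≤ ‖f‖ := Submodule.norm_starProjection_apply_le _ _

lemma inner_Cplus (f g : L2 X) : inner ℂ f (Cplus g) = inner ℂ (Cplus f) g :=
  (Submodule.inner_starProjection_left_eq_right _ _ _).symm

lemma Cplus_mem (f : L2 X) : Cplus f ∈ hardyPlus (X := X) := Submodule.starProjection_apply_mem _ _

lemma Cplus_of_mem {f : L2 X} (hf : f ∈ hardyPlus (X := X)) : Cplus f = f :=
  Submodule.starProjection_eq_self_iff.2 hf

lemma Cminus_of_mem {f : L2 X} (hf : f ∈ hardyMinus (X := X)) : Cminus f = f :=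
  Submodule.starProjection_eq_self_iff.2 hf

lemma inner_Cminus (f g : L2 X) : inner ℂ f (Cminus g) = inner ℂ (Cminus f) g :=
  (Submodule.inner_starProjection_left_eq_right _ _ _).symm

lemma Cpos_add (f g : L2 X) : Cpos (f + g) = Cpos f + Cpos g := by
  have h : Cminus (f + g) = Cminus f + Cminus g := map_add _ _ _
  simp only [Cpos, h]; abel

lemma Cpos_sub (f g : L2 X) : Cpos (f - g) = Cpos f - Cpos g := by
  have h : Cminus (f - g) = Cminus f - Cminus g := map_sub _ _ _
  simp only [Cpos, h]; abel

lemma Cpos_smul (c : ℂ) (f : L2 X) : Cpos (c • f) = c • Cpos f := by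
  have h : Cminus (c • f) = c • Cminus f := map_smul _ _ _
  simp only [Cpos, h, smul_sub]

lemma inner_Cpos (f g : L2 X) : inner ℂ f (Cpos g) = inner ℂ (Cpos f) g := by
  rw [Cpos, Cpos, inner_sub_right, inner_sub_left, inner_Cminus]

lemma norm_le_of_U_indicator {f g : L2 X} {s : Set Γ}
    (h : (U g : Γ → ℂ) =ᵐ[ν X] s.indicator (U f)) : ‖g‖ ≤ ‖f‖ := by
  rw [← LinearIsometryEquiv.norm_map (U (X := X)) f, ← LinearIsometryEquiv.norm_map (U (X := X)) g]
  refine Lp.norm_le_norm_of_ae_le ?_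
  filter_upwards [h] with ξ h1
  rw [h1]
  exact norm_indicator_le_norm_self _ _

lemma norm_Cpos_le (f : L2 X) : ‖Cpos f‖ ≤ ‖f‖ := norm_le_of_U_indicator (U_Cpos f)

/-- The frequencies of `f` lie in `s`. -/
def SuppIn (s : Set ℝ) (f : L2 X) : Prop := ∀ᵐ ξ ∂(ν X), φ X ξ ∉ s → U f ξ = 0

lemma mem_plus_iff {f : L2 X} : f ∈ hardyPlus (X := X) ↔ SuppIn (Ici 0) f := by
  simp [mem_plus, SuppIn]

lemma mem_minus_iff {f : L2 X} : f ∈ hardyMinus (X := X) ↔ SuppIn (Iic 0) f := by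
  simp [mem_minus, SuppIn]

lemma SuppIn.mono {s t : Set ℝ} (hst : s ⊆ t) {f : L2 X} (hf : SuppIn s f) : SuppIn t f := by
  filter_upwards [hf] with ξ h h1
  exact h fun h2 => h1 (hst h2)

lemma SuppIn.indicator {f g : L2 X} {s : Set ℝ}
    (h : (U g : Γ → ℂ) =ᵐ[ν X] (φ X ⁻¹' s).indicator (U f)) : SuppIn s g := by
  filter_upwards [h] with ξ h1 h2
  rw [h1]
  exact indicator_of_notMem (s := φ X ⁻¹' s) h2 _

lemma SuppIn.smul {s : Set ℝ} {f : L2 X} (hf : SuppIn s f) (c : ℂ) : SuppIn s (c • f) := by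
  filter_upwards [hf, U_smul c f] with ξ h1 h2 h3
  rw [h2, h1 h3, mul_zero]

lemma SuppIn.Cpos (f : L2 X) : SuppIn (Ioi 0) (Cpos f) := SuppIn.indicator (U_Cpos f)

lemma Cpos_mem_plus (f : L2 X) : Cpos f ∈ hardyPlus (X := X) :=
  mem_plus_iff.2 ((SuppIn.Cpos f).mono Ioi_subset_Ici_self)

lemma SuppIn.sub_Cplus (f : L2 X) : SuppIn (Iio 0) (f - CalogeroMoser.Cplus f) := by
  filter_upwards [U_sub f (CalogeroMoser.Cplus f), U_Cplus f] with ξ h1 h2 h3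
  have h4 : ξ ∈ φ X ⁻¹' Ici 0 := not_lt.1 (show ¬ φ X ξ < 0 from h3)
  rw [h1, h2, indicator_of_mem h4, sub_self]

lemma Cplus_eq_zero_iff {f : L2 X} : Cplus f = 0 ↔ SuppIn (Iio 0) f := by
  constructor
  · intro h
    simpa [h] using SuppIn.sub_Cplus f
  · intro h
    refine ext_U ?_
    have h0 : (U (0 : L2 X) : Γ → ℂ) =ᵐ[ν X] 0 := by
      rw [map_zero]; exact Lp.coeFn_zero _ _ _
    filter_upwards [U_Cplus f, h, h0] with ξ h1 h2 h3
    rw [h1, h3]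
    by_cases h4 : ξ ∈ φ X ⁻¹' Ici 0
    · rw [indicator_of_mem h4]
      exact h2 (show ¬ φ X ξ < 0 from not_lt.2 h4)
    · rw [indicator_of_notMem h4]; rfl

lemma Cpos_of_suppIn {f : L2 X} (hf : SuppIn (Ioi 0) f) : Cpos f = f := by
  refine ext_U ?_
  filter_upwards [U_Cpos f, hf] with ξ h1 h2
  rw [h1]
  by_cases h4 : ξ ∈ φ X ⁻¹' Ioi 0
  · rw [indicator_of_mem h4]
  · rw [indicator_of_notMem h4, h2 h4]

lemma Cpos_of_mem_minus {f : L2 X} (hf : f ∈ hardyMinus (X := X)) : Cpos f = 0 := by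
  rw [Cpos, Cminus_of_mem hf, sub_self]

end

section

variable {X Γ : Type} [MeasureSpace X] [GeometryData X] [AddCommGroup Γ]
  [MeasurableSpace Γ] [MeasurableAdd₂ Γ] [MeasurableNeg Γ] [fm : FourierModel X Γ]

include fm

lemma SuppIn.star {s t : Set ℝ} (hst : ∀ a ∈ s, -a ∈ t) {f : L2 X} (hf : SuppIn s f) :
    SuppIn t (star f) := by
  filter_upwards [U_star f, (Measure.measurePreserving_neg (ν X)).quasiMeasurePreserving.ae hf]
    with ξ h1 h2 h3
  rw [h1, h2 ?_, map_zero]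
  intro h4
  have := hst _ h4
  rw [map_neg, neg_neg] at this
  exact h3 this

lemma star_mem_minus {f : L2 X} (hf : f ∈ hardyPlus (X := X)) : star f ∈ hardyMinus (X := X) :=
  mem_minus_iff.2 (SuppIn.star (s := Ici 0) (fun a ha => by simpa using ha) (mem_plus_iff.1 hf))

lemma star_Cplus (f : L2 X) : star (Cplus f) = Cminus (star f) := by
  refine ext_U ?_
  have hq := (Measure.measurePreserving_neg (ν X)).quasiMeasurePreserving.ae (U_Cplus f)
  filter_upwards [U_star (Cplus f), U_Cminus (star f), U_star f, hq] with ξ h1 h2 h3 h4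
  rw [h1, h2, h4]
  by_cases h : φ X ξ ≤ 0
  · simp [h, h3]
  · simp [h]

/-- A function is the sum of its strictly positive and of its nonpositive frequencies. -/
lemma eq_Cpos_add_star (f : L2 X) : f = Cpos f + star (Cplus (star f)) := by
  rw [star_Cplus, star_star, Cpos, sub_add_cancel]

/-- Frequencies add up in a product. -/
lemma SuppIn.mul [SFinite (volume : Measure X)] {s t r : Set ℝ}
    (hst : ∀ a ∈ s, ∀ b ∈ t, a + b ∈ r) {f g : L2 X} (hw : Wiener f)
    (hf : SuppIn s f) (hg : SuppIn t g) : SuppIn r (f ⊙ g) := by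
  filter_upwards [U_mul hw g] with ξ h1 h2
  rw [h1]
  refine integral_eq_zero_of_ae ?_
  have hq := (Measure.measurePreserving_sub_left (ν X) ξ).quasiMeasurePreserving.ae hg
  filter_upwards [hf, hq] with η h3 h4
  by_cases h5 : φ X η ∈ s
  · by_cases h6 : φ X (ξ - η) ∈ t
    · refine absurd ?_ h2
      have := hst _ h5 _ h6
      rwa [← map_add, add_sub_cancel] at this
    · rw [h4 h6, mul_zero]; rfl
  · rw [h3 h5, zero_mul]; rfl

lemma Wiener.mul_mem_plus [SFinite (volume : Measure X)] {f g : L2 X} (hw : Wiener f)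
    (hf : f ∈ hardyPlus (X := X)) (hg : g ∈ hardyPlus (X := X)) : f ⊙ g ∈ hardyPlus (X := X) :=
  mem_plus_iff.2 (SuppIn.mul (r := Ici 0) (s := Ici 0) (t := Ici 0)
    (fun _ ha _ hb => by simpa using add_nonneg ha hb) hw (mem_plus_iff.1 hf)
    (mem_plus_iff.1 hg))

lemma Wiener.mul_mem_minus [SFinite (volume : Measure X)] {f g : L2 X} (hw : Wiener f)
    (hf : f ∈ hardyMinus (X := X)) (hg : g ∈ hardyMinus (X := X)) :
    f ⊙ g ∈ hardyMinus (X := X) :=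
  mem_minus_iff.2 (SuppIn.mul (r := Iic 0) (s := Iic 0) (t := Iic 0)
    (fun _ ha _ hb => by simpa using add_nonpos ha hb) hw (mem_minus_iff.1 hf)
    (mem_minus_iff.1 hg))

/-! ### Derivatives -/

/-- The tails of the weight `(1 + φ)⁻²`. By the layer cake formula this follows from the bound on
the measure of frequency intervals alone. -/
lemma lintegral_weight_tail {a : ℝ} (ha : 0 ≤ a) :
    ∫⁻ ξ in {ξ | a ≤ φ X ξ}, ENNReal.ofReal (((1 + φ X ξ) ^ 2)⁻¹) ∂(ν X)
      ≤ ENNReal.ofReal (2 / (1 + a)) := by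
  have hmeas : MeasurableSet {ξ : Γ | a ≤ φ X ξ} := measurableSet_le measurable_const measurable_φ
  have hmf : Measurable fun ξ : Γ => ((1 + φ X ξ) ^ 2)⁻¹ :=
    ((measurable_const.add measurable_φ).pow_const 2).inv
  rw [lintegral_eq_lintegral_meas_lt _ (.of_forall fun ξ => by positivity) hmf.aemeasurable]
  have h1a : (0 : ℝ) < 1 + a := by linarith
  set c : ℝ := ((1 + a) ^ 2)⁻¹ with hc
  have hc0 : 0 < c := by positivity
  have hbound : ∀ t ∈ Ioi (0 : ℝ), (ν X).restrict {ξ | a ≤ φ X ξ} {ξ | t < ((1 + φ X ξ) ^ 2)⁻¹}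
      ≤ (Ioc 0 c).indicator (fun t => ENNReal.ofReal (t ^ (-(1 / 2) : ℝ))) t := by
    intro t ht
    have ht0 : 0 < t := ht
    rw [Measure.restrict_apply (measurableSet_lt measurable_const hmf)]
    by_cases htc : t ≤ c
    · rw [indicator_of_mem (show t ∈ Ioc 0 c from ⟨ht, htc⟩)]
      set b : ℝ := t ^ (-(1 / 2) : ℝ) with hb
      have hbt : b ^ 2 = t⁻¹ := by
        rw [hb, ← Real.rpow_natCast, ← Real.rpow_mul ht0.le]
        norm_num [Real.rpow_neg_one]
      have hb0 : 0 < b := Real.rpow_pos_of_pos ht0 _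
      have hb1 : 1 ≤ b := by
        have : 1 ≤ b ^ 2 := by
          rw [hbt]
          refine (one_le_inv₀ ht0).2 (htc.trans ?_)
          rw [hc]
          exact inv_le_one_of_one_le₀ (by nlinarith)
        nlinarith
      calc ν X ({ξ | t < ((1 + φ X ξ) ^ 2)⁻¹} ∩ {ξ | a ≤ φ X ξ})
          ≤ ν X {ξ | 0 ≤ φ X ξ ∧ φ X ξ ≤ b - 1} := by
            refine measure_mono fun ξ hξ => ?_
            have h1 : t < ((1 + φ X ξ) ^ 2)⁻¹ := hξ.1
            have h2 : a ≤ φ X ξ := hξ.2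
            have h3 : (1 + φ X ξ) ^ 2 < b ^ 2 := by
              rw [hbt]
              exact (lt_inv_comm₀ ht0 (by nlinarith)).1 h1
            refine ⟨ha.trans h2, ?_⟩
            have := lt_of_pow_lt_pow_left₀ 2 hb0.le h3
            linarith
        _ ≤ ENNReal.ofReal ((b - 1 + 1) / (2 * π)) := measure_nonneg_le _ (by linarith)
        _ ≤ ENNReal.ofReal b := by
            refine ENNReal.ofReal_le_ofReal ?_
            rw [sub_add_cancel, div_le_iff₀ Real.two_pi_pos]
            nlinarith [Real.pi_gt_three]
    · have : {ξ | t < ((1 + φ X ξ) ^ 2)⁻¹} ∩ {ξ | a ≤ φ X ξ} = ∅ := by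
        ext ξ
        simp only [mem_inter_iff, mem_ofPred_eq, mem_empty_iff_false, iff_false, not_and, not_le]
        intro h1
        by_contra h2
        push Not at h2
        refine htc (h1.le.trans ?_)
        rw [hc]
        gcongr
      rw [this, measure_empty]
      exact zero_le
  calc ∫⁻ t in Ioi (0 : ℝ), (ν X).restrict {ξ | a ≤ φ X ξ} {ξ | t < ((1 + φ X ξ) ^ 2)⁻¹}
      ≤ ∫⁻ t in Ioi (0 : ℝ), (Ioc 0 c).indicator (fun t => ENNReal.ofReal (t ^ (-(1 / 2) : ℝ))) t :=
        setLIntegral_mono' measurableSet_Ioi hbound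
    _ ≤ ∫⁻ t, (Ioc 0 c).indicator (fun t => ENNReal.ofReal (t ^ (-(1 / 2) : ℝ))) t :=
        setLIntegral_le_lintegral _ _
    _ = ∫⁻ t in Ioc 0 c, ENNReal.ofReal (t ^ (-(1 / 2) : ℝ)) := lintegral_indicator measurableSet_Ioc _
    _ = ENNReal.ofReal (∫ t in Ioc 0 c, t ^ (-(1 / 2) : ℝ)) := by
        rw [ofReal_integral_eq_lintegral_ofReal]
        · refine (intervalIntegrable_iff_integrableOn_Ioc_of_le hc0.le).1 ?_
          exact intervalIntegral.intervalIntegrable_rpow' (by norm_num)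
        · filter_upwards [ae_restrict_mem measurableSet_Ioc] with t ht
          exact Real.rpow_nonneg ht.1.le _
    _ = ENNReal.ofReal (2 / (1 + a)) := by
        rw [← intervalIntegral.integral_of_le hc0.le, integral_rpow (Or.inl (by norm_num))]
        congr 1
        have h2 : c ^ (1 / 2 : ℝ) = (1 + a)⁻¹ := by
          rw [hc, ← Real.sqrt_eq_rpow, ← inv_pow, Real.sqrt_sq (by positivity)]
        rw [show (-(1 / 2) + 1 : ℝ) = 1 / 2 by norm_num, h2, Real.zero_rpow (by norm_num)]
        field_simp
        norm_num

lemma integrable_weight : Integrable (fun ξ => ((1 + |φ X ξ|) ^ 2)⁻¹) (ν X) := by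
  have hm : Measurable fun ξ : Γ => ((1 + |φ X ξ|) ^ 2)⁻¹ :=
    ((measurable_const.add (_root_.measurable_abs.comp measurable_φ)).pow_const 2).inv
  have h0 : IntegrableOn (fun ξ => ((1 + |φ X ξ|) ^ 2)⁻¹) {ξ | 0 ≤ φ X ξ} (ν X) := by
    refine ⟨hm.aestronglyMeasurable, ?_⟩
    rw [hasFiniteIntegral_iff_ofReal (.of_forall fun ξ => by positivity)]
    refine lt_of_le_of_lt ?_ (ENNReal.ofReal_lt_top (r := 2 / (1 + 0)))
    refine le_trans (le_of_eq ?_) (lintegral_weight_tail (X := X) le_rfl)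
    refine setLIntegral_congr_fun (measurableSet_le measurable_const measurable_φ) fun ξ hξ => ?_
    have : 0 ≤ φ X ξ := hξ
    simp only [abs_of_nonneg this]
  have h1 : IntegrableOn (fun ξ => ((1 + |φ X ξ|) ^ 2)⁻¹) {ξ | φ X ξ ≤ 0} (ν X) := by
    have hmp := Measure.measurePreserving_neg (ν X)
    have h2 := (hmp.integrableOn_comp_preimage (MeasurableEquiv.neg Γ).measurableEmbedding).2 h0
    have h3 : (fun ξ : Γ => -ξ) ⁻¹' {ξ | 0 ≤ φ X ξ} = {ξ | φ X ξ ≤ 0} := by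
      ext ξ; simp
    have h4 : (Neg.neg : Γ → Γ) ⁻¹' {ξ | 0 ≤ φ X ξ} = {ξ | φ X ξ ≤ 0} := h3
    rw [h4] at h2
    refine h2.congr (.of_forall fun ξ => ?_)
    simp
  rw [← integrableOn_univ]
  refine (h0.union h1).mono_set fun ξ _ => ?_
  exact le_total 0 (φ X ξ)

/-- A function with a derivative in `L²` lies in the Wiener algebra, by the Cauchy--Schwarz
inequality with the weight `(1 + |φ|)⁻²`. -/
lemma IsDeriv.wiener {u v : L2 X} (h : IsDeriv u v) : Wiener u := by
  have hw := integrable_weight (X := X)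
  have h1 : Integrable (fun ξ => (‖U u ξ‖ + ‖U v ξ‖) ^ 2) (ν X) := by
    exact ((memLp_U u).norm.add (memLp_U v).norm).integrable_sq
  refine Wiener.of_le (hw.add h1) ?_
  filter_upwards [(isDeriv_iff u v).1 h] with ξ h2
  have h3 : ‖U v ξ‖ = |φ X ξ| * ‖U u ξ‖ := by
    rw [h2]; simp
  simp only [Pi.add_apply]
  rw [h3]
  set x := |φ X ξ|
  have hx : 0 ≤ x := abs_nonneg _
  set y := ‖U u ξ‖
  have hy : 0 ≤ y := norm_nonneg _
  have h4 : (y + x * y) = (1 + x) * y := by ring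
  rw [h4]
  have h5 : y = (1 + x)⁻¹ * ((1 + x) * y) := by field_simp
  rw [← inv_pow]
  calc y = (1 + x)⁻¹ * ((1 + x) * y) := h5
    _ ≤ _ := by
      nlinarith [sq_nonneg ((1 + x)⁻¹ - (1 + x) * y), sq_nonneg ((1 + x)⁻¹), sq_nonneg ((1 + x) * y)]

lemma IsDeriv.unique {u v w : L2 X} (h1 : IsDeriv u v) (h2 : IsDeriv u w) : v = w := by
  refine ext_U ?_
  filter_upwards [(isDeriv_iff u v).1 h1, (isDeriv_iff u w).1 h2] with ξ h3 h4
  rw [h3, h4]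

lemma IsDeriv.dx_eq {u v : L2 X} (h : IsDeriv u v) : dx u = v := by
  have h1 : ∃ v, IsDeriv u v := ⟨v, h⟩
  rw [dx, dif_pos h1]
  exact IsDeriv.unique h1.choose_spec h

lemma isDeriv_dx {u : L2 X} (hu : u ∈ sobolevPlus X) : IsDeriv u (dx u) := by
  obtain ⟨v, hv⟩ := hu.2
  rwa [IsDeriv.dx_eq hv]

lemma wiener_of_sobolevPlus {u : L2 X} (hu : u ∈ sobolevPlus X) : Wiener u :=
  IsDeriv.wiener (isDeriv_dx hu)

lemma IsDeriv.add {u v u' v' : L2 X} (hu : IsDeriv u u') (hv : IsDeriv v v') :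
    IsDeriv (u + v) (u' + v') := by
  rw [isDeriv_iff] at *
  filter_upwards [hu, hv, U_add u v, U_add u' v'] with ξ h1 h2 h3 h4
  rw [h4, h3, h1, h2]; ring

lemma IsDeriv.smul {u u' : L2 X} (hu : IsDeriv u u') (c : ℂ) : IsDeriv (c • u) (c • u') := by
  rw [isDeriv_iff] at *
  filter_upwards [hu, U_smul c u, U_smul c u'] with ξ h1 h2 h3
  rw [h3, h2, h1]; ring

lemma IsDeriv.star {u u' : L2 X} (hu : IsDeriv u u') : IsDeriv (star u) (star u') := by
  rw [isDeriv_iff] at *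
  have hq := (Measure.measurePreserving_neg (ν X)).quasiMeasurePreserving.ae hu
  filter_upwards [hq, U_star u, U_star u'] with ξ h1 h2 h3
  rw [h3, h2, h1]
  simp

lemma IsDeriv.Cplus {u u' : L2 X} (hu : IsDeriv u u') : IsDeriv (Cplus u) (Cplus u') := by
  rw [isDeriv_iff] at *
  filter_upwards [hu, U_Cplus u, U_Cplus u'] with ξ h1 h2 h3
  rw [h3, h2]
  by_cases h : ξ ∈ φ X ⁻¹' Ici 0
  · simp only [indicator_of_mem h, h1]
  · simp only [indicator_of_notMem h, mul_zero]

/-- The product rule. -/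
lemma IsDeriv.mul [SFinite (volume : Measure X)] {u v u' v' : L2 X} (hu : IsDeriv u u')
    (hv : IsDeriv v v') : IsDeriv (u ⊙ v) (v ⊙ u' + u ⊙ v') := by
  have hwu := IsDeriv.wiener hu
  have hwv := IsDeriv.wiener hv
  rw [isDeriv_iff] at *
  filter_upwards [U_add (v ⊙ u') (u ⊙ v'), U_mul hwv u', U_mul hwu v', U_mul hwu v,
    ae_integrable_convolution hwv u', ae_integrable_convolution hwu v'] with ξ h1 h2 h3 h4 h5 h6
  rw [h1, h2, h3, h4, ← integral_sub_left_eq_self (fun η => U v η * U u' (ξ - η)) (ν X) ξ,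
    ← integral_add ?_ h6, ← integral_const_mul]
  · refine integral_congr_ae ?_
    have hq := (Measure.measurePreserving_sub_left (ν X) ξ).quasiMeasurePreserving.ae hv
    filter_upwards [hu, hq] with η h7 h8
    rw [sub_sub_cancel, h7, h8, map_sub]
    push_cast
    ring
  · exact h5.comp_sub_left ξ

lemma sobolevPlus_add {u v : L2 X} (hu : u ∈ sobolevPlus X) (hv : v ∈ sobolevPlus X) :
    u + v ∈ sobolevPlus X :=
  ⟨add_mem hu.1 hv.1, _, IsDeriv.add (isDeriv_dx hu) (isDeriv_dx hv)⟩

lemma sobolevPlus_smul {u : L2 X} (hu : u ∈ sobolevPlus X) (c : ℂ) : c • u ∈ sobolevPlus X :=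
  ⟨Submodule.smul_mem _ _ hu.1, _, IsDeriv.smul (isDeriv_dx hu) c⟩

lemma sobolevPlus_mul [SFinite (volume : Measure X)] {u v : L2 X} (hu : u ∈ sobolevPlus X)
    (hv : v ∈ sobolevPlus X) : u ⊙ v ∈ sobolevPlus X :=
  ⟨(wiener_of_sobolevPlus hu).mul_mem_plus hu.1 hv.1, _, IsDeriv.mul (isDeriv_dx hu) (isDeriv_dx hv)⟩

lemma dx_add {u v : L2 X} (hu : u ∈ sobolevPlus X) (hv : v ∈ sobolevPlus X) :
    dx (u + v) = dx u + dx v :=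
  IsDeriv.dx_eq (IsDeriv.add (isDeriv_dx hu) (isDeriv_dx hv))

lemma dx_smul {u : L2 X} (hu : u ∈ sobolevPlus X) (c : ℂ) : dx (c • u) = c • dx u :=
  IsDeriv.dx_eq (IsDeriv.smul (isDeriv_dx hu) c)

lemma dx_mem_plus {u : L2 X} (hu : u ∈ sobolevPlus X) : dx u ∈ hardyPlus (X := X) := by
  have h := hu.1
  rw [mem_plus] at h ⊢
  filter_upwards [h, (isDeriv_iff _ _).1 (isDeriv_dx hu)] with ξ h1 h2 h3
  rw [h2, h1 h3, mul_zero]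

end

end FourierModel

end CalogeroMoser

namespace CalogeroMoser

namespace FourierModel

/-! ### Hardy's inequality -/

lemma ennreal_two_mul_le (a b : ℝ≥0∞) : 2 * (a * b) ≤ a ^ 2 + b ^ 2 := by
  have key : ∀ a c : ℝ≥0∞, 2 * (a * (a + c)) ≤ a ^ 2 + (a + c) ^ 2 := by
    intro a c
    have : a ^ 2 + (a + c) ^ 2 = 2 * (a * (a + c)) + c ^ 2 := by ring
    rw [this]
    exact le_self_add
  rcases le_total a b with h | h
  · obtain ⟨c, rfl⟩ := exists_add_of_le h
    exact key a c
  · obtain ⟨c, rfl⟩ := exists_add_of_le h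
    rw [mul_comm (b + c) b, add_comm ((b + c) ^ 2)]
    exact key b c

section

variable {X Γ : Type} [MeasureSpace X] [GeometryData X] [AddCommGroup Γ]
  [MeasurableSpace Γ] [fm : FourierModel X Γ]

/-- The integral of `b` over the frequencies that are at most `φ η`. -/
def primitive (X : Type) {Γ : Type} [MeasureSpace X] [GeometryData X] [AddCommGroup Γ]
    [MeasurableSpace Γ] [FourierModel X Γ] (b : Γ → ℝ≥0∞) (η : Γ) : ℝ≥0∞ :=
  ∫⁻ ζ in {ζ | φ X ζ ≤ φ X η}, b ζ ∂(ν X)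

lemma measurableSet_le_freq : MeasurableSet {p : Γ × Γ | φ X p.1 ≤ φ X p.2} :=
  measurableSet_le (measurable_φ.comp measurable_fst) (measurable_φ.comp measurable_snd)

lemma measurableSet_freq_le (a : ℝ) : MeasurableSet {ζ : Γ | φ X ζ ≤ a} :=
  measurableSet_le measurable_φ measurable_const

lemma measurableSet_le_freq' (a : ℝ) : MeasurableSet {ζ : Γ | a ≤ φ X ζ} :=
  measurableSet_le measurable_const measurable_φ

lemma primitive_eq (b : Γ → ℝ≥0∞) (η : Γ) :
    primitive X b η = ∫⁻ ζ, {p : Γ × Γ | φ X p.1 ≤ φ X p.2}.indicator (fun p => b p.1) (ζ, η)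
      ∂(ν X) := by
  rw [primitive, ← lintegral_indicator (measurableSet_freq_le _)]
  rfl

lemma measurable_primitive {b : Γ → ℝ≥0∞} (hb : Measurable b) : Measurable (primitive X b) := by
  have h : primitive X b = fun η => ∫⁻ ζ, {p : Γ × Γ | φ X p.1 ≤ φ X p.2}.indicator
      (fun p => b p.1) (ζ, η) ∂(ν X) := funext (primitive_eq b)
  rw [h]
  exact Measurable.lintegral_prod_left' ((hb.comp measurable_fst).indicator measurableSet_le_freq)

/-- The square of a primitive is a double integral, which is at most twice its half `φ ζ ≤ φ ζ'`. -/
lemma primitive_sq_le {b : Γ → ℝ≥0∞} (hb : Measurable b) (η : Γ) :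
    primitive X b η ^ 2 ≤ 2 * primitive X (fun ζ => b ζ * primitive X b ζ) η := by
  set S : Set Γ := {ζ | φ X ζ ≤ φ X η} with hS
  have hSm : MeasurableSet S := measurableSet_freq_le _
  set T : Set (Γ × Γ) := {p | φ X p.1 ≤ φ X p.2} with hT
  have hTm : MeasurableSet T := measurableSet_le_freq
  have hF : Measurable (T.indicator fun p => b p.1 * b p.2) :=
    ((hb.comp measurable_fst).mul (hb.comp measurable_snd)).indicator hTm
  have h1 : ∀ ζ ∈ S, ∫⁻ ζ' in S, T.indicator (fun p => b p.1 * b p.2) (ζ', ζ) ∂(ν X)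
      = b ζ * primitive X b ζ := by
    intro ζ hζ
    rw [primitive, ← lintegral_const_mul _ hb, ← lintegral_indicator hSm,
      ← lintegral_indicator (measurableSet_freq_le _)]
    refine lintegral_congr fun ζ' => ?_
    by_cases h : φ X ζ' ≤ φ X ζ
    · have h2 : ζ' ∈ S := le_trans h hζ
      rw [indicator_of_mem h2, indicator_of_mem (show (ζ', ζ) ∈ T from h),
        indicator_of_mem (show ζ' ∈ {ζ' | φ X ζ' ≤ φ X ζ} from h), mul_comm]
    · rw [indicator_of_notMem (show ζ' ∉ {ζ' | φ X ζ' ≤ φ X ζ} from h)]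
      by_cases h2 : ζ' ∈ S
      · rw [indicator_of_mem h2, indicator_of_notMem (show (ζ', ζ) ∉ T from h)]
      · rw [indicator_of_notMem h2]
  have h2 : primitive X (fun ζ => b ζ * primitive X b ζ) η
      = ∫⁻ ζ in S, ∫⁻ ζ' in S, T.indicator (fun p => b p.1 * b p.2) (ζ', ζ) ∂(ν X) ∂(ν X) :=
    (setLIntegral_congr_fun hSm h1).symm
  have h3 : primitive X (fun ζ => b ζ * primitive X b ζ) η
      = ∫⁻ ζ in S, ∫⁻ ζ' in S, T.indicator (fun p => b p.1 * b p.2) (ζ, ζ') ∂(ν X) ∂(ν X) := by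
    rw [h2]
    exact lintegral_lintegral_swap (f := fun ζ ζ' => T.indicator (fun p => b p.1 * b p.2) (ζ', ζ))
      (hF.comp measurable_swap).aemeasurable
  have h4 : primitive X b η ^ 2 = ∫⁻ ζ in S, ∫⁻ ζ' in S, b ζ * b ζ' ∂(ν X) ∂(ν X) := by
    have : ∀ ζ, ∫⁻ ζ' in S, b ζ * b ζ' ∂(ν X) = b ζ * primitive X b η := fun ζ =>
      lintegral_const_mul _ hb
    simp only [this]
    rw [lintegral_mul_const _ hb, pow_two]
    rfl
  rw [two_mul]
  nth_rw 1 [h2]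
  rw [h3, h4, ← lintegral_add_left (Measurable.lintegral_prod_left'
    (μ := (ν X).restrict S) hF)]
  refine lintegral_mono fun ζ => ?_
  simp only
  have h5 : Measurable fun ζ' => T.indicator (fun p => b p.1 * b p.2) (ζ', ζ) :=
    hF.comp (measurable_id.prodMk measurable_const)
  rw [← lintegral_add_left h5]
  refine lintegral_mono fun ζ' => ?_
  simp only
  rcases le_total (φ X ζ) (φ X ζ') with h | h
  · rw [indicator_of_mem (show (ζ, ζ') ∈ T from h)]
    exact le_add_self
  · rw [indicator_of_mem (show (ζ', ζ) ∈ T from h), mul_comm]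
    exact le_self_add

lemma primitive_congr {b c : Γ → ℝ≥0∞} {η : Γ} (h : ∀ ζ, φ X ζ ≤ φ X η → b ζ = c ζ) :
    primitive X b η = primitive X c η :=
  setLIntegral_congr_fun (measurableSet_freq_le _) h

end

section

variable {X Γ : Type} [MeasureSpace X] [GeometryData X] [AddCommGroup Γ]
  [MeasurableSpace Γ] [MeasurableAdd₂ Γ] [MeasurableNeg Γ] [fm : FourierModel X Γ]

include fm

lemma measurable_weight (c : ℝ) : Measurable fun ξ : Γ => ENNReal.ofReal (((c + φ X ξ) ^ 2)⁻¹) :=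
  ENNReal.measurable_ofReal.comp ((measurable_const.add measurable_φ).pow_const 2).inv

/-- Hardy's inequality, under the assumption that the left-hand side is finite: one application of
`primitive_sq_le`, of the decay of the tails of the weight, and of the Cauchy--Schwarz inequality
bounds the left-hand side by half of itself plus the right-hand side. -/
lemma hardy_of_finite {b : Γ → ℝ≥0∞} (hb : Measurable b) (hb0 : ∀ ξ, φ X ξ < 0 → b ξ = 0)
    (hfin : ∫⁻ η in {η | 0 ≤ φ X η},
      primitive X b η ^ 2 * ENNReal.ofReal (((1 + φ X η) ^ 2)⁻¹) ∂(ν X) ≠ ⊤) :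
    ∫⁻ η in {η | 0 ≤ φ X η}, primitive X b η ^ 2 * ENNReal.ofReal (((1 + φ X η) ^ 2)⁻¹) ∂(ν X)
      ≤ 16 * ∫⁻ ζ, b ζ ^ 2 ∂(ν X) := by
  set P : Set Γ := {η | 0 ≤ φ X η} with hP
  have hPm : MeasurableSet P := measurableSet_le_freq' 0
  set w : Γ → ℝ≥0∞ := fun ξ => ENNReal.ofReal (((1 + φ X ξ) ^ 2)⁻¹) with hw
  have hwm : Measurable w := measurable_weight 1
  set I := ∫⁻ η in P, primitive X b η ^ 2 * w η ∂(ν X) with hI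
  set B := ∫⁻ ζ, b ζ ^ 2 ∂(ν X) with hB
  have hQm : Measurable (primitive X b) := measurable_primitive hb
  set T : Set (Γ × Γ) := {p | φ X p.1 ≤ φ X p.2} with hT
  have hTm : MeasurableSet T := measurableSet_le_freq
  set g : Γ → ℝ≥0∞ := fun ζ => b ζ * primitive X b ζ with hg
  have hgm : Measurable g := hb.mul hQm
  have h1 : I ≤ ∫⁻ η in P, 2 * ∫⁻ ζ, T.indicator (fun p => g p.1 * w p.2) (ζ, η)
      ∂(ν X) ∂(ν X) := by
    refine lintegral_mono fun η => ?_
    calc primitive X b η ^ 2 * w η ≤ 2 * primitive X g η * w η := by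
          gcongr
          exact primitive_sq_le hb η
      _ = 2 * ∫⁻ ζ, T.indicator (fun p => g p.1 * w p.2) (ζ, η) ∂(ν X) := by
          rw [mul_assoc, primitive_eq, ← lintegral_mul_const]
          · congr 1
            refine lintegral_congr fun ζ => ?_
            by_cases h : (ζ, η) ∈ T
            · simp only [← hT, indicator_of_mem h]
            · simp only [← hT, indicator_of_notMem h, zero_mul]
          · exact ((hgm.comp measurable_fst).indicator hTm).comp
              (measurable_id.prodMk measurable_const)
  have hFm : Measurable (T.indicator (fun p => g p.1 * w p.2)) :=
    ((hgm.comp measurable_fst).mul (hwm.comp measurable_snd)).indicator hTm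
  have h2 : ∫⁻ η in P, 2 * ∫⁻ ζ, T.indicator (fun p => g p.1 * w p.2) (ζ, η) ∂(ν X) ∂(ν X)
      = 2 * ∫⁻ ζ, ∫⁻ η in P, T.indicator (fun p => g p.1 * w p.2) (ζ, η) ∂(ν X) ∂(ν X) := by
    rw [lintegral_const_mul _ (Measurable.lintegral_prod_left' hFm)]
    congr 1
    exact lintegral_lintegral_swap (f := fun η ζ => T.indicator (fun p => g p.1 * w p.2) (ζ, η))
      (hFm.comp measurable_swap).aemeasurable
  have h3 : ∀ ζ, 2 * ∫⁻ η in P, T.indicator (fun p => g p.1 * w p.2) (ζ, η) ∂(ν X)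
      ≤ 8 * b ζ ^ 2 + 2⁻¹ * P.indicator (fun ζ => primitive X b ζ ^ 2 * w ζ) ζ := by
    intro ζ
    by_cases hζ : φ X ζ < 0
    · have hg0 : g ζ = 0 := by simp only [hg, hb0 ζ hζ, zero_mul]
      have : ∀ η, T.indicator (fun p => g p.1 * w p.2) (ζ, η) = 0 := fun η => by
        by_cases h : (ζ, η) ∈ T
        · rw [indicator_of_mem h]; simp only [hg0, zero_mul]
        · rw [indicator_of_notMem h]
      simp [this]
    · have hζ0 : 0 ≤ φ X ζ := not_lt.1 hζ
      rw [indicator_of_mem (show ζ ∈ P from hζ0)]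
      have h4 : ∫⁻ η in P, T.indicator (fun p => g p.1 * w p.2) (ζ, η) ∂(ν X)
          ≤ g ζ * ENNReal.ofReal (2 / (1 + φ X ζ)) := by
        calc ∫⁻ η in P, T.indicator (fun p => g p.1 * w p.2) (ζ, η) ∂(ν X)
            ≤ ∫⁻ η, T.indicator (fun p => g p.1 * w p.2) (ζ, η) ∂(ν X) :=
              setLIntegral_le_lintegral _ _
          _ = ∫⁻ η in {η | φ X ζ ≤ φ X η}, g ζ * w η ∂(ν X) := by
              rw [← lintegral_indicator (measurableSet_le_freq' _)]
              rfl
          _ = g ζ * ∫⁻ η in {η | φ X ζ ≤ φ X η}, w η ∂(ν X) := lintegral_const_mul _ hwm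
          _ ≤ _ := by
              gcongr
              exact lintegral_weight_tail hζ0
      set x := primitive X b ζ * ENNReal.ofReal ((1 + φ X ζ)⁻¹) with hx
      have h5 : primitive X b ζ ^ 2 * w ζ = x ^ 2 := by
        rw [hx, mul_pow, ← ENNReal.ofReal_pow (by positivity), inv_pow]
      have h6 : g ζ * ENNReal.ofReal (2 / (1 + φ X ζ)) = 2 * (b ζ * x) := by
        rw [hx, hg, div_eq_mul_inv, ENNReal.ofReal_mul (by norm_num)]
        simp only [ENNReal.ofReal_ofNat]
        ring
      rw [h5]
      have h7 := ennreal_two_mul_le (4 * b ζ) x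
      have h8 : (2 : ℝ≥0∞)⁻¹ * 2 = 1 := ENNReal.inv_mul_cancel (by simp) (by simp)
      calc 2 * ∫⁻ η in P, T.indicator (fun p => g p.1 * w p.2) (ζ, η) ∂(ν X)
          ≤ 2 * (2 * (b ζ * x)) := by rw [← h6]; gcongr
        _ = 2⁻¹ * (2 * (4 * b ζ * x)) := by
            rw [← mul_assoc 2⁻¹, h8]; ring
        _ ≤ 2⁻¹ * ((4 * b ζ) ^ 2 + x ^ 2) := by gcongr
        _ = 2⁻¹ * 2 * (8 * b ζ ^ 2) + 2⁻¹ * x ^ 2 := by ring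
        _ = _ := by rw [h8, one_mul]
  have h9 : I ≤ 8 * B + 2⁻¹ * I := by
    calc I ≤ 2 * ∫⁻ ζ, ∫⁻ η in P, T.indicator (fun p => g p.1 * w p.2) (ζ, η) ∂(ν X) ∂(ν X) :=
          h1.trans h2.le
      _ = ∫⁻ ζ, 2 * ∫⁻ η in P, T.indicator (fun p => g p.1 * w p.2) (ζ, η) ∂(ν X) ∂(ν X) :=
          (lintegral_const_mul' _ _ (by simp)).symm
      _ ≤ ∫⁻ ζ, (8 * b ζ ^ 2 + 2⁻¹ * P.indicator (fun ζ => primitive X b ζ ^ 2 * w ζ) ζ) ∂(ν X) :=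
          lintegral_mono h3
      _ = 8 * B + 2⁻¹ * I := by
          rw [lintegral_add_left ((hb.pow_const 2).const_mul 8), lintegral_const_mul' _ _ (by simp),
            lintegral_const_mul' _ _ (by simp), lintegral_indicator hPm]
  have h10 : I = 2⁻¹ * I + 2⁻¹ * I := by
    rw [← add_mul, ENNReal.inv_two_add_inv_two, one_mul]
  have h11 : 2⁻¹ * I ≠ ⊤ := ENNReal.mul_ne_top (by simp) hfin
  have h12 : 2⁻¹ * I ≤ 8 * B := by
    rw [h10] at h9
    nth_rw 2 [← h10] at h9
    exact (ENNReal.add_le_add_iff_right h11).1 h9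
  calc I = 2⁻¹ * I + 2⁻¹ * I := h10
    _ ≤ 8 * B + 8 * B := add_le_add h12 h12
    _ = 16 * B := by ring

/-- Hardy's inequality `∫ ((1 + φ)⁻¹ ∫_{≤ φ} b)² ≤ 16 ∫ b²`. -/
lemma hardy {b : Γ → ℝ≥0∞} (hb : Measurable b) (hb0 : ∀ ξ, φ X ξ < 0 → b ξ = 0) :
    ∫⁻ η in {η | 0 ≤ φ X η}, primitive X b η ^ 2 * ENNReal.ofReal (((1 + φ X η) ^ 2)⁻¹) ∂(ν X)
      ≤ 16 * ∫⁻ ζ, b ζ ^ 2 ∂(ν X) := by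
  by_cases hB : ∫⁻ ζ, b ζ ^ 2 ∂(ν X) = ⊤
  · rw [hB]; simp
  have hcov : {η : Γ | 0 ≤ φ X η} = ⋃ n : ℕ, {η | 0 ≤ φ X η ∧ φ X η ≤ n} := by
    ext η
    simp only [mem_ofPred_eq, mem_iUnion, exists_and_left, iff_self_and]
    intro _
    exact exists_nat_ge _
  rw [hcov, setLIntegral_iUnion_of_directed]
  swap
  · refine Monotone.directed_le fun m n hmn η hη => ⟨hη.1, hη.2.trans ?_⟩
    exact_mod_cast hmn
  refine iSup_le fun n => ?_
  -- The left-hand side is finite for the truncation of `b` to frequencies at most `n`, which has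
  -- the same primitive there.
  set c : Γ → ℝ≥0∞ := {ζ | φ X ζ ≤ n}.indicator b with hc
  have hcm : Measurable c := hb.indicator (measurableSet_freq_le _)
  have hcb : ∀ ζ, c ζ ≤ b ζ := fun ζ => indicator_le_self _ _ _
  have hc0 : ∀ ξ, φ X ξ < 0 → c ξ = 0 := fun ξ h => by
    have := hcb ξ
    rw [hb0 ξ h] at this
    exact le_antisymm this zero_le
  have hK : ∀ η, primitive X c η ≤ ∫⁻ ζ, c ζ ∂(ν X) := fun η => setLIntegral_le_lintegral _ _
  have hKfin : ∫⁻ ζ, c ζ ∂(ν X) ≠ ⊤ := by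
    have h1 : ∀ ζ, c ζ ≤ {ζ | 0 ≤ φ X ζ ∧ φ X ζ ≤ n}.indicator (1 : Γ → ℝ≥0∞) ζ + b ζ ^ 2 := by
      intro ζ
      by_cases h : 0 ≤ φ X ζ ∧ φ X ζ ≤ n
      · rw [indicator_of_mem (show ζ ∈ {ζ | 0 ≤ φ X ζ ∧ φ X ζ ≤ n} from h)]
        refine (hcb ζ).trans ?_
        rcases le_total (b ζ) 1 with h' | h'
        · exact h'.trans le_self_add
        · refine le_trans ?_ le_add_self
          rw [pow_two]
          exact le_mul_of_one_le_left' h'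
      · have : c ζ = 0 := by
          by_cases h2 : φ X ζ < 0
          · exact hc0 ζ h2
          · exact indicator_of_notMem (s := {ζ | φ X ζ ≤ n}) (fun h3 => h ⟨not_lt.1 h2, h3⟩) _
        rw [this]; exact zero_le
    have hms : MeasurableSet {ζ : Γ | 0 ≤ φ X ζ ∧ φ X ζ ≤ n} :=
      (measurableSet_le_freq' 0).inter (measurableSet_freq_le _)
    refine ne_top_of_le_ne_top ?_ (lintegral_mono h1)
    rw [lintegral_add_left (measurable_one.indicator hms), lintegral_indicator_one hms]
    refine ENNReal.add_ne_top.2 ⟨?_, hB⟩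
    exact ne_top_of_le_ne_top ENNReal.ofReal_ne_top (measure_nonneg_le _ n.cast_nonneg)
  calc ∫⁻ η in {η | 0 ≤ φ X η ∧ φ X η ≤ n},
        primitive X b η ^ 2 * ENNReal.ofReal (((1 + φ X η) ^ 2)⁻¹) ∂(ν X)
      = ∫⁻ η in {η | 0 ≤ φ X η ∧ φ X η ≤ n},
        primitive X c η ^ 2 * ENNReal.ofReal (((1 + φ X η) ^ 2)⁻¹) ∂(ν X) := by
        refine setLIntegral_congr_fun
          ((measurableSet_le_freq' 0).inter (measurableSet_freq_le _)) fun η hη => ?_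
        have h1 : primitive X b η = primitive X c η := primitive_congr fun ζ hζ =>
          (indicator_of_mem (show ζ ∈ {ζ | φ X ζ ≤ n} from hζ.trans hη.2) _).symm
        simp only [h1]
    _ ≤ ∫⁻ η in {η | 0 ≤ φ X η},
        primitive X c η ^ 2 * ENNReal.ofReal (((1 + φ X η) ^ 2)⁻¹) ∂(ν X) :=
        lintegral_mono_set fun η hη => hη.1
    _ ≤ 16 * ∫⁻ ζ, c ζ ^ 2 ∂(ν X) := by
        refine hardy_of_finite hcm hc0 (ne_top_of_le_ne_top ?_ (lintegral_mono fun η =>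
          mul_le_mul_left (pow_le_pow_left' (hK η) 2) _))
        rw [lintegral_const_mul _ (measurable_weight 1)]
        refine ENNReal.mul_ne_top (ENNReal.pow_ne_top hKfin) ?_
        exact ne_top_of_le_ne_top ENNReal.ofReal_ne_top (lintegral_weight_tail (X := X) le_rfl)
    _ ≤ 16 * ∫⁻ ζ, b ζ ^ 2 ∂(ν X) := by
        gcongr with ζ
        exact hcb ζ

end

end FourierModel

end CalogeroMoser

namespace CalogeroMoser

namespace FourierModel

/-! ### The Hankel operators `u ↦ C₊(q̄ u)` -/

lemma lintegral_mul_sq_le {α : Type*} [MeasurableSpace α] (μ : Measure α) {f g : α → ℝ≥0∞}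
    (hf : AEMeasurable f μ) (hg : AEMeasurable g μ) :
    (∫⁻ x, f x * g x ∂μ) ^ 2 ≤ (∫⁻ x, f x ^ 2 ∂μ) * ∫⁻ x, g x ^ 2 ∂μ := by
  have h := ENNReal.lintegral_mul_le_Lp_mul_Lq μ Real.HolderConjugate.two_two hf hg
  simp only [Pi.mul_apply, ENNReal.rpow_ofNat] at h
  calc (∫⁻ x, f x * g x ∂μ) ^ 2
      ≤ ((∫⁻ x, f x ^ 2 ∂μ) ^ (1 / 2 : ℝ) * (∫⁻ x, g x ^ 2 ∂μ) ^ (1 / 2 : ℝ)) ^ 2 := by gcongr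
    _ = _ := by
      rw [mul_pow, ← ENNReal.rpow_natCast, ← ENNReal.rpow_natCast, ← ENNReal.rpow_mul,
        ← ENNReal.rpow_mul]
      norm_num

lemma lintegral_mul_le_ofReal {α : Type*} [MeasurableSpace α] (μ : Measure α) {f g : α → ℝ≥0∞}
    (hf : AEMeasurable f μ) (hg : AEMeasurable g μ) {a b : ℝ} (ha : 0 ≤ a) (hb : 0 ≤ b)
    (hfa : ∫⁻ x, f x ^ 2 ∂μ ≤ ENNReal.ofReal (a ^ 2))
    (hgb : ∫⁻ x, g x ^ 2 ∂μ ≤ ENNReal.ofReal (b ^ 2)) :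
    ∫⁻ x, f x * g x ∂μ ≤ ENNReal.ofReal (a * b) := by
  have h := (lintegral_mul_sq_le μ hf hg).trans (mul_le_mul' hfa hgb)
  rw [← ENNReal.ofReal_mul (by positivity), ← mul_pow, ENNReal.ofReal_pow (by positivity)] at h
  exact (ENNReal.pow_le_pow_left_iff (by norm_num)).1 h

section

variable {X Γ : Type} [MeasureSpace X] [GeometryData X] [AddCommGroup Γ]
  [MeasurableSpace Γ] [MeasurableAdd₂ Γ] [MeasurableNeg Γ] [fm : FourierModel X Γ]

include fm

lemma norm_sq_eq_U (f : L2 X) : ‖f‖ ^ 2 = ∫ ξ, ‖U f ξ‖ ^ 2 ∂(ν X) := by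
  have h := inner_self_eq_norm_sq (𝕜 := ℂ) f
  rw [← h, inner_eq_U]
  have h1 : ∀ ξ, conj (U f ξ) * U f ξ = ((‖U f ξ‖ ^ 2 : ℝ) : ℂ) := fun x => by
    rw [← Complex.normSq_eq_conj_mul_self, Complex.normSq_eq_norm_sq]
  simp only [h1]
  rw [integral_complex_ofReal]
  simp

lemma lintegral_U_sq (f : L2 X) : ∫⁻ ξ, ‖U f ξ‖ₑ ^ 2 ∂(ν X) = ENNReal.ofReal (‖f‖ ^ 2) := by
  rw [norm_sq_eq_U, ofReal_integral_eq_lintegral_ofReal]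
  · refine lintegral_congr fun ξ => ?_
    rw [ENNReal.ofReal_pow (norm_nonneg _), ofReal_norm]
  · exact (memLp_U f).norm.integrable_sq
  · exact .of_forall fun ξ => by positivity

lemma wiener_of_lintegral_le {f : L2 X} {C : ℝ} (hC : 0 ≤ C)
    (h : ∫⁻ ξ, ‖U f ξ‖ₑ ∂(ν X) ≤ ENNReal.ofReal C) : Wiener f ∧ wnorm f ≤ C := by
  refine ⟨⟨Lp.aestronglyMeasurable _, h.trans_lt ENNReal.ofReal_lt_top⟩, ?_⟩
  rw [wnorm, integral_norm_eq_lintegral_enorm (Lp.aestronglyMeasurable _)]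
  exact ENNReal.toReal_le_of_le_ofReal hC h

lemma measurable_enorm_U (f : L2 X) : Measurable fun ξ => ‖U f ξ‖ₑ := (measurable_U f).enorm

/-- The Fourier transform of `q̄ u` is dominated by the correlation of the Fourier transforms. -/
lemma enorm_U_star_mul_le [SFinite (volume : Measure X)] {u : L2 X} (hu : Wiener u) (q : L2 X) :
    ∀ᵐ ξ ∂(ν X), ‖U (star q ⊙ u) ξ‖ₑ ≤ ∫⁻ η, ‖U u η‖ₑ * ‖U q (η - ξ)‖ₑ ∂(ν X) := by
  rw [mul_comm']
  filter_upwards [U_mul hu (star q)] with ξ h1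
  rw [h1]
  refine (enorm_integral_le_lintegral_enorm _).trans (le_of_eq (lintegral_congr_ae ?_))
  have hq := (Measure.measurePreserving_sub_left (ν X) ξ).quasiMeasurePreserving.ae (U_star q)
  filter_upwards [hq] with η h2
  rw [enorm_mul, h2, neg_sub, RCLike.enorm_conj]

/-- The modulus of the Fourier transform, cut off to nonnegative frequencies. -/
def absHat (q : L2 X) (ξ : Γ) : ℝ≥0∞ := {ξ | 0 ≤ φ X ξ}.indicator (fun ξ => ‖U q ξ‖ₑ) ξ

lemma measurable_absHat (q : L2 X) : Measurable (absHat q) :=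
  (measurable_enorm_U q).indicator (measurableSet_le_freq' 0)

lemma absHat_of_neg (q : L2 X) (ξ : Γ) (h : φ X ξ < 0) : absHat q ξ = 0 :=
  indicator_of_notMem (s := {ξ | 0 ≤ φ X ξ}) (not_le.2 h) _

lemma absHat_le (q : L2 X) (ξ : Γ) : absHat q ξ ≤ ‖U q ξ‖ₑ := indicator_le_self _ _ _

lemma enorm_U_ae_eq {q : L2 X} (hq : q ∈ hardyPlus (X := X)) :
    ∀ᵐ ξ ∂(ν X), ‖U q ξ‖ₑ = absHat q ξ := by
  filter_upwards [(mem_plus q).1 hq] with ξ h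
  by_cases h1 : 0 ≤ φ X ξ
  · exact (indicator_of_mem (s := {ξ | 0 ≤ φ X ξ}) h1 fun ξ => ‖U q ξ‖ₑ).symm
  · rw [absHat_of_neg q ξ (not_le.1 h1), h (not_le.1 h1), enorm_zero]

/-- Since `q̂` lives on nonnegative frequencies, the part of `q̄ u` at frequencies `≥ 0` that comes
from the frequency `η` of `u` only involves `q̂` on `[0, η]`. -/
lemma lintegral_U_Cplus_star_mul_le [SFinite (volume : Measure X)] {q u : L2 X}
    (hq : q ∈ hardyPlus (X := X)) (hu : Wiener u) :
    ∫⁻ ξ, ‖U (Cplus (star q ⊙ u)) ξ‖ₑ ∂(ν X)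
      ≤ ∫⁻ η, ‖U u η‖ₑ * primitive X (absHat q) η ∂(ν X) := by
  set P : Set Γ := {ξ | 0 ≤ φ X ξ} with hP
  have hPm : MeasurableSet P := measurableSet_le_freq' 0
  have hm : Measurable fun p : Γ × Γ => ‖U u p.2‖ₑ * ‖U q (p.2 - p.1)‖ₑ :=
    ((measurable_enorm_U u).comp measurable_snd).mul
      ((measurable_enorm_U q).comp (measurable_snd.sub measurable_fst))
  calc ∫⁻ ξ, ‖U (Cplus (star q ⊙ u)) ξ‖ₑ ∂(ν X)
      ≤ ∫⁻ ξ, P.indicator (fun ξ => ∫⁻ η, ‖U u η‖ₑ * ‖U q (η - ξ)‖ₑ ∂(ν X)) ξ ∂(ν X) := by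
        refine lintegral_mono_ae ?_
        filter_upwards [U_Cplus (star q ⊙ u), enorm_U_star_mul_le hu q] with ξ h1 h2
        rw [h1]
        by_cases h : ξ ∈ P
        · rw [indicator_of_mem h, indicator_of_mem (show ξ ∈ φ X ⁻¹' Ici 0 from h)]
          exact h2
        · rw [indicator_of_notMem (show ξ ∉ φ X ⁻¹' Ici 0 from h), enorm_zero]
          exact zero_le
    _ = ∫⁻ ξ in P, ∫⁻ η, ‖U u η‖ₑ * ‖U q (η - ξ)‖ₑ ∂(ν X) ∂(ν X) := lintegral_indicator hPm _
    _ = ∫⁻ η, ∫⁻ ξ in P, ‖U u η‖ₑ * ‖U q (η - ξ)‖ₑ ∂(ν X) ∂(ν X) :=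
        lintegral_lintegral_swap hm.aemeasurable
    _ = ∫⁻ η, ‖U u η‖ₑ * primitive X (absHat q) η ∂(ν X) := by
        refine lintegral_congr fun η => ?_
        have hms : Measurable fun ξ => ‖U q (η - ξ)‖ₑ :=
          (measurable_enorm_U q).comp (measurable_const.sub measurable_id)
        rw [lintegral_const_mul _ hms,
          ← lintegral_indicator hPm]
        congr 1
        have h1 : ∀ ξ, P.indicator (fun ξ => ‖U q (η - ξ)‖ₑ) ξ
            = {ζ | φ X ζ ≤ φ X η}.indicator (fun ζ => ‖U q ζ‖ₑ) (η - ξ) := by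
          intro ξ
          by_cases h : ξ ∈ P
          · rw [indicator_of_mem h, indicator_of_mem]
            have : 0 ≤ φ X ξ := h
            simp [map_sub, this]
          · rw [indicator_of_notMem h, indicator_of_notMem]
            have : ¬ 0 ≤ φ X ξ := h
            simpa [map_sub] using this
        simp only [h1]
        rw [lintegral_sub_left_eq_self
          (fun ζ => {ζ | φ X ζ ≤ φ X η}.indicator (fun ζ => ‖U q ζ‖ₑ) ζ) η,
          lintegral_indicator (measurableSet_freq_le _), primitive]
        refine lintegral_congr_ae (ae_restrict_of_ae ?_)
        exact enorm_U_ae_eq hq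

/-! ### The free resolvent -/

/-- The symbol of `(D + κ)⁻¹ C₊`, where `D = -i∂`. -/
def resolventSymbol (X : Type) {Γ : Type} [MeasureSpace X] [GeometryData X] [AddCommGroup Γ]
    [MeasurableSpace Γ] [FourierModel X Γ] (κ : ℝ) : Γ → ℂ :=
  {ξ | 0 ≤ φ X ξ}.indicator fun ξ => ((κ + φ X ξ)⁻¹ : ℝ)

/-- The operator `(D + κ)⁻¹ C₊` for `κ > 0`, where `D = -i∂`. -/
def freeResolvent (X : Type) {Γ : Type} [MeasureSpace X] [GeometryData X] [AddCommGroup Γ]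
    [MeasurableSpace Γ] [FourierModel X Γ] (κ : ℝ) : L2 X →L[ℂ] L2 X :=
  mult X (resolventSymbol X κ)

lemma U_freeResolvent {κ : ℝ} (hκ : 0 < κ) (f : L2 X) :
    (U (freeResolvent X κ f) : Γ → ℂ) =ᵐ[ν X] fun ξ => resolventSymbol X κ ξ * U f ξ := by
  have hm : Measurable (resolventSymbol X κ : Γ → ℂ) :=
    (Complex.measurable_ofReal.comp (measurable_const.add measurable_φ).inv).indicator
      (measurableSet_le_freq' 0)
  refine U_mult hm (C := κ⁻¹) (fun ξ => ?_) f
  by_cases h : ξ ∈ {ξ | 0 ≤ φ X ξ}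
  · rw [resolventSymbol, indicator_of_mem h, Complex.norm_real, Real.norm_eq_abs]
    have h' : 0 ≤ φ X ξ := h
    rw [abs_of_nonneg (by positivity)]
    gcongr
    linarith
  · rw [resolventSymbol, indicator_of_notMem h, norm_zero]
    positivity

lemma freeResolvent_mem_plus {κ : ℝ} (hκ : 0 < κ) (f : L2 X) :
    freeResolvent X κ f ∈ hardyPlus (X := X) := by
  rw [mem_plus]
  filter_upwards [U_freeResolvent hκ f] with ξ h1 h2
  rw [h1, resolventSymbol, indicator_of_notMem (by simpa using h2), zero_mul]

lemma isDeriv_freeResolvent {κ : ℝ} (hκ : 0 < κ) (f : L2 X) :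
    IsDeriv (freeResolvent X κ f) (Complex.I • (Cplus f - (κ : ℂ) • freeResolvent X κ f)) := by
  rw [isDeriv_iff]
  filter_upwards [U_freeResolvent hκ f, U_Cplus f,
    U_smul Complex.I (Cplus f - (κ : ℂ) • freeResolvent X κ f),
    U_sub (Cplus f) ((κ : ℂ) • freeResolvent X κ f), U_smul (κ : ℂ) (freeResolvent X κ f)]
    with ξ h1 h2 h3 h4 h5
  rw [h3, h4, h5, h2, h1]
  by_cases h : 0 ≤ φ X ξ
  · rw [resolventSymbol, indicator_of_mem (show ξ ∈ {ξ | 0 ≤ φ X ξ} from h),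
      indicator_of_mem (show ξ ∈ φ X ⁻¹' Ici 0 from h)]
    have h0 : ((κ + φ X ξ : ℝ) : ℂ) ≠ 0 := by
      norm_cast; positivity
    push_cast at h0 ⊢
    field_simp
    ring
  · rw [resolventSymbol, indicator_of_notMem (show ξ ∉ {ξ | 0 ≤ φ X ξ} from h),
      indicator_of_notMem (show ξ ∉ φ X ⁻¹' Ici 0 from h)]
    ring

lemma freeResolvent_mem_sobolevPlus {κ : ℝ} (hκ : 0 < κ) (f : L2 X) :
    freeResolvent X κ f ∈ sobolevPlus X :=
  ⟨freeResolvent_mem_plus hκ f, _, isDeriv_freeResolvent hκ f⟩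

lemma dx_freeResolvent {κ : ℝ} (hκ : 0 < κ) (f : L2 X) :
    -(Complex.I • dx (freeResolvent X κ f)) + (κ : ℂ) • freeResolvent X κ f = Cplus f := by
  rw [IsDeriv.dx_eq (isDeriv_freeResolvent hκ f), smul_smul, Complex.I_mul_I]
  module

lemma freeResolvent_apply_of_sobolevPlus {κ : ℝ} (hκ : 0 < κ) {u : L2 X}
    (hu : u ∈ sobolevPlus X) :
    freeResolvent X κ (-(Complex.I • dx u) + (κ : ℂ) • u) = u := by
  refine ext_U ?_
  set f := -(Complex.I • dx u) + (κ : ℂ) • u with hf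
  have hf' : f = (-Complex.I) • dx u + (κ : ℂ) • u := by rw [hf, neg_smul]
  filter_upwards [U_freeResolvent hκ f, U_add ((-Complex.I) • dx u) ((κ : ℂ) • u),
    U_smul (-Complex.I) (dx u), U_smul (κ : ℂ) u, (isDeriv_iff _ _).1 (isDeriv_dx hu),
    (mem_plus u).1 hu.1] with ξ h1 h2 h3 h4 h5 h6
  rw [h1, hf', h2, h3, h4, h5]
  by_cases h : 0 ≤ φ X ξ
  · rw [resolventSymbol, indicator_of_mem (show ξ ∈ {ξ | 0 ≤ φ X ξ} from h)]
    have h0 : ((κ + φ X ξ : ℝ) : ℂ) ≠ 0 := by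
      norm_cast; positivity
    push_cast at h0 ⊢
    field_simp
    linear_combination -(φ X ξ : ℂ) * U u ξ * Complex.I_sq
  · rw [h6 (not_le.1 h)]; ring

lemma enorm_resolventSymbol_sq {κ : ℝ} (ξ : Γ) :
    ‖resolventSymbol X κ ξ‖ₑ ^ 2
      = {ξ | 0 ≤ φ X ξ}.indicator (fun ξ => ENNReal.ofReal (((κ + φ X ξ) ^ 2)⁻¹)) ξ := by
  by_cases h : ξ ∈ {ξ | 0 ≤ φ X ξ}
  · rw [resolventSymbol, indicator_of_mem h, indicator_of_mem h, ← ofReal_norm,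
      ← ENNReal.ofReal_pow (norm_nonneg _), Complex.norm_real, Real.norm_eq_abs, sq_abs, inv_pow]
  · rw [resolventSymbol, indicator_of_notMem h, indicator_of_notMem h, enorm_zero]
    norm_num

lemma measurable_enorm_resolventSymbol (κ : ℝ) :
    Measurable fun ξ : Γ => ‖resolventSymbol X κ ξ‖ₑ :=
  ((Complex.measurable_ofReal.comp (measurable_const.add measurable_φ).inv).indicator
      (measurableSet_le_freq' 0)).enorm

/-- The free resolvent maps `L²` to the Wiener algebra, by the Cauchy--Schwarz inequality. -/
lemma wiener_freeResolvent (f : L2 X) :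
    Wiener (freeResolvent X 1 f) ∧ wnorm (freeResolvent X 1 f) ≤ 2 * ‖f‖ := by
  refine wiener_of_lintegral_le (by positivity) ?_
  calc ∫⁻ ξ, ‖U (freeResolvent X 1 f) ξ‖ₑ ∂(ν X)
      = ∫⁻ ξ, ‖resolventSymbol X 1 ξ‖ₑ * ‖U f ξ‖ₑ ∂(ν X) := by
        refine lintegral_congr_ae ?_
        filter_upwards [U_freeResolvent one_pos f] with ξ h1
        rw [h1, enorm_mul]
    _ ≤ ENNReal.ofReal (2 * ‖f‖) := by
        refine lintegral_mul_le_ofReal _ (measurable_enorm_resolventSymbol 1).aemeasurable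
          (measurable_enorm_U f).aemeasurable (by norm_num) (norm_nonneg _) ?_
          (lintegral_U_sq f).le
        simp only [enorm_resolventSymbol_sq]
        rw [lintegral_indicator (measurableSet_le_freq' 0)]
        refine (lintegral_weight_tail (X := X) le_rfl).trans (ENNReal.ofReal_le_ofReal ?_)
        norm_num

/-- The square of the bound for `u ↦ C₊(q̄ (D + κ)⁻¹ u)`, as an operator from `L²₊` to the
Wiener algebra. -/
def hankelBound (q : L2 X) (κ : ℝ) : ℝ≥0∞ :=
  ∫⁻ η in {η | 0 ≤ φ X η}, primitive X (absHat q) η ^ 2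
    * ENNReal.ofReal (((κ + φ X η) ^ 2)⁻¹) ∂(ν X)

lemma hankelBound_one_le (q : L2 X) : hankelBound q 1 ≤ ENNReal.ofReal ((4 * ‖q‖) ^ 2) := by
  refine (hardy (measurable_absHat q) (absHat_of_neg q)).trans ?_
  have h : ∫⁻ ζ, absHat q ζ ^ 2 ∂(ν X) ≤ ENNReal.ofReal (‖q‖ ^ 2) := by
    rw [← lintegral_U_sq]
    exact lintegral_mono fun ζ => pow_le_pow_left' (absHat_le q ζ) 2
  refine (mul_le_mul_right h 16).trans (le_of_eq ?_)
  rw [mul_pow, ENNReal.ofReal_mul (by positivity)]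
  norm_num

/-- The Hankel operator with the bounded resolvent on its right maps `L²₊` to the Wiener algebra;
this is where Hardy's inequality is used. -/
lemma wiener_hankel_of_le [SFinite (volume : Measure X)] {q : L2 X}
    (hq : q ∈ hardyPlus (X := X)) {κ : ℝ} (hκ : 0 < κ) {C : ℝ} (hC : 0 ≤ C)
    (h : hankelBound q κ ≤ ENNReal.ofReal (C ^ 2)) {w : L2 X}
    (hw : Wiener (freeResolvent X κ w)) :
    Wiener (Cplus (star q ⊙ freeResolvent X κ w))
      ∧ wnorm (Cplus (star q ⊙ freeResolvent X κ w)) ≤ C * ‖w‖ := by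
  have hQ : Measurable (primitive X (absHat q)) := measurable_primitive (measurable_absHat q)
  refine wiener_of_lintegral_le (by positivity) ((lintegral_U_Cplus_star_mul_le hq hw).trans ?_)
  calc ∫⁻ η, ‖U (freeResolvent X κ w) η‖ₑ * primitive X (absHat q) η ∂(ν X)
      = ∫⁻ η, (‖resolventSymbol X κ η‖ₑ * primitive X (absHat q) η) * ‖U w η‖ₑ ∂(ν X) := by
        refine lintegral_congr_ae ?_
        filter_upwards [U_freeResolvent hκ w] with ξ h1
        rw [h1, enorm_mul]
        ring
    _ ≤ ENNReal.ofReal (C * ‖w‖) := by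
        have hms : Measurable fun η => ‖resolventSymbol X κ η‖ₑ * primitive X (absHat q) η :=
          (measurable_enorm_resolventSymbol κ).mul hQ
        refine lintegral_mul_le_ofReal _ hms.aemeasurable
          (measurable_enorm_U w).aemeasurable hC (norm_nonneg _) ?_ (lintegral_U_sq w).le
        refine le_trans (le_of_eq ?_) h
        rw [hankelBound, ← lintegral_indicator (measurableSet_le_freq' 0)]
        refine lintegral_congr fun η => ?_
        rw [mul_pow, enorm_resolventSymbol_sq]
        by_cases hη : η ∈ {ξ | 0 ≤ φ X ξ}
        · rw [indicator_of_mem hη, indicator_of_mem hη, mul_comm]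
        · rw [indicator_of_notMem hη, indicator_of_notMem hη, zero_mul]

lemma wiener_freeResolvent' {κ : ℝ} (hκ : 0 < κ) (w : L2 X) : Wiener (freeResolvent X κ w) :=
  wiener_of_sobolevPlus (freeResolvent_mem_sobolevPlus hκ w)

lemma wiener_hankel [SFinite (volume : Measure X)] {q : L2 X} (hq : q ∈ hardyPlus (X := X))
    (w : L2 X) :
    Wiener (Cplus (star q ⊙ freeResolvent X 1 w))
      ∧ wnorm (Cplus (star q ⊙ freeResolvent X 1 w)) ≤ 4 * ‖q‖ * ‖w‖ :=
  wiener_hankel_of_le hq one_pos (by positivity) (hankelBound_one_le q)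
    (wiener_freeResolvent' one_pos w)

lemma wiener_Cplus_star_mul [SFinite (volume : Measure X)] {q u : L2 X}
    (hq : q ∈ hardyPlus (X := X)) (hu : u ∈ sobolevPlus X) : Wiener (Cplus (star q ⊙ u)) := by
  rw [← freeResolvent_apply_of_sobolevPlus one_pos hu]
  exact (wiener_hankel hq _).1

/-- By dominated convergence, with `κ = 1` as the majorant. -/
lemma tendsto_hankelBound (q : L2 X) :
    Filter.Tendsto (fun κ : ℝ => hankelBound q κ) Filter.atTop (nhds 0) := by
  have hQ : Measurable (primitive X (absHat q)) := measurable_primitive (measurable_absHat q)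
  have h1 : hankelBound q 1 ≠ ⊤ := ne_top_of_le_ne_top ENNReal.ofReal_ne_top (hankelBound_one_le q)
  have h0 : ∫⁻ _ in {η : Γ | 0 ≤ φ X η}, (0 : ℝ≥0∞) ∂(ν X) = 0 := lintegral_zero
  rw [← h0]
  have hfin : ∀ᵐ η ∂((ν X).restrict {η | 0 ≤ φ X η}), primitive X (absHat q) η ^ 2
      * ENNReal.ofReal (((1 + φ X η) ^ 2)⁻¹) < ⊤ :=
    ae_lt_top ((hQ.pow_const 2).mul (measurable_weight 1)) h1
  refine tendsto_lintegral_filter_of_dominated_convergence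
    (fun η => primitive X (absHat q) η ^ 2 * ENNReal.ofReal (((1 + φ X η) ^ 2)⁻¹))
    (.of_forall fun κ => (hQ.pow_const 2).mul (measurable_weight κ)) ?_ h1 ?_
  · filter_upwards [Filter.eventually_ge_atTop 1] with κ hκ
    filter_upwards [ae_restrict_mem (measurableSet_le_freq' 0)] with η hη
    have : 0 ≤ φ X η := hη
    gcongr
  · filter_upwards [ae_restrict_mem (measurableSet_le_freq' 0), hfin] with η hη h2
    have hη0 : 0 ≤ φ X η := hη
    have h3 : primitive X (absHat q) η ^ 2 ≠ ⊤ := by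
      intro h4
      rw [h4, ENNReal.top_mul] at h2
      · exact lt_irrefl _ h2
      · rw [Ne, ENNReal.ofReal_eq_zero, not_le]
        positivity
    have h4 : Filter.Tendsto (fun κ : ℝ => ENNReal.ofReal (((κ + φ X η) ^ 2)⁻¹)) Filter.atTop
        (nhds (ENNReal.ofReal 0)) := by
      refine ENNReal.tendsto_ofReal (Filter.Tendsto.inv_tendsto_atTop ?_)
      exact (Filter.tendsto_pow_atTop (by norm_num)).comp
        (Filter.tendsto_atTop_add_const_right _ _ Filter.tendsto_id)
    have h5 := ENNReal.Tendsto.const_mul (a := primitive X (absHat q) η ^ 2) h4 (Or.inr h3)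
    simpa using h5

/-! ### The form bound -/

/-- The quadratic form `⟨u, -iu'⟩` of `D = -i∂`. -/
def energy (u : L2 X) : ℝ := ∫ ξ, φ X ξ * ‖U u ξ‖ ^ 2 ∂(ν X)

lemma integrable_energy {u v : L2 X} (hu : IsDeriv u v) :
    Integrable (fun ξ => φ X ξ * ‖U u ξ‖ ^ 2) (ν X) := by
  have h := (((memLp_U u).norm.integrable_mul (memLp_U v).norm))
  refine h.mono ((measurable_φ.mul ((measurable_U u).norm.pow_const 2)).aestronglyMeasurable) ?_
  filter_upwards [(isDeriv_iff _ _).1 hu] with ξ h1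
  simp only [Pi.mul_apply]
  rw [h1]
  simp only [norm_mul, Complex.norm_I, one_mul, Complex.norm_real, Real.norm_eq_abs,
    abs_abs, norm_pow]
  refine le_of_eq ?_
  ring

lemma inner_D {u : L2 X} (hu : u ∈ sobolevPlus X) :
    inner ℂ u (-(Complex.I • dx u)) = (energy u : ℂ) := by
  rw [inner_eq_U, energy, ← integral_complex_ofReal]
  refine integral_congr_ae ?_
  have h0 : -(Complex.I • dx u) = (-Complex.I) • dx u := by rw [neg_smul]
  rw [h0]
  filter_upwards [(isDeriv_iff _ _).1 (isDeriv_dx hu), U_smul (-Complex.I) (dx u)] with ξ h1 h2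
  rw [h2, h1]
  have h3 : conj (U u ξ) * U u ξ = ((‖U u ξ‖ ^ 2 : ℝ) : ℂ) := by
    rw [← Complex.normSq_eq_conj_mul_self, Complex.normSq_eq_norm_sq]
  push_cast at h3 ⊢
  rw [← h3]
  linear_combination -(φ X ξ : ℂ) * (conj (U u ξ) * U u ξ) * Complex.I_sq

lemma energy_nonneg {u : L2 X} (hu : u ∈ hardyPlus (X := X)) : 0 ≤ energy u := by
  refine integral_nonneg_of_ae ?_
  filter_upwards [(mem_plus u).1 hu] with ξ h
  by_cases h1 : φ X ξ < 0
  · rw [h h1]; simp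
  · have := not_lt.1 h1
    simp only [Pi.zero_apply]
    positivity

/-- The sharp bound of the Hankel operator by the quadratic form of `D`, by the Cauchy--Schwarz
inequality on the Fourier side. -/
lemma norm_sq_hankel_le [SFinite (volume : Measure X)] {s : Set ℝ} (hs : MeasurableSet s) {c : ℝ}
    (hc : 0 ≤ c)
    (hm : ∀ a, 0 ≤ a → ν X {ξ | φ X ξ ∈ s ∧ φ X ξ ≤ a} ≤ ENNReal.ofReal ((a + c) / (2 * π)))
    {q u v : L2 X} (hq : q ∈ hardyPlus (X := X)) (hu : u ∈ sobolevPlus X)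
    (hv : (U v : Γ → ℂ) =ᵐ[ν X] (φ X ⁻¹' s).indicator (U (star q ⊙ u))) :
    ‖v‖ ^ 2 ≤ ‖q‖ ^ 2 / (2 * π) * (energy u + c * ‖u‖ ^ 2) := by
  set S : Set Γ := φ X ⁻¹' s with hS
  have hSm : MeasurableSet S := measurable_φ hs
  have hen := integrable_energy (isDeriv_dx hu)
  have hsq : Integrable (fun ξ => ‖U u ξ‖ ^ 2) (ν X) := (memLp_U u).norm.integrable_sq
  have hpos : 0 ≤ energy u + c * ‖u‖ ^ 2 := add_nonneg (energy_nonneg hu.1) (by positivity)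
  set T : Set (Γ × Γ) := {p | φ X p.1 ≤ φ X p.2} with hT
  have hTm : MeasurableSet T := measurableSet_le_freq
  have hF : Measurable fun p : Γ × Γ => T.indicator (fun p => ‖U u p.2‖ₑ ^ 2) p :=
    (((measurable_enorm_U u).comp measurable_snd).pow_const 2).indicator hTm
  -- the pointwise bound of the Fourier transform
  have h1 : ∀ ξ, (∫⁻ η, ‖U u η‖ₑ * ‖U q (η - ξ)‖ₑ ∂(ν X)) ^ 2
      ≤ (∫⁻ η, T.indicator (fun p => ‖U u p.2‖ₑ ^ 2) (ξ, η) ∂(ν X))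
        * ENNReal.ofReal (‖q‖ ^ 2) := by
    intro ξ
    have hmT : Measurable fun η => T.indicator (fun p => ‖U u p.2‖ₑ) (ξ, η) :=
      (((measurable_enorm_U u).comp measurable_snd).indicator hTm).comp
        (measurable_const.prodMk measurable_id)
    have h2 : ∫⁻ η, ‖U u η‖ₑ * ‖U q (η - ξ)‖ₑ ∂(ν X)
        = ∫⁻ η, T.indicator (fun p => ‖U u p.2‖ₑ) (ξ, η) * ‖U q (η - ξ)‖ₑ ∂(ν X) := by
      refine lintegral_congr_ae ?_
      have hqq := (measurePreserving_sub_right (ν X) ξ).quasiMeasurePreserving.ae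
        ((mem_plus q).1 hq)
      filter_upwards [hqq] with η h3
      by_cases h4 : (ξ, η) ∈ T
      · rw [indicator_of_mem h4]
      · rw [h3 ?_]
        · simp
        · have : φ X η < φ X ξ := not_le.1 h4
          rw [map_sub]; linarith
    rw [h2]
    have hms : Measurable fun η => ‖U q (η - ξ)‖ₑ :=
      (measurable_enorm_U q).comp (measurable_id.sub measurable_const)
    refine (lintegral_mul_sq_le _ hmT.aemeasurable hms.aemeasurable).trans (le_of_eq ?_)
    congr 1
    · refine lintegral_congr fun η => ?_
      by_cases h4 : (ξ, η) ∈ T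
      · rw [indicator_of_mem h4, indicator_of_mem h4]
      · rw [indicator_of_notMem h4, indicator_of_notMem h4]; norm_num
    · rw [lintegral_sub_right_eq_self (fun η => ‖U q η‖ₑ ^ 2) ξ, lintegral_U_sq]
  have h5 : ∫⁻ η, ∫⁻ ξ in S, T.indicator (fun p => ‖U u p.2‖ₑ ^ 2) (ξ, η) ∂(ν X) ∂(ν X)
      ≤ ENNReal.ofReal ((energy u + c * ‖u‖ ^ 2) / (2 * π)) := by
    have h6 : ∀ η, ∫⁻ ξ in S, T.indicator (fun p => ‖U u p.2‖ₑ ^ 2) (ξ, η) ∂(ν X)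
        = ‖U u η‖ₑ ^ 2 * ν X {ξ | φ X ξ ∈ s ∧ φ X ξ ≤ φ X η} := by
      intro η
      have h7 : ∀ ξ, T.indicator (fun p => ‖U u p.2‖ₑ ^ 2) (ξ, η)
          = {ξ | φ X ξ ≤ φ X η}.indicator (fun _ => ‖U u η‖ₑ ^ 2) ξ := fun ξ => rfl
      simp only [h7]
      rw [setLIntegral_indicator (measurableSet_freq_le _), setLIntegral_const]
      congr 2
      ext ξ
      exact and_comm
    simp only [h6]
    have h8 : (energy u + c * ‖u‖ ^ 2) / (2 * π)
        = ∫ ξ, ‖U u ξ‖ ^ 2 * ((φ X ξ + c) / (2 * π)) ∂(ν X) := by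
      rw [norm_sq_eq_U, energy, ← integral_const_mul, ← integral_add hen (hsq.const_mul c),
        ← integral_div]
      refine integral_congr_ae (.of_forall fun ξ => ?_)
      simp only
      ring
    have h9 : Integrable (fun ξ => ‖U u ξ‖ ^ 2 * ((φ X ξ + c) / (2 * π))) (ν X) := by
      refine ((hen.add (hsq.const_mul c)).div_const (2 * π)).congr (.of_forall fun ξ => ?_)
      simp only [Pi.add_apply]
      ring
    have h10 : ∀ᵐ ξ ∂(ν X), ‖U u ξ‖ₑ ^ 2 * ν X {ζ | φ X ζ ∈ s ∧ φ X ζ ≤ φ X ξ}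
        ≤ ENNReal.ofReal (‖U u ξ‖ ^ 2 * ((φ X ξ + c) / (2 * π)))
        ∧ 0 ≤ ‖U u ξ‖ ^ 2 * ((φ X ξ + c) / (2 * π)) := by
      filter_upwards [(mem_plus u).1 hu.1] with ξ h
      by_cases h11 : φ X ξ < 0
      · rw [h h11]; simp
      · have h12 := not_lt.1 h11
        have := Real.two_pi_pos
        refine ⟨?_, by positivity⟩
        rw [ENNReal.ofReal_mul (by positivity), ENNReal.ofReal_pow (norm_nonneg _),
          ofReal_norm]
        gcongr
        exact hm _ h12
    rw [h8, ofReal_integral_eq_lintegral_ofReal h9 (h10.mono fun ξ h => h.2)]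
    exact lintegral_mono_ae (h10.mono fun ξ h => h.1)
  have h13 : ENNReal.ofReal (‖v‖ ^ 2)
      ≤ ENNReal.ofReal ((energy u + c * ‖u‖ ^ 2) / (2 * π)) * ENNReal.ofReal (‖q‖ ^ 2) := by
    rw [← lintegral_U_sq]
    calc ∫⁻ ξ, ‖U v ξ‖ₑ ^ 2 ∂(ν X)
        ≤ ∫⁻ ξ, S.indicator (fun ξ => (∫⁻ η, T.indicator (fun p => ‖U u p.2‖ₑ ^ 2) (ξ, η)
            ∂(ν X)) * ENNReal.ofReal (‖q‖ ^ 2)) ξ ∂(ν X) := by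
          refine lintegral_mono_ae ?_
          filter_upwards [hv, enorm_U_star_mul_le (wiener_of_sobolevPlus hu) q] with ξ h2 h3
          rw [h2]
          by_cases h : ξ ∈ S
          · rw [indicator_of_mem h, indicator_of_mem h]
            exact (pow_le_pow_left' h3 2).trans (h1 ξ)
          · rw [indicator_of_notMem h, indicator_of_notMem h]; norm_num
      _ = (∫⁻ ξ in S, ∫⁻ η, T.indicator (fun p => ‖U u p.2‖ₑ ^ 2) (ξ, η) ∂(ν X) ∂(ν X))
            * ENNReal.ofReal (‖q‖ ^ 2) := by
          rw [lintegral_indicator hSm, lintegral_mul_const' _ _ ENNReal.ofReal_ne_top]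
      _ = (∫⁻ η, ∫⁻ ξ in S, T.indicator (fun p => ‖U u p.2‖ₑ ^ 2) (ξ, η) ∂(ν X) ∂(ν X))
            * ENNReal.ofReal (‖q‖ ^ 2) := by
          rw [lintegral_lintegral_swap hF.aemeasurable]
      _ ≤ _ := by gcongr
  have h14 : 0 ≤ (energy u + c * ‖u‖ ^ 2) / (2 * π) := div_nonneg hpos Real.two_pi_pos.le
  rw [← ENNReal.ofReal_mul h14, ENNReal.ofReal_le_ofReal_iff (by positivity)] at h13
  refine h13.trans (le_of_eq ?_)
  ring

lemma norm_sq_Cpos_star_mul_le [SFinite (volume : Measure X)] {q u : L2 X}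
    (hq : q ∈ hardyPlus (X := X)) (hu : u ∈ sobolevPlus X) :
    ‖Cpos (star q ⊙ u)‖ ^ 2 ≤ ‖q‖ ^ 2 / (2 * π) * energy u := by
  have := norm_sq_hankel_le (c := 0) measurableSet_Ioi le_rfl
    (fun a ha => by simpa using measure_pos_le (X := X) a ha) hq hu (U_Cpos _)
  simpa using this

lemma norm_sq_Cplus_star_mul_le [SFinite (volume : Measure X)] {q u : L2 X}
    (hq : q ∈ hardyPlus (X := X)) (hu : u ∈ sobolevPlus X) :
    ‖Cplus (star q ⊙ u)‖ ^ 2 ≤ ‖q‖ ^ 2 / (2 * π) * (energy u + ‖u‖ ^ 2) := by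
  have := norm_sq_hankel_le (c := 1) measurableSet_Ici zero_le_one
    (fun a ha => by simpa using measure_nonneg_le (X := X) a ha) hq hu (U_Cplus _)
  simpa using this

end

end FourierModel

end CalogeroMoser

namespace CalogeroMoser

/-! ### Algebra of products -/

section

variable {X : Type} [MeasureSpace X]

lemma mul_add_of_memLp {f g h : L2 X} (h1 : MemLp (fun x => f x * g x) 2 volume)
    (h2 : MemLp (fun x => f x * h x) 2 volume) : f ⊙ (g + h) = f ⊙ g + f ⊙ h := by
  have h3 : (fun x => f x * (g + h : L2 X) x) =ᵐ[volume] fun x => f x * g x + f x * h x := by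
    filter_upwards [Lp.coeFn_add g h] with x h4
    rw [h4, Pi.add_apply, mul_add]
  refine Lp.ext ?_
  filter_upwards [coeFn_mul h1, coeFn_mul h2, Lp.coeFn_add (f ⊙ g) (f ⊙ h), h3,
    coeFn_mul ((memLp_congr_ae h3).2 (h1.add h2))] with x h4 h5 h6 h7 h8
  rw [h8, h7, h6, Pi.add_apply, h4, h5]

lemma add_mul_of_memLp {f g h : L2 X} (h1 : MemLp (fun x => f x * h x) 2 volume)
    (h2 : MemLp (fun x => g x * h x) 2 volume) : (f + g) ⊙ h = f ⊙ h + g ⊙ h := by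
  rw [mul_comm' (f + g), mul_add_of_memLp (by simpa only [mul_comm] using h1)
    (by simpa only [mul_comm] using h2), mul_comm' h, mul_comm' h]

lemma mul_smul' (f g : L2 X) (c : ℂ) : f ⊙ (c • g) = c • (f ⊙ g) := by
  have h3 : (fun x => f x * (c • g : L2 X) x) =ᵐ[volume] fun x => c * (f x * g x) := by
    filter_upwards [Lp.coeFn_smul c g] with x h4
    rw [h4, Pi.smul_apply, smul_eq_mul, mul_left_comm]
  rw [mulL2, toL2_congr h3]
  by_cases h : MemLp (fun x => f x * g x) 2 volume
  · refine Lp.ext ?_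
    filter_upwards [coeFn_toL2 (h.const_mul c), coeFn_mul h, Lp.coeFn_smul c (f ⊙ g)]
      with x h4 h5 h6
    rw [h4, h6, Pi.smul_apply, h5, smul_eq_mul]
  · by_cases hc : c = 0
    · subst hc
      have : (0 : ℂ → ℂ) = 0 := rfl
      rw [zero_smul]
      refine Lp.ext ?_
      have h0 : MemLp (fun x => (0 : ℂ) * (f x * g x)) 2 volume := by simp
      filter_upwards [coeFn_toL2 h0, Lp.coeFn_zero ℂ 2 (volume : Measure X)] with x h4 h5
      rw [h4, h5, zero_mul]; rfl
    · have h4 : ¬ MemLp (fun x => c * (f x * g x)) 2 volume := fun h5 => h <| by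
        have := h5.const_mul c⁻¹
        simpa [inv_mul_cancel_left₀ hc] using this
      rw [mulL2, toL2, toL2, dif_neg h, dif_neg h4, smul_zero]

lemma smul_mul' (f g : L2 X) (c : ℂ) : (c • f) ⊙ g = c • (f ⊙ g) := by
  rw [mul_comm', mul_smul', mul_comm']

lemma mul_sub_of_memLp {f g h : L2 X} (h1 : MemLp (fun x => f x * g x) 2 volume)
    (h2 : MemLp (fun x => f x * h x) 2 volume) : f ⊙ (g - h) = f ⊙ g - f ⊙ h := by
  have h3 : MemLp (fun x => f x * ((-1 : ℂ) • h) x) 2 volume := by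
    refine (memLp_congr_ae ?_).2 (h2.const_mul (-1))
    filter_upwards [Lp.coeFn_smul (-1 : ℂ) h] with x h4
    rw [h4, Pi.smul_apply, smul_eq_mul]; ring
  have h4 : g - h = g + (-1 : ℂ) • h := by rw [neg_one_smul, sub_eq_add_neg]
  rw [h4, mul_add_of_memLp h1 h3, mul_smul', neg_one_smul, ← sub_eq_add_neg]

lemma sub_mul_of_memLp {f g h : L2 X} (h1 : MemLp (fun x => f x * h x) 2 volume)
    (h2 : MemLp (fun x => g x * h x) 2 volume) : (f - g) ⊙ h = f ⊙ h - g ⊙ h := by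
  rw [mul_comm' (f - g), mul_sub_of_memLp (by simpa only [mul_comm] using h1)
    (by simpa only [mul_comm] using h2), mul_comm' h, mul_comm' h]

lemma mul_assoc_of_memLp {f g h : L2 X} (h1 : MemLp (fun x => f x * g x) 2 volume)
    (h2 : MemLp (fun x => g x * h x) 2 volume) : f ⊙ g ⊙ h = f ⊙ (g ⊙ h) := by
  refine toL2_congr ?_
  filter_upwards [coeFn_mul h1, coeFn_mul h2] with x h3 h4
  rw [h3, h4, mul_assoc]

end

/-- An injective bounded operator with closed range is onto if its form dominates `‖S y‖²`. -/
lemma surjective_of_form_bound {E : Type*} [NormedAddCommGroup E] [InnerProductSpace ℂ E]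
    [CompleteSpace E] (S : E →L[ℂ] E) {C : ℝ} (h1 : ∀ y, ‖y‖ ≤ C * ‖S y‖)
    (h2 : ∀ y, ‖S y‖ ^ 2 ≤ (inner ℂ y (S y)).re) : Function.Surjective S := by
  have hanti : AntilipschitzWith (Real.toNNReal C) S := by
    refine AddMonoidHomClass.antilipschitz_of_bound S fun y => (h1 y).trans ?_
    gcongr
    exact Real.le_coe_toNNReal C
  have hcl : IsClosed (LinearMap.range (S : E →ₗ[ℂ] E) : Set E) := by
    have h : IsClosed (Set.range S) := hanti.isClosed_range S.uniformContinuous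
    exact h
  have hbot : (LinearMap.range (S : E →ₗ[ℂ] E))ᗮ = ⊥ := by
    rw [Submodule.eq_bot_iff]
    intro y hy
    have h3 : inner ℂ (S y) y = 0 := hy (S y) ⟨y, rfl⟩
    have h4 : inner ℂ y (S y) = 0 := by rw [← inner_conj_symm, h3, map_zero]
    have h5 := h2 y
    rw [h4, Complex.zero_re] at h5
    have h6 : ‖S y‖ = 0 := by nlinarith [norm_nonneg (S y)]
    have h7 := h1 y
    rw [h6, mul_zero] at h7
    exact norm_le_zero_iff.1 h7
  have htop := Submodule.topologicalClosure_eq_top_iff.2 hbot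
  rw [hcl.submodule_topologicalClosure_eq] at htop
  exact LinearMap.range_eq_top.1 htop

lemma Sign.val_mul_self (s : Sign) : s.val * s.val = 1 := by
  cases s <;> simp [Sign.val]

lemma Sign.conj_val (s : Sign) : conj s.val = s.val := by
  cases s <;> simp [Sign.val]

lemma Sign.norm_val (s : Sign) : ‖s.val‖ = 1 := by
  cases s <;> simp [Sign.val]

namespace FourierModel

section

variable {X Γ : Type} [MeasureSpace X] [GeometryData X] [AddCommGroup Γ]
  [MeasurableSpace Γ] [MeasurableAdd₂ Γ] [MeasurableNeg Γ] [fm : FourierModel X Γ]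
  [SFinite (volume : Measure X)]

include fm

/-! ### The Lax operator -/

lemma memLp_mul_Cplus {q u : L2 X} (hq : q ∈ hardyPlus (X := X)) (hu : u ∈ sobolevPlus X)
    (p : L2 X) : MemLp (fun x => p x * Cplus (star q ⊙ u) x) 2 volume :=
  (wiener_Cplus_star_mul hq hu).memLp_mul' p

lemma lax_mem_plus (s : Sign) {q u : L2 X} (hq : q ∈ hardyPlus (X := X))
    (hu : u ∈ sobolevPlus X) : lax s q u ∈ hardyPlus (X := X) := by
  refine sub_mem (neg_mem (Submodule.smul_mem _ _ (dx_mem_plus hu))) (Submodule.smul_mem _ _ ?_)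
  rw [mul_comm']
  exact (wiener_Cplus_star_mul hq hu).mul_mem_plus (Cplus_mem _) hq

lemma Cplus_star_mul_add {q u v : L2 X} (hu : u ∈ sobolevPlus X) (hv : v ∈ sobolevPlus X) :
    Cplus (star q ⊙ (u + v)) = Cplus (star q ⊙ u) + Cplus (star q ⊙ v) := by
  rw [mul_add_of_memLp ((wiener_of_sobolevPlus hu).memLp_mul' _)
    ((wiener_of_sobolevPlus hv).memLp_mul' _), Cplus_add]

lemma lax_add (s : Sign) {q u v : L2 X} (hq : q ∈ hardyPlus (X := X)) (hu : u ∈ sobolevPlus X)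
    (hv : v ∈ sobolevPlus X) : lax s q (u + v) = lax s q u + lax s q v := by
  rw [lax, lax, lax, dx_add hu hv, Cplus_star_mul_add hu hv,
    mul_add_of_memLp (memLp_mul_Cplus hq hu q) (memLp_mul_Cplus hq hv q)]
  module

lemma lax_smul (s : Sign) {q u : L2 X} (hu : u ∈ sobolevPlus X) (c : ℂ) :
    lax s q (c • u) = c • lax s q u := by
  rw [lax, lax, dx_smul hu, mul_smul', Cplus_smul, mul_smul']
  module

lemma inner_D_symm {u w : L2 X} (hu : u ∈ sobolevPlus X) (hw : w ∈ sobolevPlus X) :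
    inner ℂ w (-(Complex.I • dx u)) = inner ℂ (-(Complex.I • dx w)) u := by
  rw [← neg_smul, ← neg_smul, inner_eq_U, inner_eq_U]
  refine integral_congr_ae ?_
  filter_upwards [(isDeriv_iff _ _).1 (isDeriv_dx hu), (isDeriv_iff _ _).1 (isDeriv_dx hw),
    U_smul (-Complex.I) (dx u), U_smul (-Complex.I) (dx w)] with ξ h1 h2 h3 h4
  rw [h3, h4, h1, h2]
  simp only [map_mul, map_neg, Complex.conj_I, Complex.conj_ofReal]
  ring

lemma inner_mul_Cplus {p q u w : L2 X} (hw : w ∈ sobolevPlus X)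
    (hq : q ∈ hardyPlus (X := X)) (hu : u ∈ sobolevPlus X) :
    inner ℂ w (p ⊙ Cplus (star q ⊙ u)) = inner ℂ (Cplus (star p ⊙ w)) (Cplus (star q ⊙ u)) := by
  rw [inner_mul_right (memLp_mul_Cplus hq hu p) ((wiener_of_sobolevPlus hw).memLp_mul' _),
    ← inner_Cplus, Cplus_of_mem (Cplus_mem _)]

lemma inner_lax_symm (s : Sign) {q u w : L2 X} (hq : q ∈ hardyPlus (X := X))
    (hu : u ∈ sobolevPlus X) (hw : w ∈ sobolevPlus X) :
    inner ℂ w (lax s q u) = inner ℂ (lax s q w) u := by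
  have h1 : inner ℂ (q ⊙ Cplus (star q ⊙ w)) u
      = inner ℂ (Cplus (star q ⊙ w)) (Cplus (star q ⊙ u)) := by
    rw [← inner_conj_symm, inner_mul_Cplus hu hq hw, inner_conj_symm]
  rw [lax, lax, inner_sub_right, inner_sub_left, inner_D_symm hu hw, inner_smul_right,
    inner_smul_left, inner_mul_Cplus hw hq hu, h1, Sign.conj_val]

lemma re_inner_lax (s : Sign) {q u : L2 X} (hq : q ∈ hardyPlus (X := X))
    (hu : u ∈ sobolevPlus X) :
    (inner ℂ u (lax s q u)).re = energy u - s.val.re * ‖Cplus (star q ⊙ u)‖ ^ 2 := by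
  rw [lax, inner_sub_right, inner_D hu, inner_smul_right, inner_mul_Cplus hu hq hu,
    inner_self_eq_norm_sq_to_K]
  cases s <;> simp [Sign.val, ← Complex.ofReal_pow]

lemma mass_eq (q : L2 X) : mass q = ‖q‖ ^ 2 := (norm_sq_eq_integral q).symm

/-- The Lax operator is bounded below by a number larger than `-1` on the phase space. -/
lemma exists_form_bound {s : Sign} {q : L2 X} (hq : q ∈ phaseSpace X s) :
    ∃ c : ℝ, 0 < c ∧ ∀ κ : ℝ, 1 ≤ κ → ∀ u ∈ sobolevPlus X,
      c * ‖u‖ ^ 2 ≤ (inner ℂ u (lax s q u + (κ : ℂ) • u)).re := by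
  have hre : ∀ κ : ℝ, ∀ u ∈ sobolevPlus X, (inner ℂ u (lax s q u + (κ : ℂ) • u)).re
      = energy u - s.val.re * ‖Cplus (star q ⊙ u)‖ ^ 2 + κ * ‖u‖ ^ 2 := by
    intro κ u hu
    rw [inner_add_right, Complex.add_re, re_inner_lax s hq.1 hu, inner_smul_right,
      inner_self_eq_norm_sq_to_K]
    simp [← Complex.ofReal_pow]
  cases s with
  | focusing =>
    have hmass : ‖q‖ ^ 2 < 2 * π := by
      have := hq.2
      rw [mass_eq, Sign.critMass, ENNReal.ofReal_lt_ofReal_iff Real.two_pi_pos] at this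
      exact this
    refine ⟨1 - ‖q‖ ^ 2 / (2 * π), ?_, fun κ hκ u hu => ?_⟩
    · rw [sub_pos, div_lt_one Real.two_pi_pos]; exact hmass
    · rw [hre κ u hu]
      have h1 := norm_sq_Cplus_star_mul_le hq.1 hu
      have h2 := energy_nonneg hu.1
      have h3 : ‖q‖ ^ 2 / (2 * π) < 1 := (div_lt_one Real.two_pi_pos).2 hmass
      set θ := ‖q‖ ^ 2 / (2 * π)
      simp only [Sign.val, Complex.one_re, one_mul]
      nlinarith [sq_nonneg ‖u‖]
  | defocusing =>
    refine ⟨1, one_pos, fun κ hκ u hu => ?_⟩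
    rw [hre κ u hu]
    have h2 := energy_nonneg hu.1
    simp only [Sign.val, Complex.neg_re, Complex.one_re]
    nlinarith [sq_nonneg ‖u‖, sq_nonneg ‖Cplus (star q ⊙ u)‖]

lemma lax_resolvent_unique {s : Sign} {q : L2 X} (hq : q ∈ phaseSpace X s) {κ : ℝ}
    (hκ : 1 ≤ κ) {u v : L2 X} (hu : u ∈ sobolevPlus X) (hv : v ∈ sobolevPlus X)
    (h : lax s q u + (κ : ℂ) • u = lax s q v + (κ : ℂ) • v) : u = v := by
  obtain ⟨c, hc, hcu⟩ := exists_form_bound hq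
  have hd : u + (-1 : ℂ) • v ∈ sobolevPlus X := sobolevPlus_add hu (sobolevPlus_smul hv _)
  have h1 := hcu κ hκ _ hd
  have h2 : lax s q (u + (-1 : ℂ) • v) + (κ : ℂ) • (u + (-1 : ℂ) • v)
      = (lax s q u + (κ : ℂ) • u) - (lax s q v + (κ : ℂ) • v) := by
    rw [lax_add s hq.1 hu (sobolevPlus_smul hv _), lax_smul s hv]
    module
  rw [h2, h, sub_self, inner_zero_right, Complex.zero_re] at h1
  have h3 : ‖u + (-1 : ℂ) • v‖ = 0 := by
    have := le_antisymm (nonpos_of_mul_nonpos_right h1 hc) (sq_nonneg _)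
    exact pow_eq_zero_iff two_ne_zero |>.1 this
  rw [norm_eq_zero, neg_one_smul, ← sub_eq_add_neg, sub_eq_zero] at h3
  exact h3

/-- The perturbation `w ↦ p C₊(q̄ (D + κ)⁻¹ w)`. -/
def perturbation (p : L2 X) {q : L2 X} (hq : q ∈ hardyPlus (X := X)) {κ : ℝ} (hκ : 0 < κ) {C : ℝ}
    (hC : 0 ≤ C) (h : hankelBound q κ ≤ ENNReal.ofReal (C ^ 2)) : L2 X →L[ℂ] L2 X :=
  LinearMap.mkContinuous
    { toFun := fun w => p ⊙ Cplus (star q ⊙ freeResolvent X κ w)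
      map_add' := fun w₁ w₂ => by
        rw [map_add, Cplus_star_mul_add (freeResolvent_mem_sobolevPlus hκ w₁)
          (freeResolvent_mem_sobolevPlus hκ w₂),
          mul_add_of_memLp (memLp_mul_Cplus hq (freeResolvent_mem_sobolevPlus hκ w₁) p)
          (memLp_mul_Cplus hq (freeResolvent_mem_sobolevPlus hκ w₂) p)]
      map_smul' := fun c w => by
        rw [map_smul, mul_smul', Cplus_smul, mul_smul', RingHom.id_apply] }
    (C * ‖p‖) (fun w => by
      have h1 := wiener_hankel_of_le hq hκ hC h (wiener_freeResolvent' hκ w)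
      change ‖p ⊙ Cplus (star q ⊙ freeResolvent X κ w)‖ ≤ _
      rw [mul_comm']
      refine (h1.1.norm_mul_le p).trans ?_
      calc _ ≤ C * ‖w‖ * ‖p‖ := by gcongr; exact h1.2
        _ = _ := by ring)

/-- The equation `(𝓛_q + κ) u = f` is solvable for all large `κ`, by a Neumann series. -/
lemma exists_large_resolvent (s : Sign) {q : L2 X} (hq : q ∈ hardyPlus (X := X)) (κ₀ : ℝ) :
    ∃ κ ≥ κ₀, ∃ R : L2 X →L[ℂ] L2 X, ∀ f : L2 X,
      R f ∈ sobolevPlus X ∧ lax s q (R f) + (κ : ℂ) • R f = Cplus f := by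
  set C : ℝ := (2 * (‖q‖ + 1))⁻¹ with hC
  have hCpos : 0 < C := by positivity
  have hev : ∀ᶠ κ : ℝ in Filter.atTop, hankelBound q κ < ENNReal.ofReal (C ^ 2) :=
    (tendsto_hankelBound q).eventually_lt_const (by rw [ENNReal.ofReal_pos]; positivity)
  obtain ⟨κ, ⟨h1, h2⟩, h3⟩ :=
    ((hev.and (Filter.eventually_gt_atTop 0)).and (Filter.eventually_ge_atTop κ₀)).exists
  refine ⟨κ, h3, ?_⟩
  set T := perturbation q hq h2 hCpos.le h1.le with hT
  have hTn : ‖s.val • T‖ < 1 := by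
    rw [norm_smul, Sign.norm_val, one_mul]
    have : ‖T‖ ≤ C * ‖q‖ := LinearMap.mkContinuous_norm_le _ (by positivity) _
    refine this.trans_lt ?_
    rw [hC, inv_mul_lt_iff₀ (by positivity)]
    linarith [norm_nonneg q]
  set V := Units.oneSub (s.val • T) hTn with hV
  set A : L2 X →L[ℂ] L2 X := ↑V⁻¹ with hA
  have hAf : ∀ f, A f - s.val • T (A f) = f := fun f => by
    have h4 : (V : L2 X →L[ℂ] L2 X) * A = 1 := V.mul_inv
    have h5 := congrArg (fun B : L2 X →L[ℂ] L2 X => B f) h4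
    simpa [hV] using h5
  refine ⟨freeResolvent X κ ∘L A ∘L (hardyPlus (X := X)).starProjection, fun f => ?_⟩
  set w := A (Cplus f) with hw
  have hwf : w - s.val • T w = Cplus f := hAf (Cplus f)
  have hsob : freeResolvent X κ w ∈ sobolevPlus X := freeResolvent_mem_sobolevPlus h2 w
  have hTw : T w = q ⊙ Cplus (star q ⊙ freeResolvent X κ w) := rfl
  have hTplus : T w ∈ hardyPlus (X := X) := by
    rw [hTw, mul_comm']
    exact (wiener_Cplus_star_mul hq hsob).mul_mem_plus (Cplus_mem _) hq
  have hwplus : Cplus w = w := Cplus_of_mem <| by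
    have : w = Cplus f + s.val • T w := by rw [← hwf]; abel
    rw [this]
    exact add_mem (Cplus_mem _) (Submodule.smul_mem _ _ hTplus)
  refine ⟨hsob, ?_⟩
  change lax s q (freeResolvent X κ w) + (κ : ℂ) • freeResolvent X κ w = Cplus f
  rw [lax, ← hwf, hTw]
  have h6 := dx_freeResolvent h2 w
  rw [hwplus] at h6
  nth_rw 4 [← h6]
  abel

/-- The Lax operator shifted by `κ ≥ 1` maps `H¹₊` onto `L²₊` for every `q` in the phase space. -/
lemma exists_lax_eq {s : Sign} {q : L2 X} (hq : q ∈ phaseSpace X s) {κ : ℝ} (hκ : 1 ≤ κ)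
    {f : L2 X} (hf : f ∈ hardyPlus (X := X)) :
    ∃ u ∈ sobolevPlus X, lax s q u + (κ : ℂ) • u = f := by
  obtain ⟨κ', hκ', R, hR⟩ := exists_large_resolvent s hq.1 κ
  obtain ⟨c, hc, hcu⟩ := exists_form_bound hq
  set δ : ℝ := κ' - κ with hδ
  have hδ0 : 0 ≤ δ := sub_nonneg.2 hκ'
  -- On `L²₊` the operator `S` is `(𝓛_q + κ) R` with `R = (𝓛_q + κ')⁻¹ C₊`; on `L²` it is the sum of
  -- this and the projection to the orthogonal complement of `L²₊`. If `S` is onto, so is `𝓛_q + κ`.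
  set S : L2 X →L[ℂ] L2 X := ContinuousLinearMap.id ℂ (L2 X) - (δ : ℂ) • R with hS
  set g : L2 X → L2 X := fun y => lax s q (R y) + (κ : ℂ) • R y with hg
  have hgp : ∀ y, g y ∈ hardyPlus (X := X) := fun y =>
    add_mem (lax_mem_plus s hq.1 (hR y).1) (Submodule.smul_mem _ _ (hR y).1.1)
  have hgC : ∀ y, Cplus y = g y + (δ : ℂ) • R y := fun y => by
    rw [← (hR y).2, hg, hδ]; push_cast; module
  have hSy : ∀ y, S y = (y - Cplus y) + g y := fun y => by
    have : S y = y - (δ : ℂ) • R y := rfl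
    rw [this, hgC]; abel
  have horth : ∀ y w : L2 X, w ∈ hardyPlus (X := X) → inner ℂ (y - Cplus y) w = 0 := by
    intro y w hw
    exact Submodule.starProjection_inner_eq_zero y w hw
  have horth' : ∀ y w : L2 X, w ∈ hardyPlus (X := X) → inner ℂ w (y - Cplus y) = 0 := by
    intro y w hw
    rw [← inner_conj_symm, horth y w hw, map_zero]
  have hnorm : ∀ y, ‖S y‖ ^ 2 = ‖y - Cplus y‖ ^ 2 + ‖g y‖ ^ 2 := fun y => by
    rw [hSy, pow_two, pow_two, pow_two]
    exact norm_add_sq_eq_norm_sq_add_norm_sq_of_inner_eq_zero _ _ (horth y _ (hgp y))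
  have hgS : ∀ y, ‖g y‖ ≤ ‖S y‖ := fun y => by
    have := hnorm y
    nlinarith [norm_nonneg (g y), norm_nonneg (S y), sq_nonneg ‖y - Cplus y‖]
  have hRg : ∀ y, c * ‖R y‖ ≤ ‖g y‖ := fun y => by
    have h1 := hcu κ hκ _ (hR y).1
    have h2 : (inner ℂ (R y) (g y)).re ≤ ‖R y‖ * ‖g y‖ := re_inner_le_norm (𝕜 := ℂ) _ _
    rcases (norm_nonneg (R y)).eq_or_lt with h0 | h0
    · rw [← h0, mul_zero]; exact norm_nonneg _
    · have h3 : c * ‖R y‖ ^ 2 ≤ ‖R y‖ * ‖g y‖ := h1.trans h2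
      nlinarith
  have hgy : ∀ y, g y = lax s q (R y) + (κ : ℂ) • R y := fun _ => rfl
  clear_value g
  have hsurj : Function.Surjective S := by
    refine surjective_of_form_bound S (C := 1 + δ / c) (fun y => ?_) (fun y => ?_)
    · have h1 : y = S y + (δ : ℂ) • R y := by
        have : S y = y - (δ : ℂ) • R y := rfl
        rw [this]; abel
      calc ‖y‖ = ‖S y + (δ : ℂ) • R y‖ := by rw [← h1]
        _ ≤ ‖S y‖ + ‖(δ : ℂ) • R y‖ := norm_add_le _ _
        _ = ‖S y‖ + δ * ‖R y‖ := by
          rw [norm_smul, Complex.norm_real, Real.norm_eq_abs, abs_of_nonneg hδ0]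
        _ ≤ ‖S y‖ + δ * (‖S y‖ / c) := by
          gcongr
          rw [le_div_iff₀ hc, mul_comm]
          exact (hRg y).trans (hgS y)
        _ = (1 + δ / c) * ‖S y‖ := by ring
    · have hcg := hcu κ hκ _ (hR y).1
      rw [← hgy] at hcg
      have h1 : inner ℂ y (S y) = (‖y - Cplus y‖ ^ 2 : ℝ) + (‖g y‖ ^ 2 : ℝ)
          + δ * inner ℂ (R y) (g y) := by
        have h2 : y = (y - Cplus y) + (g y + (δ : ℂ) • R y) := by rw [← hgC]; abel
        rw [hSy]
        nth_rw 1 [h2]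
        rw [inner_add_left, inner_add_right, inner_add_right, horth y _ (hgp y),
          horth' y _ (add_mem (hgp y) (Submodule.smul_mem _ _ (hR y).1.1)), inner_add_left,
          inner_smul_left, inner_self_eq_norm_sq_to_K, inner_self_eq_norm_sq_to_K]
        simp
        ring
      rw [h1, hnorm]
      have h3 : 0 ≤ (inner ℂ (R y) (g y)).re :=
        le_trans (by positivity) hcg
      simp only [Complex.add_re, Complex.ofReal_re, Complex.re_ofReal_mul]
      have := mul_nonneg hδ0 h3
      linarith
  obtain ⟨y, hy⟩ := hsurj f
  refine ⟨R y, (hR y).1, ?_⟩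
  have h1 : Cplus (S y) = g y := by
    rw [hSy, Cplus_add, Cplus_sub, Cplus_of_mem (Cplus_mem y), sub_self, zero_add,
      Cplus_of_mem (hgp y)]
  rw [← hgy, ← h1, hy, Cplus_of_mem hf]

lemma resolv_spec {s : Sign} {q : L2 X} (hq : q ∈ phaseSpace X s) {κ : ℝ} (hκ : 1 ≤ κ)
    {f : L2 X} (hf : f ∈ hardyPlus (X := X)) : resolv s κ q f ∈ sobolevPlus X ∧
      lax s q (resolv s κ q f) + (κ : ℂ) • resolv s κ q f = f := by
  have h : ∃ u, u ∈ sobolevPlus X ∧ lax s q u + (κ : ℂ) • u = f := exists_lax_eq hq hκ hf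
  rw [resolv, dif_pos h]
  exact h.choose_spec

lemma resolv_eq {s : Sign} {q : L2 X} (hq : q ∈ phaseSpace X s) {κ : ℝ} (hκ : 1 ≤ κ)
    {f u : L2 X} (hu : u ∈ sobolevPlus X) (h : lax s q u + (κ : ℂ) • u = f) :
    resolv s κ q f = u := by
  have hf : f ∈ hardyPlus (X := X) := by
    rw [← h]; exact add_mem (lax_mem_plus s hq.1 hu) (Submodule.smul_mem _ _ hu.1)
  have h1 := resolv_spec hq hκ hf
  exact lax_resolvent_unique hq hκ h1.1 hu (h1.2.trans h.symm)

/-- The resolvent is symmetric. -/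
lemma inner_resolv_symm {s : Sign} {q : L2 X} (hq : q ∈ phaseSpace X s) {κ : ℝ} (hκ : 1 ≤ κ)
    {f g : L2 X} (hf : f ∈ hardyPlus (X := X)) (hg : g ∈ hardyPlus (X := X)) :
    inner ℂ f (resolv s κ q g) = inner ℂ (resolv s κ q f) g := by
  have h1 := resolv_spec hq hκ hf
  have h2 := resolv_spec hq hκ hg
  nth_rw 1 [← h1.2]
  nth_rw 2 [← h2.2]
  rw [inner_add_left, inner_add_right, inner_lax_symm s hq.1 h2.1 h1.1, inner_smul_left,
    inner_smul_right, Complex.conj_ofReal]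

lemma mkappa_spec {s : Sign} {q : L2 X} (hq : q ∈ phaseSpace X s) {κ : ℝ} (hκ : 1 ≤ κ) :
    mkappa s κ q ∈ sobolevPlus X ∧ lax s q (mkappa s κ q) + (κ : ℂ) • mkappa s κ q = q :=
  resolv_spec hq hκ hq.1

lemma beta_im {s : Sign} {q : L2 X} (hq : q ∈ phaseSpace X s) {κ : ℝ} (hκ : 1 ≤ κ) :
    (beta s κ q).im = 0 := by
  have h := inner_resolv_symm hq hκ hq.1 hq.1
  rw [← Complex.conj_eq_iff_im, beta, inner_conj_symm]
  exact h.symm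

end

end FourierModel

end CalogeroMoser

namespace CalogeroMoser

/-- The value of `±` as a real number. -/
def Sign.sgn (s : Sign) : ℝ := s.val.re

lemma Sign.coe_sgn (s : Sign) : (s.sgn : ℂ) = s.val := by
  cases s <;> simp [Sign.val, Sign.sgn]

section

variable {X : Type} [MeasureSpace X]

lemma real_smul_eq (r : ℝ) (f : L2 X) : r • f = (r : ℂ) • f := by
  refine Lp.ext ?_
  filter_upwards [Lp.coeFn_smul r f, Lp.coeFn_smul (r : ℂ) f] with x h1 h2
  rw [h1, h2]; simp

lemma star_real_smul (r : ℝ) (f : L2 X) : (star (r • f) : L2 X) = r • star f := by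
  rw [real_smul_eq, star_smul', Complex.conj_ofReal, real_smul_eq]

lemma mul_real_smul (f g : L2 X) (r : ℝ) : f ⊙ (r • g) = r • (f ⊙ g) := by
  rw [real_smul_eq, mul_smul', real_smul_eq]

lemma real_smul_mul (f g : L2 X) (r : ℝ) : (r • f) ⊙ g = r • (f ⊙ g) := by
  rw [real_smul_eq, smul_mul', real_smul_eq]

end

namespace FourierModel

section

variable {X Γ : Type} [MeasureSpace X] [GeometryData X] [AddCommGroup Γ]
  [MeasurableSpace Γ] [MeasurableAdd₂ Γ] [MeasurableNeg Γ] [fm : FourierModel X Γ]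
  [SFinite (volume : Measure X)]

include fm

/-! ### Differentiability of the resolvent -/

lemma Cplus_real_smul (r : ℝ) (f : L2 X) : Cplus (r • f) = r • Cplus f := by
  rw [real_smul_eq, Cplus_smul, real_smul_eq]

lemma memLp_hankel (q w p : L2 X) :
    MemLp (fun x => p x * Cplus (star (Cplus q) ⊙ freeResolvent X 1 w) x) 2 volume :=
  (wiener_hankel (Cplus_mem q) w).1.memLp_mul' p

lemma memLp_star_mul_freeResolvent (q w : L2 X) :
    MemLp (fun x => (star q : L2 X) x * freeResolvent X 1 w x) 2 volume :=
  (wiener_freeResolvent w).1.memLp_mul' _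

lemma norm_hankel_le (p q w : L2 X) :
    ‖p ⊙ Cplus (star (Cplus q) ⊙ freeResolvent X 1 w)‖ ≤ 4 * ‖p‖ * ‖q‖ * ‖w‖ := by
  have h := wiener_hankel (Cplus_mem q) w
  rw [mul_comm']
  refine (h.1.norm_mul_le p).trans ?_
  calc _ ≤ 4 * ‖Cplus q‖ * ‖w‖ * ‖p‖ := by gcongr; exact h.2
    _ ≤ 4 * ‖q‖ * ‖w‖ * ‖p‖ := by gcongr; exact norm_Cplus_le q
    _ = _ := by ring

/-- The real trilinear map `(p, q, w) ↦ p C₊(q̄₊ (D + 1)⁻¹ w)` with `q₊ = C₊ q`. Projecting `q`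
makes it bounded on all of `L²`. -/
def hankelMap (X : Type) {Γ : Type} [MeasureSpace X] [GeometryData X] [AddCommGroup Γ]
    [MeasurableSpace Γ] [MeasurableAdd₂ Γ] [MeasurableNeg Γ] [FourierModel X Γ]
    [SFinite (volume : Measure X)] : L2 X →L[ℝ] L2 X →L[ℝ] L2 X →L[ℝ] L2 X :=
  LinearMap.mkContinuous₂
    (LinearMap.mk₂ ℝ (fun p q => LinearMap.mkContinuous
      { toFun := fun w => p ⊙ Cplus (star (Cplus q) ⊙ freeResolvent X 1 w)
        map_add' := fun w₁ w₂ => by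
          rw [map_add, mul_add_of_memLp (memLp_star_mul_freeResolvent _ _)
            (memLp_star_mul_freeResolvent _ _), Cplus_add,
            mul_add_of_memLp (memLp_hankel _ _ _) (memLp_hankel _ _ _)]
        map_smul' := fun c w => by
          rw [real_smul_eq, map_smul, ← real_smul_eq, mul_real_smul, Cplus_real_smul,
            mul_real_smul, RingHom.id_apply] }
      (4 * ‖p‖ * ‖q‖) (fun w => norm_hankel_le p q w))
      (fun p₁ p₂ q => ContinuousLinearMap.ext fun w =>
        add_mul_of_memLp (memLp_hankel _ _ _) (memLp_hankel _ _ _))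
      (fun c p q => ContinuousLinearMap.ext fun w => real_smul_mul _ _ _)
      (fun p q₁ q₂ => ContinuousLinearMap.ext fun w => by
        change p ⊙ Cplus (star (Cplus (q₁ + q₂)) ⊙ freeResolvent X 1 w)
          = p ⊙ Cplus (star (Cplus q₁) ⊙ freeResolvent X 1 w)
            + p ⊙ Cplus (star (Cplus q₂) ⊙ freeResolvent X 1 w)
        rw [Cplus_add, star_add', add_mul_of_memLp (memLp_star_mul_freeResolvent _ _)
          (memLp_star_mul_freeResolvent _ _), Cplus_add,
          mul_add_of_memLp (memLp_hankel _ _ _) (memLp_hankel _ _ _)])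
      (fun c p q => ContinuousLinearMap.ext fun w => by
        change p ⊙ Cplus (star (Cplus (c • q)) ⊙ freeResolvent X 1 w)
          = c • (p ⊙ Cplus (star (Cplus q) ⊙ freeResolvent X 1 w))
        rw [Cplus_real_smul, star_real_smul, real_smul_mul, Cplus_real_smul, mul_real_smul]))
    4 (fun p q => LinearMap.mkContinuous_norm_le _ (by positivity) fun w => norm_hankel_le p q w)

lemma hankelMap_apply (p q w : L2 X) :
    hankelMap X p q w = p ⊙ Cplus (star (Cplus q) ⊙ freeResolvent X 1 w) := rfl

/-- The operator `1 + (κ - 1)(D + 1)⁻¹ C₊ ∓ q C₊ q̄₊ (D + 1)⁻¹`, that is `(𝓛_q + κ)(D + 1)⁻¹` on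
`L²₊` extended by the identity. It is polynomial in `q`. -/
def laxFactor (s : Sign) (κ : ℝ) (q : L2 X) : L2 X →L[ℝ] L2 X :=
  ContinuousLinearMap.id ℝ (L2 X) + (κ - 1) • (freeResolvent X 1).restrictScalars ℝ
    - s.sgn • hankelMap X q q

lemma laxFactor_apply (s : Sign) (κ : ℝ) {q : L2 X} (hq : q ∈ hardyPlus (X := X)) (w : L2 X) :
    laxFactor s κ q w = (w - Cplus w)
      + (lax s q (freeResolvent X 1 w) + (κ : ℂ) • freeResolvent X 1 w) := by
  have h : laxFactor s κ q w = w + (κ - 1) • freeResolvent X 1 w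
      - s.sgn • (q ⊙ Cplus (star (Cplus q) ⊙ freeResolvent X 1 w)) := rfl
  rw [h, Cplus_of_mem hq, ← dx_freeResolvent one_pos w, lax, real_smul_eq, real_smul_eq,
    Sign.coe_sgn]
  push_cast
  module

lemma freeResolvent_Cplus {κ : ℝ} (hκ : 0 < κ) (f : L2 X) :
    freeResolvent X κ (Cplus f) = freeResolvent X κ f := by
  refine ext_U ?_
  filter_upwards [U_freeResolvent hκ f, U_freeResolvent hκ (Cplus f), U_Cplus f] with ξ h1 h2 h3
  rw [h1, h2, h3]
  by_cases h : 0 ≤ φ X ξ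
  · rw [indicator_of_mem (show ξ ∈ φ X ⁻¹' Ici 0 from h)]
  · rw [resolventSymbol, indicator_of_notMem (s := {ξ | 0 ≤ φ X ξ}) h, zero_mul, zero_mul]

lemma bijective_laxFactor {s : Sign} {q : L2 X} (hq : q ∈ phaseSpace X s) {κ : ℝ} (hκ : 1 ≤ κ) :
    Function.Bijective (laxFactor s κ q) := by
  constructor
  · refine (injective_iff_map_eq_zero _).2 fun w hw => ?_
    rw [laxFactor_apply s κ hq.1] at hw
    have hu := freeResolvent_mem_sobolevPlus (X := X) one_pos w
    set u := freeResolvent X 1 w with hu'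
    have h1 : lax s q u + (κ : ℂ) • u ∈ hardyPlus (X := X) :=
      add_mem (lax_mem_plus s hq.1 hu) (Submodule.smul_mem _ _ hu.1)
    have h2 := congrArg Cplus hw
    rw [Cplus_add, Cplus_sub, Cplus_of_mem (Cplus_mem w), sub_self, zero_add, Cplus_of_mem h1] at h2
    have h0 : Cplus (0 : L2 X) = 0 := Cplus_of_mem (zero_mem _)
    rw [h0] at h2
    have h3 : u = 0 := by
      rw [← resolv_eq hq hκ hu h2]
      have hz : (0 : L2 X) ∈ sobolevPlus X := by simpa using sobolevPlus_smul hu 0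
      refine resolv_eq hq hκ hz ?_
      have := lax_smul s (q := q) hz 0
      simp only [zero_smul] at this
      rw [this, smul_zero, add_zero]
    rw [h2, add_zero, sub_eq_zero] at hw
    have h4 := dx_freeResolvent (X := X) one_pos w
    rw [← hu', h3] at h4
    have hz : (0 : L2 X) ∈ sobolevPlus X := by simpa using sobolevPlus_smul hu 0
    have h5 : dx (0 : L2 X) = 0 := by simpa using dx_smul hz 0
    rw [h5, smul_zero, smul_zero, neg_zero, add_zero] at h4
    rw [hw, ← h4]
  · intro f
    obtain ⟨u, hu, h⟩ := exists_lax_eq hq hκ (Cplus_mem f)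
    have h1 : -(Complex.I • dx u) + ((1 : ℝ) : ℂ) • u ∈ hardyPlus (X := X) :=
      add_mem (neg_mem (Submodule.smul_mem _ _ (dx_mem_plus hu))) (Submodule.smul_mem _ _ hu.1)
    refine ⟨(f - Cplus f) + (-(Complex.I • dx u) + ((1 : ℝ) : ℂ) • u), ?_⟩
    rw [laxFactor_apply s κ hq.1, map_add, freeResolvent_apply_of_sobolevPlus one_pos hu, map_sub,
      freeResolvent_Cplus one_pos, sub_self, zero_add, h, Cplus_add, Cplus_sub,
      Cplus_of_mem (Cplus_mem f), sub_self, zero_add, Cplus_of_mem h1]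
    abel

/-- `m_κ = (D + 1)⁻¹ w` with `w` a smooth function of `q ∈ L²`. -/
def density (s : Sign) (κ : ℝ) (q : L2 X) : L2 X := (laxFactor s κ q).inverse q

lemma exists_equiv {s : Sign} {q : L2 X} (hq : q ∈ phaseSpace X s) {κ : ℝ} (hκ : 1 ≤ κ) :
    ∃ e : L2 X ≃L[ℝ] L2 X, (e : L2 X →L[ℝ] L2 X) = laxFactor s κ q :=
  ⟨ContinuousLinearEquiv.ofBijective _ (LinearMap.ker_eq_bot.2 (bijective_laxFactor hq hκ).1)
    (LinearMap.range_eq_top.2 (bijective_laxFactor hq hκ).2),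
    ContinuousLinearEquiv.coe_ofBijective _ _ _⟩

lemma laxFactor_density {s : Sign} {q : L2 X} (hq : q ∈ phaseSpace X s) {κ : ℝ} (hκ : 1 ≤ κ) :
    laxFactor s κ q (density s κ q) = q := by
  obtain ⟨e, he⟩ := exists_equiv hq hκ
  rw [density, ← he, ContinuousLinearMap.inverse_equiv]
  simp

lemma contDiff_laxFactor (s : Sign) (κ : ℝ) : ContDiff ℝ 1 (laxFactor (X := X) s κ) := by
  unfold laxFactor
  have h : ContDiff ℝ 1 fun q : L2 X => hankelMap X q q :=
    (hankelMap X).contDiff.clm_apply contDiff_id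
  exact contDiff_const.sub (h.const_smul s.sgn)

lemma contDiffAt_density {s : Sign} {q : L2 X} (hq : q ∈ phaseSpace X s) {κ : ℝ} (hκ : 1 ≤ κ) :
    ContDiffAt ℝ 1 (density (X := X) s κ) q := by
  obtain ⟨e, he⟩ := exists_equiv hq hκ
  have h1 : ContDiffAt ℝ 1 (ContinuousLinearMap.inverse (R := ℝ) (M := L2 X) (M₂ := L2 X))
      (laxFactor s κ q) := by
    rw [← he]; exact contDiffAt_map_inverse e
  exact (h1.comp q (contDiff_laxFactor s κ).contDiffAt).clm_apply contDiffAt_id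

/-- The resolvent equation solved by `laxFactor`. -/
lemma resolv_of_laxFactor {s : Sign} {q : L2 X} (hq : q ∈ phaseSpace X s) {κ : ℝ} (hκ : 1 ≤ κ)
    {f w : L2 X} (hf : f ∈ hardyPlus (X := X)) (h : laxFactor s κ q w = f) :
    freeResolvent X 1 w = resolv s κ q f := by
  rw [laxFactor_apply s κ hq.1] at h
  have hu := freeResolvent_mem_sobolevPlus (X := X) one_pos w
  have h1 : lax s q (freeResolvent X 1 w) + (κ : ℂ) • freeResolvent X 1 w ∈ hardyPlus (X := X) :=
    add_mem (lax_mem_plus s hq.1 hu) (Submodule.smul_mem _ _ hu.1)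
  have h2 := congrArg Cplus h
  rw [Cplus_add, Cplus_sub, Cplus_of_mem (Cplus_mem w), sub_self, zero_add, Cplus_of_mem h1,
    Cplus_of_mem hf] at h2
  exact (resolv_eq hq hκ hu h2).symm

lemma mkappa_eq {s : Sign} {q : L2 X} (hq : q ∈ phaseSpace X s) {κ : ℝ} (hκ : 1 ≤ κ) :
    mkappa s κ q = freeResolvent X 1 (density s κ q) :=
  (resolv_of_laxFactor hq hκ hq.1 (laxFactor_density hq hκ)).symm

end

end FourierModel

end CalogeroMoser

namespace CalogeroMoser

lemma hasDerivAt_clm_diag {E F : Type*} [NormedAddCommGroup E] [NormedSpace ℝ E]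
    [NormedAddCommGroup F] [NormedSpace ℝ F] (T : E →L[ℝ] E →L[ℝ] F) {Q : ℝ → E} {f : E} {t : ℝ}
    (hQ : HasDerivAt Q f t) :
    HasDerivAt (fun ε => T (Q ε) (Q ε)) (T f (Q t) + T (Q t) f) t :=
  HasDerivAt.clm_apply (T.hasFDerivAt.comp_hasDerivAt t hQ) hQ

namespace FourierModel

section

variable {X Γ : Type} [MeasureSpace X] [GeometryData X] [AddCommGroup Γ]
  [MeasurableSpace Γ] [MeasurableAdd₂ Γ] [MeasurableNeg Γ] [fm : FourierModel X Γ]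
  [SFinite (volume : Measure X)]

include fm

/-! ### The Wirtinger derivative of `β` -/

lemma isOpen_mass (s : Sign) : IsOpen {q : L2 X | ENNReal.ofReal (mass q) < s.critMass} := by
  have h : {q : L2 X | ENNReal.ofReal (mass q) < s.critMass}
      = {q : L2 X | ENNReal.ofReal (‖q‖ ^ 2) < s.critMass} := by
    ext q; rw [mem_ofPred_eq, mem_ofPred_eq, mass_eq]
  rw [h]
  exact isOpen_lt (ENNReal.continuous_ofReal.comp (continuous_norm.pow 2)) continuous_const

lemma eventually_mem_phaseSpace {s : Sign} {q f : L2 X} (hq : q ∈ phaseSpace X s)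
    (hf : f ∈ hardyPlus (X := X)) : ∀ᶠ ε : ℝ in nhds 0, q + (ε : ℂ) • f ∈ phaseSpace X s := by
  have hc : Continuous fun ε : ℝ => q + (ε : ℂ) • f := by fun_prop
  have h := hc.continuousAt.eventually ((isOpen_mass s).mem_nhds
    (show q + ((0 : ℝ) : ℂ) • f ∈ {q : L2 X | ENNReal.ofReal (mass q) < s.critMass} by
      simpa using hq.2))
  filter_upwards [h] with ε h1
  exact ⟨add_mem hq.1 (Submodule.smul_mem _ _ hf), h1⟩

lemma mkappa_mem_sobolevPlus {s : Sign} {q : L2 X} (hq : q ∈ phaseSpace X s) {κ : ℝ}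
    (hκ : 1 ≤ κ) : mkappa s κ q ∈ sobolevPlus X :=
  (mkappa_spec hq hκ).1

lemma hasDerivAt_line (q f : L2 X) : HasDerivAt (fun ε : ℝ => q + (ε : ℂ) • f) f 0 := by
  have h1 : HasDerivAt (fun ε : ℝ => (ε : ℂ)) 1 0 := Complex.ofRealCLM.hasDerivAt
  simpa using (h1.smul_const f).const_add q

/-- The derivative of `m_κ` in the direction `f`, by differentiating the resolvent equation. -/
lemma hasDerivAt_mkappa {s : Sign} {q f : L2 X} (hq : q ∈ phaseSpace X s)
    (hf : f ∈ hardyPlus (X := X)) {κ : ℝ} (hκ : 1 ≤ κ) :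
    HasDerivAt (fun ε : ℝ => mkappa s κ (q + (ε : ℂ) • f))
      (resolv s κ q (f + s.val • (f ⊙ Cplus (star q ⊙ mkappa s κ q)
        + q ⊙ Cplus (star f ⊙ mkappa s κ q)))) 0 := by
  set Q : ℝ → L2 X := fun ε => q + (ε : ℂ) • f with hQ
  have hQ0 : Q 0 = q := by
    change q + ((0 : ℝ) : ℂ) • f = q
    rw [Complex.ofReal_zero, zero_smul, add_zero]
  have hQ' : HasDerivAt Q f 0 := hasDerivAt_line q f
  have hev : ∀ᶠ ε in nhds 0, Q ε ∈ phaseSpace X s := eventually_mem_phaseSpace hq hf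
  set w := density s κ q with hw
  have hm : mkappa s κ q = freeResolvent X 1 w := mkappa_eq hq hκ
  have hd : DifferentiableAt ℝ (density (X := X) s κ) (Q 0) := by
    rw [hQ0]; exact (contDiffAt_density hq hκ).differentiableAt one_ne_zero
  obtain ⟨w', hw'⟩ : ∃ w', HasDerivAt (fun ε => density s κ (Q ε)) w' 0 :=
    ⟨_, hd.hasFDerivAt.comp_hasDerivAt 0 hQ'⟩
  have hT : HasDerivAt (fun ε => laxFactor s κ (Q ε))
      (-(s.sgn • (hankelMap X f q + hankelMap X q f))) 0 := by
    have h2 := hasDerivAt_clm_diag (hankelMap X) hQ'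
    rw [hQ0] at h2
    have h3 := (h2.const_smul s.sgn).const_sub
      (ContinuousLinearMap.id ℝ (L2 X) + (κ - 1) • (freeResolvent X 1).restrictScalars ℝ)
    exact h3
  have hprod := hT.clm_apply hw'
  have huniq : HasDerivAt (fun ε => laxFactor s κ (Q ε) (density s κ (Q ε))) f 0 :=
    hQ'.congr_of_eventuallyEq (hev.mono fun ε h => laxFactor_density h hκ)
  have heq := hprod.unique huniq
  rw [hQ0, ← hw] at heq
  have hmsob := mkappa_mem_sobolevPlus hq hκ
  set m := mkappa s κ q with hm'
  have hTw : ∀ a b : L2 X, b ∈ hardyPlus (X := X) →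
      hankelMap X a b w = a ⊙ Cplus (star b ⊙ m) := fun a b hb => by
    rw [hankelMap_apply, Cplus_of_mem hb, hm]
  have hL : laxFactor s κ q w' = f + s.val • (f ⊙ Cplus (star q ⊙ m)
      + q ⊙ Cplus (star f ⊙ m)) := by
    rw [← hTw f q hq.1, ← hTw q f hf, ← Sign.coe_sgn, ← real_smul_eq]
    have h4 : (-(s.sgn • (hankelMap X f q + hankelMap X q f))) w
        = -(s.sgn • (hankelMap X f q w + hankelMap X q f w)) := rfl
    rw [h4] at heq
    rw [neg_add_eq_sub, sub_eq_iff_eq_add] at heq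
    rw [heq, add_comm (hankelMap X f q w)]
  have hplus : f + s.val • (f ⊙ Cplus (star q ⊙ m) + q ⊙ Cplus (star f ⊙ m))
      ∈ hardyPlus (X := X) := by
    refine add_mem hf (Submodule.smul_mem _ _ (add_mem ?_ ?_))
    · rw [mul_comm']
      exact (wiener_Cplus_star_mul hq.1 hmsob).mul_mem_plus (Cplus_mem _) hf
    · rw [mul_comm']
      exact (wiener_Cplus_star_mul hf hmsob).mul_mem_plus (Cplus_mem _) hq.1
  rw [← resolv_of_laxFactor hq hκ hplus hL]
  have h5 : HasDerivAt (fun ε => freeResolvent X 1 (density s κ (Q ε)))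
      (freeResolvent X 1 w') 0 :=
    ((freeResolvent X 1).restrictScalars ℝ).hasFDerivAt.comp_hasDerivAt 0 hw'
  exact h5.congr_of_eventuallyEq (hev.mono fun ε h => mkappa_eq h hκ)

/-- The Wirtinger derivative `δβ/δq̄`. -/
def wirtinger (s : Sign) (κ : ℝ) (q : L2 X) : L2 X :=
  mkappa s κ q + s.val • Cplus (mkappa s κ q ⊙ Cminus (q ⊙ star (mkappa s κ q)))

lemma star_star_mul {m : L2 X} (hm : Wiener m) (q : L2 X) :
    star (star q ⊙ m) = q ⊙ star m := by
  rw [star_mul' (hm.memLp_mul' _), star_star]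

/-- The conjugate of `C₊(q̄ m)` is `C₋(q m̄)`. -/
lemma star_Cplus_star_mul {m : L2 X} (hm : Wiener m) (q : L2 X) :
    star (Cplus (star q ⊙ m)) = Cminus (q ⊙ star m) := by
  rw [star_Cplus, star_star_mul hm]

lemma wirtinger_mem_plus {s : Sign} {q : L2 X} (hq : q ∈ phaseSpace X s) {κ : ℝ} (hκ : 1 ≤ κ) :
    wirtinger s κ q ∈ hardyPlus (X := X) :=
  add_mem (mkappa_mem_sobolevPlus hq hκ).1 (Submodule.smul_mem _ _ (Cplus_mem _))

/-- The derivative of `β` in the direction `f` is `2 Re ⟨f, a⟩`. -/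
lemma hasDerivAt_beta {s : Sign} {q f : L2 X} (hq : q ∈ phaseSpace X s)
    (hf : f ∈ hardyPlus (X := X)) {κ : ℝ} (hκ : 1 ≤ κ) :
    HasDerivAt (fun ε : ℝ => beta s κ (q + (ε : ℂ) • f))
      (conj (inner ℂ f (wirtinger s κ q)) + inner ℂ f (wirtinger s κ q)) 0 := by
  have hmsob := mkappa_mem_sobolevPlus hq hκ
  have h1 := (hasDerivAt_line q f).inner ℂ (hasDerivAt_mkappa hq hf hκ)
  simp only [Complex.ofReal_zero, zero_smul, add_zero] at h1
  set m := mkappa s κ q with hm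
  have hmw : Wiener m := wiener_of_sobolevPlus hmsob
  have hWq := wiener_Cplus_star_mul hq.1 hmsob
  have hWf := wiener_Cplus_star_mul hf hmsob
  set B := Cplus (star q ⊙ m) with hB
  have hplus1 : f ⊙ B ∈ hardyPlus (X := X) := by
    rw [mul_comm']; exact hWq.mul_mem_plus (Cplus_mem _) hf
  have hplus2 : q ⊙ Cplus (star f ⊙ m) ∈ hardyPlus (X := X) := by
    rw [mul_comm']; exact hWf.mul_mem_plus (Cplus_mem _) hq.1
  have hrhs : f + s.val • (f ⊙ B + q ⊙ Cplus (star f ⊙ m)) ∈ hardyPlus (X := X) :=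
    add_mem hf (Submodule.smul_mem _ _ (add_mem hplus1 hplus2))
  have h2 : inner ℂ q (resolv s κ q (f + s.val • (f ⊙ B + q ⊙ Cplus (star f ⊙ m))))
      = inner ℂ m (f + s.val • (f ⊙ B + q ⊙ Cplus (star f ⊙ m))) :=
    inner_resolv_symm hq hκ hq.1 hrhs
  rw [h2] at h1
  -- `c` is the pairing of `f` with `m C₋(q m̄)`
  set c := inner ℂ f (m ⊙ star B) with hc
  have hBs : Wiener (star B) := hWq.star
  have e1 : inner ℂ m (f ⊙ B) = conj c := by
    rw [hc, inner_conj_symm, mul_comm' f B, mul_comm' m (star B), inner_mul_right (hWq.memLp_mul _)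
      (hBs.memLp_mul _)]
  have e2 : inner ℂ m (q ⊙ Cplus (star f ⊙ m)) = c := by
    rw [inner_mul_Cplus hmsob hf hmsob, ← hB, inner_Cplus, Cplus_of_mem (Cplus_mem _), hc,
      mul_comm' m (star B), inner_mul_right (hBs.memLp_mul _) ?_, star_star, mul_comm' (star f) m,
      inner_mul_right (hmw.memLp_mul _) (hmw.star.memLp_mul _), inner_eq, inner_eq]
    · refine integral_congr_ae ?_
      filter_upwards [coeFn_mul (hmw.star.memLp_mul B), coeFn_mul (hWq.memLp_mul f),
        coeFn_star' m, coeFn_star' f] with x a1 a2 a3 a4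
      rw [a1, a2, a3, a4]
      simp only [map_mul, Complex.conj_conj]
      ring
    · rw [star_star]; exact hWq.memLp_mul _
  have e3 : inner ℂ f (wirtinger s κ q) = inner ℂ f m + s.val * c := by
    rw [wirtinger, inner_add_right, inner_smul_right, inner_Cplus, Cplus_of_mem hf, ← hm, hc, hB,
      star_Cplus_star_mul hmw]
  refine h1.congr_deriv ?_
  rw [e3, inner_add_right, inner_smul_right, inner_add_right, e1, e2, map_add, map_mul,
    Sign.conj_val, inner_conj_symm m f]
  ring

lemma isWirtingerBar_beta {s : Sign} {q : L2 X} (hq : q ∈ phaseSpace X s) {κ : ℝ} (hκ : 1 ≤ κ) :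
    IsWirtingerBar (beta s κ) q (wirtinger s κ q) := by
  refine ⟨wirtinger_mem_plus hq hκ, star (wirtinger s κ q),
    star_mem_minus (wirtinger_mem_plus hq hκ), fun f hf => ?_⟩
  have h := hasDerivAt_beta hq hf hκ
  rwa [inner_conj_symm, ← inner_star_star] at h

/-- Replacing `f` by `i f` separates the two terms, so the Wirtinger derivative is unique. -/
lemma IsWirtingerBar.unique {F : L2 X → ℂ} {q a a' : L2 X} (h : IsWirtingerBar F q a)
    (h' : IsWirtingerBar F q a') : a = a' := by
  obtain ⟨ha, b, -, hb⟩ := h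
  obtain ⟨ha', b', -, hb'⟩ := h'
  have h1 : ∀ f ∈ hardyPlus (X := X), inner ℂ (star f) (b - b') + inner ℂ f (a - a') = 0 := by
    intro f hf
    have := (hb f hf).unique (hb' f hf)
    rw [inner_sub_right, inner_sub_right]
    linear_combination this
  have h2 := h1 _ (sub_mem ha ha')
  have h3 := h1 _ (Submodule.smul_mem _ Complex.I (sub_mem ha ha'))
  rw [star_smul', inner_smul_left, inner_smul_left, Complex.conj_conj, Complex.conj_I] at h3
  have h4 : inner ℂ (a - a') (a - a') = 0 := by
    have h5 : 2 * inner ℂ (a - a') (a - a') = 0 := by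
      linear_combination h2 + Complex.I * h3
        + (inner ℂ (a - a') (a - a') - inner ℂ (star (a - a')) (b - b')) * Complex.I_sq
    simpa using h5
  rw [inner_self_eq_zero, sub_eq_zero] at h4
  exact h4

lemma isWirtingerBar_iff {s : Sign} {q : L2 X} (hq : q ∈ phaseSpace X s) {κ : ℝ} (hκ : 1 ≤ κ)
    (a : L2 X) : IsWirtingerBar (beta s κ) q a ↔ a = wirtinger s κ q :=
  ⟨fun h => IsWirtingerBar.unique h (isWirtingerBar_beta hq hκ), fun h => h ▸ isWirtingerBar_beta hq hκ⟩

/-- `β_κ(q) = ⟨q, (D + 1)⁻¹ w(q)⟩` with the smooth map `w` of `contDiffAt_density`. -/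
lemma contDiffOn_beta (s : Sign) {κ : ℝ} (hκ : 1 ≤ κ) :
    ContDiffOn ℝ 1 (fun q : hardyPlus (X := X) => beta s κ (q : L2 X))
      {q | (q : L2 X) ∈ phaseSpace X s} := by
  have h1 : ∀ q ∈ {q : hardyPlus (X := X) | (q : L2 X) ∈ phaseSpace X s},
      ContDiffAt ℝ 1 (fun q : hardyPlus (X := X) =>
        inner ℂ (q : L2 X) (freeResolvent X 1 (density s κ (q : L2 X)))) q := by
    intro q hq
    have hc : ContDiff ℝ 1 (fun q : hardyPlus (X := X) => (q : L2 X)) :=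
      ((hardyPlus (X := X)).subtypeL.restrictScalars ℝ).contDiff
    have hd : ContDiffAt ℝ 1 (fun q : hardyPlus (X := X) => density s κ (q : L2 X)) q :=
      (contDiffAt_density hq hκ).comp q hc.contDiffAt
    exact hc.contDiffAt.inner ℂ
      (((freeResolvent X 1).restrictScalars ℝ).contDiff.contDiffAt.comp q hd)
  refine ContDiffOn.congr (fun q hq => (h1 q hq).contDiffWithinAt) fun q hq => ?_
  rw [beta, mkappa_eq hq hκ]

end

end FourierModel

end CalogeroMoser

namespace CalogeroMoser

/-- What the argument needs to know about the operator `∂̃⁻¹`: it inverts `∂` up to the mean, is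
bounded from `L¹` to `L^∞`, additive, and insensitive to null sets. -/
class AntiderivModel (X : Type) [MeasureSpace X] [GeometryData X] where
  /-- the weight of the mean: `0` on the line and `1 / 2π` on the torus -/
  c₀ : ℝ
  /-- the mean is the Fourier coefficient at the frequency zero -/
  mul_zero_mode : ∀ f g : L2 X, g ⊙ (Cplus f - (f - Cminus f)) = (c₀ * ∫ x, f x) • g
  /-- `∂̃⁻¹` inverts `∂` up to the mean -/
  antideriv_deriv : ∀ f g : L2 X, IsDeriv f g → Integrable g volume →
    ∀ᵐ x, antideriv (fun y => (g y).re) x = (f x - c₀ * ∫ y, f y).re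
  abs_antideriv_le : ∀ F : X → ℝ, Integrable F volume → ∀ x, |antideriv F x| ≤ 1 / 2 * ∫ y, |F y|
  aestronglyMeasurable_antideriv : ∀ F : X → ℝ, Integrable F volume →
    AEStronglyMeasurable (antideriv F) volume
  antideriv_sub : ∀ F G : X → ℝ, Integrable F volume → Integrable G volume →
    ∀ x, antideriv (fun y => F y - G y) x = antideriv F x - antideriv G x
  antideriv_congr : ∀ F G : X → ℝ, F =ᵐ[volume] G → antideriv F = antideriv G

section

variable {X : Type} [MeasureSpace X] [GeometryData X]

/-- The operator `-2i(𝓛_q+κ)⁻¹ ± 2i m_κ C₊ m̄_κ ∓ 2ic β_κ (𝓛_q+κ)⁻¹ ∓ 2ic ‖m_κ‖²`. -/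
def peter (c : ℝ) (s : Sign) (κ : ℝ) (q f : L2 X) : L2 X :=
  -((2 * Complex.I) • resolv s κ q f)
    + (2 * Complex.I * s.val) • (mkappa s κ q ⊙ Cplus (star (mkappa s κ q) ⊙ f))
    - (s.val * (2 * Complex.I * c) * beta s κ q) • resolv s κ q f
    - (s.val * (2 * Complex.I * c) * (‖mkappa s κ q‖ ^ 2 : ℝ)) • f

end

namespace FourierModel

section

variable {X Γ : Type} [MeasureSpace X] [GeometryData X] [AddCommGroup Γ]
  [MeasurableSpace Γ] [MeasurableAdd₂ Γ] [MeasurableNeg Γ] [fm : FourierModel X Γ]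
  [SFinite (volume : Measure X)]

include fm

/-! ### The commutator of the Peter operator with the Lax operator -/

lemma Wiener.smul {f : L2 X} (hf : Wiener f) (c : ℂ) : Wiener (c • f) :=
  Wiener.of_ae (Integrable.const_mul hf c) (U_smul c f)

lemma resolv_lax {s : Sign} {q : L2 X} (hq : q ∈ phaseSpace X s) {κ : ℝ} (hκ : 1 ≤ κ) {u : L2 X}
    (hu : u ∈ sobolevPlus X) :
    resolv s κ q (lax s q u) = u - (κ : ℂ) • resolv s κ q u := by
  have h := resolv_spec hq hκ hu.1
  refine resolv_eq hq hκ (u := u - (κ : ℂ) • resolv s κ q u) ?_ ?_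
  · rw [sub_eq_add_neg, ← neg_smul]
    exact sobolevPlus_add hu (sobolevPlus_smul h.1 _)
  · rw [sub_eq_add_neg, ← neg_smul, lax_add s hq.1 hu (sobolevPlus_smul h.1 _), lax_smul s h.1]
    nth_rw 3 [← h.2]
    module

lemma lax_resolv {s : Sign} {q : L2 X} (hq : q ∈ phaseSpace X s) {κ : ℝ} (hκ : 1 ≤ κ) {u : L2 X}
    (hu : u ∈ hardyPlus (X := X)) :
    lax s q (resolv s κ q u) = u - (κ : ℂ) • resolv s κ q u :=
  eq_sub_of_add_eq (resolv_spec hq hκ hu).2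

lemma Cplus_star_mul_mem_sobolevPlus {m u : L2 X} (hm : m ∈ sobolevPlus X)
    (hu : u ∈ sobolevPlus X) : Cplus (star m ⊙ u) ∈ sobolevPlus X :=
  ⟨Cplus_mem _, _, IsDeriv.Cplus (IsDeriv.mul (IsDeriv.star (isDeriv_dx hm)) (isDeriv_dx hu))⟩

lemma D_Cplus_star_mul {m u : L2 X} (hm : m ∈ sobolevPlus X) (hu : u ∈ sobolevPlus X) :
    -(Complex.I • dx (Cplus (star m ⊙ u)))
      = Cplus (star m ⊙ -(Complex.I • dx u)) - Cplus (u ⊙ star (-(Complex.I • dx m))) := by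
  rw [IsDeriv.dx_eq (IsDeriv.Cplus
    (IsDeriv.mul (IsDeriv.star (isDeriv_dx hm)) (isDeriv_dx hu))), ← neg_smul, ← neg_smul,
    ← neg_smul, star_smul', mul_smul', mul_smul', Cplus_smul, Cplus_smul, Cplus_add, map_neg,
    Complex.conj_I]
  module

lemma D_mul {u v : L2 X} (hu : u ∈ sobolevPlus X) (hv : v ∈ sobolevPlus X) :
    -(Complex.I • dx (u ⊙ v)) = v ⊙ -(Complex.I • dx u) + u ⊙ -(Complex.I • dx v) := by
  rw [IsDeriv.dx_eq (IsDeriv.mul (isDeriv_dx hu) (isDeriv_dx hv)), ← neg_smul, ← neg_smul,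
    ← neg_smul, mul_smul', mul_smul']
  module

lemma peter_mem_sobolevPlus (c : ℝ) {s : Sign} {q : L2 X} (hq : q ∈ phaseSpace X s) {κ : ℝ}
    (hκ : 1 ≤ κ) {u : L2 X} (hu : u ∈ sobolevPlus X) : peter c s κ q u ∈ sobolevPlus X := by
  have hm := mkappa_mem_sobolevPlus hq hκ
  have h1 := (resolv_spec hq hκ hu.1).1
  have h2 := sobolevPlus_mul hm (Cplus_star_mul_mem_sobolevPlus hm hu)
  rw [peter, sub_eq_add_neg, sub_eq_add_neg, ← neg_smul, ← neg_smul, ← neg_smul]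
  exact sobolevPlus_add (sobolevPlus_add (sobolevPlus_add (sobolevPlus_smul h1 _)
    (sobolevPlus_smul h2 _)) (sobolevPlus_smul h1 _)) (sobolevPlus_smul hu _)

lemma Cplus_mul_sub_Cplus {f g : L2 X} (hf : f ∈ hardyMinus (X := X))
    (h : Wiener f ∨ Wiener (g - Cplus g)) : Cplus (f ⊙ (g - Cplus g)) = 0 := by
  rw [Cplus_eq_zero_iff]
  rcases h with h | h
  · exact SuppIn.mul (s := Iic 0) (t := Iio 0)
      (fun a ha b hb => by simp only [mem_Iic, mem_Iio] at *; linarith) h (mem_minus_iff.1 hf)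
      (SuppIn.sub_Cplus g)
  · rw [mul_comm']
    exact SuppIn.mul (s := Iio 0) (t := Iic 0)
      (fun a ha b hb => by simp only [mem_Iic, mem_Iio] at *; linarith) h (SuppIn.sub_Cplus g)
      (mem_minus_iff.1 hf)

/-- The vector field of the flow. In terms of the projection `C_>` to the strictly positive
frequencies no term with `β_κ` is needed: on the torus, that term of the symplectic gradient
accounts for the mean `c₀ ⟨m, q⟩` of `q m̄`, by which `C₊(q m̄)` and `C_>(q m̄)` differ. -/
def hamVec (c : ℝ) (s : Sign) (κ : ℝ) (q : L2 X) : L2 X :=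
  -((2 * Complex.I) • mkappa s κ q)
    + (2 * Complex.I * s.val) • (mkappa s κ q ⊙ Cpos (q ⊙ star (mkappa s κ q)))
    - (s.val * (2 * Complex.I * c) * (‖mkappa s κ q‖ ^ 2 : ℝ)) • q

lemma hamVec_mem_plus (c : ℝ) {s : Sign} {q : L2 X} (hq : q ∈ phaseSpace X s) {κ : ℝ}
    (hκ : 1 ≤ κ) : hamVec c s κ q ∈ hardyPlus (X := X) := by
  have hm := mkappa_mem_sobolevPlus hq hκ
  exact sub_mem (add_mem (neg_mem (Submodule.smul_mem _ _ hm.1)) (Submodule.smul_mem _ _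
    ((wiener_of_sobolevPlus hm).mul_mem_plus hm.1 (Cpos_mem_plus _)))) (Submodule.smul_mem _ _ hq.1)

lemma mul_star_eq {s : Sign} {q : L2 X} (hq : q ∈ phaseSpace X s) {κ : ℝ} (hκ : 1 ≤ κ) :
    q ⊙ star (mkappa s κ q) = Cpos (q ⊙ star (mkappa s κ q))
      + star (Cplus (star q ⊙ mkappa s κ q)) := by
  have hmw := wiener_of_sobolevPlus (mkappa_mem_sobolevPlus hq hκ)
  have h := eq_Cpos_add_star (q ⊙ star (mkappa s κ q))
  rwa [star_mul' (hmw.star.memLp_mul' q), star_star] at h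

/-- The derivative of `q ↦ 𝓛_q u` in the direction `d`. -/
def laxVariation (s : Sign) (q d u : L2 X) : L2 X :=
  -(s.val • (d ⊙ Cplus (star q ⊙ u) + q ⊙ Cplus (star d ⊙ u)))

/-- The commutator identity behind the Lax pair. With `a = q m̄ = A + B̄`, `A = C_>(q m̄)` and
`B = C₊(q̄ m)`, it comes down to `C₊(B̄ q̄ u) = C₊(B̄ C₊(q̄ u))` and
`C₊(Ā m̄ u) = C₊(Ā C₊(m̄ u))`. -/
lemma peter_commutator (c : ℝ) {s : Sign} {q : L2 X} (hq : q ∈ phaseSpace X s) {κ : ℝ}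
    (hκ : 1 ≤ κ) {u : L2 X} (hu : u ∈ sobolevPlus X) :
    peter c s κ q (lax s q u) - lax s q (peter c s κ q u)
      = laxVariation s q (hamVec c s κ q) u := by
  have hm := mkappa_mem_sobolevPlus hq hκ
  have hspec := (mkappa_spec hq hκ).2
  have hsplit := mul_star_eq hq hκ
  have hR := (resolv_spec hq hκ hu.1).1
  have hw'sob := Cplus_star_mul_mem_sobolevPlus hm hu
  have hWw := wiener_Cplus_star_mul hq.1 hu
  have hWB := wiener_Cplus_star_mul hq.1 hm
  have hmW := wiener_of_sobolevPlus hm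
  have huW := wiener_of_sobolevPlus hu
  have hw'W := wiener_of_sobolevPlus hw'sob
  have hmw' := sobolevPlus_mul hm hw'sob
  have hlaxR := lax_resolv hq hκ hu.1
  have hRlax := resolv_lax hq hκ hu
  rw [hamVec, peter, peter]
  set m := mkappa s κ q with hmdef
  have hμc : conj (s.val * (2 * Complex.I * c) * ((‖m‖ ^ 2 : ℝ) : ℂ))
      = -(s.val * (2 * Complex.I * c) * ((‖m‖ ^ 2 : ℝ) : ℂ)) := by
    simp only [map_mul, Sign.conj_val, Complex.conj_I, Complex.conj_ofReal, Complex.conj_ofNat]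
    ring
  generalize hβ : s.val * (2 * Complex.I * c) * beta s κ q = β
  generalize hμ : s.val * (2 * Complex.I * c) * ((‖m‖ ^ 2 : ℝ) : ℂ) = μ at hμc ⊢
  set R := resolv s κ q u with hRdef
  set w := Cplus (star q ⊙ u) with hwdef
  set w' := Cplus (star m ⊙ u) with hw'def
  set B := Cplus (star q ⊙ m) with hBdef
  set A := Cpos (q ⊙ star m) with hAdef
  have hqm : star q ⊙ m = star A + B := by
    have h := congrArg star hsplit
    rwa [star_mul' (hmW.star.memLp_mul' q), star_star, star_add', star_star] at h
  -- the two identities for the Cauchy-Szegő projections of triple products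
  have K1 : Cplus (star m ⊙ (q ⊙ w)) = A ⊙ w + Cplus (u ⊙ star (q ⊙ B)) := by
    have h1 : star m ⊙ (q ⊙ w) = A ⊙ w + star B ⊙ w := by
      rw [← mul_assoc_of_memLp (hmW.star.memLp_mul q) (hWw.memLp_mul' q), mul_comm' (star m) q,
        hsplit, add_mul_of_memLp (hWw.memLp_mul' A) (hWw.memLp_mul' _)]
    have h2 : Cplus (A ⊙ w) = A ⊙ w := Cplus_of_mem <| by
      rw [mul_comm']; exact hWw.mul_mem_plus (Cplus_mem _) (Cpos_mem_plus _)
    have h3 : u ⊙ star (q ⊙ B) = star B ⊙ (star q ⊙ u) := by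
      rw [star_mul' (hWB.memLp_mul' q), mul_comm' (star q),
        ← mul_assoc_of_memLp (hWB.star.memLp_mul' u) (hWB.star.memLp_mul _), mul_comm' u,
        mul_assoc_of_memLp (hWB.star.memLp_mul u) (huW.memLp_mul _), mul_comm' u]
    have h4 := Cplus_mul_sub_Cplus (f := star B) (g := star q ⊙ u) (star_mem_minus (Cplus_mem _))
      (Or.inl hWB.star)
    rw [mul_sub_of_memLp (hWB.star.memLp_mul _) (hWB.star.memLp_mul _), Cplus_sub,
      sub_eq_zero] at h4
    rw [h1, Cplus_add, h2, h3, h4]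
  have K2 : Cplus (star q ⊙ (m ⊙ w')) = B ⊙ w' + Cplus (star (m ⊙ A) ⊙ u) := by
    have h1 : star q ⊙ (m ⊙ w') = star A ⊙ w' + B ⊙ w' := by
      rw [← mul_assoc_of_memLp (hmW.memLp_mul' _) (hmW.memLp_mul w'), hqm,
        add_mul_of_memLp (hw'W.memLp_mul' _) (hw'W.memLp_mul' _)]
    have h2 : Cplus (B ⊙ w') = B ⊙ w' := Cplus_of_mem <|
      hWB.mul_mem_plus (Cplus_mem _) (Cplus_mem _)
    have h3 : star (m ⊙ A) ⊙ u = star A ⊙ (star m ⊙ u) := by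
      rw [star_mul' (hmW.memLp_mul A), mul_comm' (star m),
        mul_assoc_of_memLp (hmW.star.memLp_mul' _) (hmW.star.memLp_mul _)]
    have hmu : Wiener (star m ⊙ u) :=
      IsDeriv.wiener (IsDeriv.mul (IsDeriv.star (isDeriv_dx hm)) (isDeriv_dx hu))
    have h4 := Cplus_mul_sub_Cplus (f := star A) (g := star m ⊙ u)
      (star_mem_minus (Cpos_mem_plus _)) (Or.inr (hmu.sub hmu.Cplus))
    rw [mul_sub_of_memLp (hmu.memLp_mul' _) (hw'W.memLp_mul' _), Cplus_sub,
      sub_eq_zero] at h4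
    rw [h1, Cplus_add, h2, h3, h4, add_comm]
  have hDm : -(Complex.I • dx m) = q + (-κ : ℂ) • m + s.val • (q ⊙ B) := by
    rw [lax] at hspec
    linear_combination (norm := module) hspec
  have hLmw : lax s q (m ⊙ w') = w' ⊙ q + s.val • (w' ⊙ (q ⊙ B))
      + m ⊙ Cplus (star m ⊙ -(Complex.I • dx u)) - m ⊙ w - s.val • (m ⊙ Cplus (u ⊙ star (q ⊙ B)))
      - s.val • (q ⊙ Cplus (star q ⊙ (m ⊙ w'))) := by
    have h1 : star (q + (-κ : ℂ) • m + s.val • (q ⊙ B))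
        = star q + (-κ : ℂ) • star m + s.val • star (q ⊙ B) := by
      rw [star_add', star_add', star_smul', star_smul', Sign.conj_val, map_neg,
        Complex.conj_ofReal]
    have h2 : Cplus (u ⊙ (star q + (-κ : ℂ) • star m + s.val • star (q ⊙ B)))
        = w + (-κ : ℂ) • w' + s.val • Cplus (u ⊙ star (q ⊙ B)) := by
      rw [mul_add_of_memLp (huW.memLp_mul _) (huW.memLp_mul _),
        mul_add_of_memLp (huW.memLp_mul _) (huW.memLp_mul _), mul_smul', mul_smul', Cplus_add,
        Cplus_add, Cplus_smul, Cplus_smul, mul_comm' u (star q), mul_comm' u (star m)]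
    rw [lax, D_mul hm hw'sob, hw'def, D_Cplus_star_mul hm hu, ← hw'def, hDm, h1, h2,
      mul_add_of_memLp (hw'W.memLp_mul _) (hw'W.memLp_mul _),
      mul_add_of_memLp (hw'W.memLp_mul _) (hw'W.memLp_mul _), mul_smul', mul_smul',
      mul_sub_of_memLp (hmW.memLp_mul _) (hmW.memLp_mul _),
      mul_add_of_memLp (hmW.memLp_mul _) (hmW.memLp_mul _),
      mul_add_of_memLp (hmW.memLp_mul _) (hmW.memLp_mul _), mul_smul', mul_smul', mul_comm' w' m]
    module
  have hPL : m ⊙ Cplus (star m ⊙ lax s q u) = m ⊙ Cplus (star m ⊙ -(Complex.I • dx u))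
      - s.val • (m ⊙ Cplus (star m ⊙ (q ⊙ w))) := by
    rw [lax, mul_sub_of_memLp (hmW.star.memLp_mul _) (hmW.star.memLp_mul _), mul_smul', Cplus_sub,
      Cplus_smul, mul_sub_of_memLp (hmW.memLp_mul _) (hmW.memLp_mul _), mul_smul']
  have hLP : lax s q (-((2 * Complex.I) • R) + (2 * Complex.I * s.val) • (m ⊙ w') - β • R - μ • u)
      = (-(2 * Complex.I) - β) • (u - (κ : ℂ) • R)
        + ((2 * Complex.I * s.val) • lax s q (m ⊙ w') + (-μ) • lax s q u) := by
    rw [← hlaxR, ← lax_smul s hR, ← lax_smul s hmw', ← lax_smul s hu,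
      ← lax_add s hq.1 (sobolevPlus_smul hmw' _) (sobolevPlus_smul hu _),
      ← lax_add s hq.1 (sobolevPlus_smul hR _)
        (sobolevPlus_add (sobolevPlus_smul hmw' _) (sobolevPlus_smul hu _))]
    congr 1
    module
  set v := -((2 * Complex.I) • m) + (2 * Complex.I * s.val) • (m ⊙ A) - μ • q with hv
  have hv' : v = (-(2 * Complex.I)) • m + (2 * Complex.I * s.val) • (m ⊙ A) + (-μ) • q := by
    rw [hv]; module
  have hvw : v ⊙ w = (-(2 * Complex.I)) • (m ⊙ w) + (2 * Complex.I * s.val) • (m ⊙ (A ⊙ w))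
      + (-μ) • (q ⊙ w) := by
    rw [hv', add_mul_of_memLp (hWw.memLp_mul' _) (hWw.memLp_mul' _),
      add_mul_of_memLp (hWw.memLp_mul' _) (hWw.memLp_mul' _), smul_mul', smul_mul', smul_mul',
      mul_assoc_of_memLp (hmW.memLp_mul _) (hWw.memLp_mul' _)]
  have hsv : star v = (2 * Complex.I) • star m + (-(2 * Complex.I * s.val)) • star (m ⊙ A)
      + μ • star q := by
    rw [hv', star_add', star_add', star_smul', star_smul', star_smul']
    simp only [map_neg, map_mul, Complex.conj_I, Sign.conj_val, hμc, Complex.conj_ofNat]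
    module
  have hW5 : Wiener (Cplus (star (m ⊙ A) ⊙ u)) :=
    wiener_Cplus_star_mul (hmW.mul_mem_plus hm.1 (Cpos_mem_plus _)) hu
  have hvu : q ⊙ Cplus (star v ⊙ u) = (2 * Complex.I) • (q ⊙ w')
      + (-(2 * Complex.I * s.val)) • (q ⊙ Cplus (star (m ⊙ A) ⊙ u)) + μ • (q ⊙ w) := by
    rw [hsv, add_mul_of_memLp (huW.memLp_mul' _) (huW.memLp_mul' _),
      add_mul_of_memLp (huW.memLp_mul' _) (huW.memLp_mul' _), smul_mul', smul_mul', smul_mul',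
      Cplus_add, Cplus_add, Cplus_smul, Cplus_smul, Cplus_smul]
    have hq1 : MemLp (fun x => q x * ((2 * Complex.I) • w') x) 2 volume :=
      (wiener_of_sobolevPlus (sobolevPlus_smul hw'sob _)).memLp_mul' q
    have hq2 := (hW5.smul (-(2 * Complex.I * s.val))).memLp_mul' q
    have hq3 := (hWw.smul μ).memLp_mul' q
    rw [mul_add_of_memLp (((wiener_of_sobolevPlus (sobolevPlus_smul hw'sob _)).add
      (hW5.smul _)).memLp_mul' q) hq3, mul_add_of_memLp hq1 hq2, mul_smul', mul_smul', mul_smul']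
  have hK1 : m ⊙ Cplus (star m ⊙ (q ⊙ w)) = m ⊙ (A ⊙ w) + m ⊙ Cplus (u ⊙ star (q ⊙ B)) := by
    rw [K1, mul_add_of_memLp (hmW.memLp_mul _) (hmW.memLp_mul _)]
  have hK2 : q ⊙ Cplus (star q ⊙ (m ⊙ w'))
      = w' ⊙ (q ⊙ B) + q ⊙ Cplus (star (m ⊙ A) ⊙ u) := by
    have hBw : Wiener (B ⊙ w') := by
      have h := (wiener_Cplus_star_mul hq.1 hmw').sub hW5
      rwa [K2, add_sub_cancel_right] at h
    rw [K2, mul_add_of_memLp (hBw.memLp_mul' q) (hW5.memLp_mul' q),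
      ← mul_assoc_of_memLp (hWB.memLp_mul' q) (hw'W.memLp_mul' B), mul_comm' w']
  rw [hLP, hRlax, hPL, hLmw, laxVariation, hvw, hvu, hK1, hK2, mul_comm' w' q]
  module

end

end FourierModel

end CalogeroMoser

namespace CalogeroMoser

open AntiderivModel

namespace FourierModel

section

variable {X Γ : Type} [MeasureSpace X] [GeometryData X] [AddCommGroup Γ]
  [MeasurableSpace Γ] [MeasurableAdd₂ Γ] [MeasurableNeg Γ] [fm : FourierModel X Γ]
  [SFinite (volume : Measure X)] [am : AntiderivModel X]

include fm am

/-! ### Multiplication by antiderivatives -/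

/-- The product `q ∂̃⁻¹F`. -/
def mulAntideriv (q : L2 X) (F : X → ℝ) : L2 X := toL2 fun x => q x * (antideriv F x : ℝ)

lemma memLp_mulAntideriv (q : L2 X) {F : X → ℝ} (hF : Integrable F volume) :
    MemLp (fun x => q x * (antideriv F x : ℝ)) 2 volume := by
  refine MemLp.of_le_mul (c := 1 / 2 * ∫ y, |F y|) (Lp.memLp q)
    ((Lp.aestronglyMeasurable q).mul
      (Complex.continuous_ofReal.comp_aestronglyMeasurable
        (aestronglyMeasurable_antideriv F hF))) (.of_forall fun x => ?_)
  rw [norm_mul, Complex.norm_real, Real.norm_eq_abs, mul_comm]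
  gcongr
  exact abs_antideriv_le F hF x

lemma coeFn_mulAntideriv (q : L2 X) {F : X → ℝ} (hF : Integrable F volume) :
    (mulAntideriv q F : X → ℂ) =ᵐ[volume] fun x => q x * (antideriv F x : ℝ) :=
  coeFn_toL2 (memLp_mulAntideriv q hF)

lemma norm_mulAntideriv_le (q : L2 X) {F : X → ℝ} (hF : Integrable F volume) :
    ‖mulAntideriv q F‖ ≤ 1 / 2 * (∫ y, |F y|) * ‖q‖ := by
  refine Lp.norm_le_mul_norm_of_ae_le_mul ?_
  filter_upwards [coeFn_mulAntideriv q hF] with x hx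
  rw [hx, norm_mul, Complex.norm_real, Real.norm_eq_abs, mul_comm]
  gcongr
  exact abs_antideriv_le F hF x

lemma mulAntideriv_sub (q : L2 X) {F G : X → ℝ} (hF : Integrable F volume)
    (hG : Integrable G volume) :
    mulAntideriv q (fun y => F y - G y) = mulAntideriv q F - mulAntideriv q G := by
  refine Lp.ext ?_
  filter_upwards [coeFn_mulAntideriv q hF, coeFn_mulAntideriv q hG,
    coeFn_mulAntideriv q (hF.sub hG), Lp.coeFn_sub (mulAntideriv q F) (mulAntideriv q G)]
    with x h1 h2 h3 h4
  have h5 : antideriv (F - G) x = antideriv F x - antideriv G x := antideriv_sub F G hF hG x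
  rw [h5] at h3
  refine Eq.trans h3 ?_
  rw [h4, Pi.sub_apply, h1, h2]
  push_cast
  ring

lemma mulAntideriv_congr (q : L2 X) {F G : X → ℝ} (h : F =ᵐ[volume] G) :
    mulAntideriv q F = mulAntideriv q G := by
  rw [mulAntideriv, mulAntideriv, antideriv_congr F G h]

lemma integrable_re_conj_mul (q g : L2 X) :
    Integrable (fun y => (conj (q y) * g y).re) volume := (integrable_conj_mul q g).re

lemma Theta_eq (q g : L2 X) :
    Theta q g = Complex.I • mulAntideriv q (fun y => (conj (q y) * g y).re) := by
  have h := memLp_mulAntideriv q (integrable_re_conj_mul q g)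
  refine Lp.ext ?_
  have h' : MemLp (fun x => Complex.I * q x
      * (antideriv (fun y => (conj (q y) * g y).re) x : ℝ)) 2 volume := by
    simpa only [mul_assoc] using h.const_mul Complex.I
  filter_upwards [coeFn_toL2 h', coeFn_mulAntideriv q (integrable_re_conj_mul q g),
    Lp.coeFn_smul Complex.I (mulAntideriv q (fun y => (conj (q y) * g y).re))] with x h1 h2 h3
  rw [Theta, h1, h3, Pi.smul_apply, h2, smul_eq_mul, mul_assoc]

lemma Theta_sub (q g h : L2 X) : Theta q (g - h) = Theta q g - Theta q h := by
  rw [Theta_eq, Theta_eq, Theta_eq, ← smul_sub, ← mulAntideriv_sub q (integrable_re_conj_mul q g)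
    (integrable_re_conj_mul q h)]
  congr 1
  refine mulAntideriv_congr q ?_
  filter_upwards [Lp.coeFn_sub g h] with x h1
  rw [h1, Pi.sub_apply, mul_sub, Complex.sub_re]

lemma Omega_sub (s : Sign) (q g h : L2 X) : Omega s q (g - h) = Omega s q g - Omega s q h := by
  rw [Omega, Omega, Omega, Theta_sub, Cplus_sub]
  module

lemma Omega_mem_plus (s : Sign) {q g : L2 X} (hg : g ∈ hardyPlus (X := X)) :
    Omega s q g ∈ hardyPlus (X := X) :=
  Submodule.smul_mem _ _ (sub_mem hg (Submodule.smul_mem _ _ (Cplus_mem _)))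

/-- Functions with frequencies bounded away from zero and integrable Fourier transform are dense
among those with strictly positive frequencies. -/
lemma exists_wiener_suppIn_near {p : L2 X} (hp : SuppIn (Ioi 0) p) {ε : ℝ} (hε : 0 < ε) :
    ∃ p' : L2 X, Wiener p' ∧ (∃ δ > 0, SuppIn (Ici δ) p') ∧ ‖p - p'‖ < ε := by
  set P : ℕ → L2 X → L2 X :=
    fun n => mult X ((φ X ⁻¹' Ici ((1 : ℝ) / (n + 1))).indicator 1) with hP
  have hU : ∀ n f, (U (P n f) : Γ → ℂ) =ᵐ[ν X] (φ X ⁻¹' Ici ((1 : ℝ) / (n + 1))).indicator (U f) :=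
    fun n f => U_mult_indicator measurableSet_Ici f
  have hlim : Filter.Tendsto (fun n => ‖p - P n p‖ ^ 2) Filter.atTop (nhds 0) := by
    have h1 : ∀ n, ‖p - P n p‖ ^ 2
        = ∫ ξ, ‖U p ξ - (φ X ⁻¹' Ici ((1 : ℝ) / (n + 1))).indicator (U p) ξ‖ ^ 2 ∂(ν X) := by
      intro n
      rw [norm_sq_eq_U]
      refine integral_congr_ae ?_
      filter_upwards [U_sub p (P n p), hU n p] with ξ a1 a2
      rw [a1, a2]
    simp only [h1]
    have h0 : (0 : ℝ) = ∫ ξ : Γ, (0 : ℝ) ∂(ν X) := by simp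
    rw [h0]
    refine tendsto_integral_of_dominated_convergence (fun ξ => ‖U p ξ‖ ^ 2) (fun n => ?_)
      (memLp_U p).norm.integrable_sq (fun n => .of_forall fun ξ => ?_) ?_
    · exact (((measurable_U p).sub ((measurable_U p).indicator
        (measurable_φ measurableSet_Ici))).norm.pow_const 2).aestronglyMeasurable
    · rw [Real.norm_eq_abs, abs_of_nonneg (by positivity)]
      by_cases h : ξ ∈ φ X ⁻¹' Ici ((1 : ℝ) / (n + 1))
      · rw [indicator_of_mem h, sub_self, norm_zero, zero_pow two_ne_zero]; positivity
      · rw [indicator_of_notMem h, sub_zero]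
    · filter_upwards [hp] with ξ h
      by_cases hξ : 0 < φ X ξ
      · obtain ⟨N, hN⟩ := exists_nat_one_div_lt hξ
        refine tendsto_const_nhds.congr' ?_
        filter_upwards [Filter.eventually_ge_atTop N] with n hn
        have : ξ ∈ φ X ⁻¹' Ici ((1 : ℝ) / (n + 1)) := by
          refine le_trans ?_ hN.le
          gcongr
        rw [indicator_of_mem this, sub_self, norm_zero, zero_pow two_ne_zero]
      · rw [h hξ]
        refine tendsto_const_nhds.congr fun n => ?_
        have : ξ ∉ φ X ⁻¹' Ici ((1 : ℝ) / (n + 1)) := fun h1 =>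
          hξ (lt_of_lt_of_le (by positivity) h1)
        rw [indicator_of_notMem this, sub_zero, norm_zero, zero_pow two_ne_zero]
  obtain ⟨n, hn⟩ := (hlim.eventually_lt_const
    (show (0 : ℝ) < (ε / 2) ^ 2 by positivity)).exists
  have hn' : ‖p - P n p‖ < ε / 2 := lt_of_pow_lt_pow_left₀ 2 (by positivity) hn
  obtain ⟨g, hg, hgp⟩ := exists_wiener_near p (show 0 < ε / 2 by positivity)
  refine ⟨P n g, Wiener.indicator measurableSet_Ici (hU n g) hg,
    ⟨1 / (n + 1), by positivity, SuppIn.indicator (hU n g)⟩, ?_⟩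
  have h2 : ‖P n p - P n g‖ ≤ ‖p - g‖ := by
    have h3 : P n p - P n g = P n (p - g) := by
      change mult X _ p - mult X _ g = mult X _ (p - g)
      rw [map_sub]
    rw [h3]
    exact norm_le_of_U_indicator (hU n (p - g))
  calc ‖p - P n g‖ = ‖(p - P n p) + (P n p - P n g)‖ := by congr 1; abel
    _ ≤ ‖p - P n p‖ + ‖P n p - P n g‖ := norm_add_le _ _
    _ < ε := by linarith

/-- On functions with frequencies bounded away from zero, `D = -i∂` is invertible. -/
lemma exists_D_eq {f : L2 X} {δ : ℝ} (hδ : 0 < δ) (hf : SuppIn (Ici δ) f) :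
    ∃ u : L2 X, SuppIn (Ioi 0) u ∧ IsDeriv u (Complex.I • f) := by
  set b : Γ → ℂ := (φ X ⁻¹' Ici δ).indicator fun ξ => ((φ X ξ)⁻¹ : ℝ) with hb
  have hbm : Measurable b :=
    (Complex.measurable_ofReal.comp measurable_φ.inv).indicator (measurable_φ measurableSet_Ici)
  have hbC : ∀ ξ, ‖b ξ‖ ≤ δ⁻¹ := fun ξ => by
    rw [hb]
    by_cases h : ξ ∈ φ X ⁻¹' Ici δ
    · have h' : δ ≤ φ X ξ := h
      rw [indicator_of_mem h, Complex.norm_real, Real.norm_eq_abs,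
        abs_of_pos (inv_pos.2 (hδ.trans_le h'))]
      gcongr
    · rw [indicator_of_notMem h, norm_zero]; positivity
  refine ⟨mult X b f, ?_, (isDeriv_iff _ _).2 ?_⟩
  · filter_upwards [U_mult hbm hbC f] with ξ h1 h2
    have : ξ ∉ φ X ⁻¹' Ici δ := fun h => h2 (lt_of_lt_of_le hδ h)
    rw [h1, hb, indicator_of_notMem this, zero_mul]
  · filter_upwards [U_mult hbm hbC f, U_smul Complex.I f, hf] with ξ h1 h2 h3
    rw [h2, h1, hb]
    by_cases h : ξ ∈ φ X ⁻¹' Ici δ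
    · have h' : (φ X ξ : ℂ) ≠ 0 := by
        exact_mod_cast (lt_of_lt_of_le hδ h).ne'
      rw [indicator_of_mem h]
      push_cast
      field_simp
    · rw [h3 h]; simp

end

end FourierModel

end CalogeroMoser

namespace CalogeroMoser

open AntiderivModel

/-! ### Nondegeneracy of the symplectic form -/

namespace FourierModel

section

variable {X Γ : Type} [MeasureSpace X] [GeometryData X] [AddCommGroup Γ]
  [MeasurableSpace Γ] [MeasurableAdd₂ Γ] [MeasurableNeg Γ] [fm : FourierModel X Γ]
  [SFinite (volume : Measure X)] [am : AntiderivModel X]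

include fm am

lemma mul_zero' (f : L2 X) : f ⊙ (0 : L2 X) = 0 := by
  have h := mul_smul' f 0 0
  rwa [zero_smul, zero_smul] at h

lemma mean_eq_zero {f : L2 X} (hf : SuppIn (Ioi 0) f) : (c₀ X : ℂ) * ∫ x, f x = 0 := by
  have h := mul_zero_mode f f
  have h1 : Cplus f - (f - Cminus f) = 0 := by
    rw [Cplus_of_mem (mem_plus_iff.2 (hf.mono Ioi_subset_Ici_self))]
    have h2 : f - Cminus f = f := Cpos_of_suppIn hf
    rw [h2, sub_self]
  rw [h1, mul_zero'] at h
  rcases smul_eq_zero.1 h.symm with h2 | h2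
  · exact h2
  · have h3 : (f : X → ℂ) =ᵐ[volume] 0 := by rw [h2]; exact Lp.coeFn_zero _ _ _
    rw [integral_congr_ae h3]; simp

/-- The real part of `2 (±i) q p`. -/
def pairing (s : Sign) (q p : L2 X) (y : X) : ℝ := (2 * s.val * Complex.I * (q y * p y)).re

lemma integrable_pairing (s : Sign) (q p : L2 X) : Integrable (pairing s q p) volume :=
  ((integrable_mul q p).const_mul _).re

lemma integral_abs_pairing_le (s : Sign) (q p : L2 X) :
    ∫ y, |pairing s q p y| ≤ 2 * (‖q‖ * ‖p‖) := by
  have h1 : ∀ y, |pairing s q p y| ≤ 2 * (‖q y‖ * ‖p y‖) := fun y => by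
    refine (Complex.abs_re_le_norm _).trans_eq ?_
    rw [norm_mul, norm_mul, norm_mul, Sign.norm_val, Complex.norm_I, norm_mul]
    norm_num
  have h2 : ∫ y, ‖q y‖ * ‖p y‖ ≤ ‖q‖ * ‖p‖ := by
    have h3 : ENNReal.ofReal 2 = 2 := by simp
    have h4 := integral_mul_norm_le_Lp_mul_Lq (μ := (volume : Measure X))
      Real.HolderConjugate.two_two
      (f := q) (g := p) (by rw [h3]; exact Lp.memLp q) (by rw [h3]; exact Lp.memLp p)
    have h5 : ∀ f : L2 X, (∫ a, ‖f a‖ ^ (2 : ℝ)) ^ (1 / (2 : ℝ)) = ‖f‖ := fun f => by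
      simp only [Real.rpow_two]
      rw [← norm_sq_eq_integral, ← Real.sqrt_eq_rpow, Real.sqrt_sq (norm_nonneg f)]
    rwa [h5, h5] at h4
  have hi : Integrable (fun y => ‖q y‖ * ‖p y‖) volume := by
    simpa [norm_mul] using (integrable_mul q p).norm
  calc ∫ y, |pairing s q p y| ≤ ∫ y, 2 * (‖q y‖ * ‖p y‖) :=
        integral_mono (integrable_pairing s q p).abs (hi.const_mul 2) h1
    _ = 2 * ∫ y, ‖q y‖ * ‖p y‖ := integral_const_mul _ _
    _ ≤ _ := by gcongr

/-- The operator `p ↦ C_>(q̄ ∂̃⁻¹ Re(± 2 i q p))`; on strictly positive frequencies it is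
`± C_> q̄ D⁻¹ q`. -/
def antiHankel (s : Sign) (q p : L2 X) : L2 X := Cpos (star (mulAntideriv q (pairing s q p)))

lemma antiHankel_sub (s : Sign) (q p p' : L2 X) :
    antiHankel s q (p - p') = antiHankel s q p - antiHankel s q p' := by
  rw [antiHankel, antiHankel, antiHankel, ← Cpos_sub, ← star_sub',
    ← mulAntideriv_sub q (integrable_pairing s q p) (integrable_pairing s q p')]
  congr 2
  refine mulAntideriv_congr q ?_
  filter_upwards [Lp.coeFn_sub p p'] with y h
  rw [pairing, h, Pi.sub_apply, pairing, pairing, mul_sub, mul_sub, Complex.sub_re]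

lemma norm_antiHankel_le (s : Sign) (q p : L2 X) : ‖antiHankel s q p‖ ≤ ‖q‖ ^ 2 * ‖p‖ := by
  refine (norm_Cpos_le _).trans ?_
  rw [norm_star']
  refine (norm_mulAntideriv_le q (integrable_pairing s q p)).trans ?_
  have h := integral_abs_pairing_le s q p
  calc _ ≤ 1 / 2 * (2 * (‖q‖ * ‖p‖)) * ‖q‖ := by gcongr
    _ = _ := by ring

lemma continuous_antiHankel (s : Sign) (q : L2 X) : Continuous (antiHankel s q) := by
  have : LipschitzWith (Real.toNNReal (‖q‖ ^ 2)) (antiHankel s q) := by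
    refine LipschitzWith.of_dist_le_mul fun p p' => ?_
    rw [dist_eq_norm, dist_eq_norm, ← antiHankel_sub, Real.coe_toNNReal _ (by positivity)]
    exact norm_antiHankel_le s q _
  exact this.continuous

/-- For `p` with frequencies bounded away from zero, `D u = q p` is solvable in `H¹₊`, and the form
of `antiHankel` is `±⟨u, D u⟩`. -/
lemma norm_sq_antiHankel_le_of_suppIn (s : Sign) {q p : L2 X} (hq : q ∈ hardyPlus (X := X))
    (hp : Wiener p) {δ : ℝ} (hδ : 0 < δ) (hpδ : SuppIn (Ici δ) p) :
    ‖antiHankel s q p‖ ^ 2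
      ≤ ‖q‖ ^ 2 / (2 * π) * (s.sgn * (inner ℂ (antiHankel s q p) p).re) := by
  have hqp : SuppIn (Ici δ) (p ⊙ q) := SuppIn.mul (s := Ici δ) (t := Ici 0)
    (fun a ha b hb => by simp only [mem_Ici] at *; linarith) hp hpδ (mem_plus_iff.1 hq)
  obtain ⟨u, hu, hd⟩ := exists_D_eq hδ hqp
  have husob : u ∈ sobolevPlus X := ⟨mem_plus_iff.2 (hu.mono Ioi_subset_Ici_self), _, hd⟩
  have huW := wiener_of_sobolevPlus husob
  have hDu : -(Complex.I • dx u) = p ⊙ q := by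
    rw [IsDeriv.dx_eq hd, smul_smul, Complex.I_mul_I]; module
  have hK : antiHankel s q p = s.val • Cpos (star q ⊙ u) := by
    have hd2 := IsDeriv.smul hd (2 * s.val)
    have hint : Integrable ((2 * s.val) • Complex.I • (p ⊙ q) : L2 X) volume := by
      have h1 : (((2 * s.val) • Complex.I • (p ⊙ q) : L2 X) : X → ℂ) =ᵐ[volume]
          fun y => 2 * s.val * Complex.I * (q y * p y) := by
        filter_upwards [Lp.coeFn_smul (2 * s.val) (Complex.I • (p ⊙ q)),
          Lp.coeFn_smul Complex.I (p ⊙ q), coeFn_mul (hp.memLp_mul q)] with y h1 h2 h3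
        rw [h1, Pi.smul_apply, h2, Pi.smul_apply, h3, smul_eq_mul, smul_eq_mul]
        ring
      exact ((integrable_mul q p).const_mul _).congr h1.symm
    have hpair : (fun y => (((2 * s.val) • Complex.I • (p ⊙ q) : L2 X) y).re)
        =ᵐ[volume] pairing s q p := by
      filter_upwards [Lp.coeFn_smul (2 * s.val) (Complex.I • (p ⊙ q)),
        Lp.coeFn_smul Complex.I (p ⊙ q), coeFn_mul (hp.memLp_mul q)] with y h1 h2 h3
      rw [h1, Pi.smul_apply, h2, Pi.smul_apply, h3, smul_eq_mul, smul_eq_mul, pairing]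
      congr 1
      ring
    have hA := antideriv_deriv _ _ hd2 hint
    rw [antideriv_congr _ _ hpair, mean_eq_zero (hu.smul (2 * s.val))] at hA
    have hstar : star (mulAntideriv q (pairing s q p))
        = s.val • (star q ⊙ u) + s.val • (star q ⊙ star u) := by
      refine Lp.ext ?_
      filter_upwards [coeFn_star' (mulAntideriv q (pairing s q p)),
        coeFn_mulAntideriv q (integrable_pairing s q p), hA, Lp.coeFn_smul (2 * s.val) u,
        Lp.coeFn_add (s.val • (star q ⊙ u)) (s.val • (star q ⊙ star u)),
        Lp.coeFn_smul s.val (star q ⊙ u), Lp.coeFn_smul s.val (star q ⊙ star u),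
        coeFn_mul (huW.memLp_mul' (star q)), coeFn_mul (huW.star.memLp_mul' (star q)),
        coeFn_star' q, coeFn_star' u] with y h1 h2 h3 h4 h5 h6 h7 h8 h9 h10 h11
      rw [h1, h2, h3, h4, h5, Pi.add_apply, h6, h7, Pi.smul_apply, Pi.smul_apply, Pi.smul_apply,
        h8, h9, h10, h11, sub_zero, map_mul, Complex.conj_ofReal, Complex.re_eq_add_conj]
      simp only [smul_eq_mul, map_mul, Sign.conj_val, Complex.conj_ofNat]
      ring
    have hneg : Cpos (star q ⊙ star u) = 0 := Cpos_of_mem_minus <| by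
      rw [mul_comm']
      exact huW.star.mul_mem_minus (star_mem_minus husob.1) (star_mem_minus hq)
    rw [antiHankel, hstar, Cpos_add, Cpos_smul, Cpos_smul, hneg, smul_zero, add_zero]
  have hen : (energy u : ℂ) = s.sgn * inner ℂ (antiHankel s q p) p := by
    have hpp : Cpos p = p := Cpos_of_suppIn (hpδ.mono fun a ha => lt_of_lt_of_le hδ ha)
    rw [← inner_D husob, hDu, mul_comm' p q, hK, inner_smul_left, Sign.conj_val, ← inner_Cpos, hpp,
      inner_mul_right (hp.memLp_mul' q) (huW.memLp_mul' (star q)), Sign.coe_sgn, ← mul_assoc,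
      Sign.val_mul_self, one_mul]
  have hen' : energy u = s.sgn * (inner ℂ (antiHankel s q p) p).re := by
    have := congrArg Complex.re hen
    rwa [Complex.ofReal_re, Complex.re_ofReal_mul] at this
  rw [← hen', hK, norm_smul, Sign.norm_val, one_mul]
  exact norm_sq_Cpos_star_mul_le hq husob

lemma norm_sq_antiHankel_le (s : Sign) {q p : L2 X} (hq : q ∈ hardyPlus (X := X))
    (hp : SuppIn (Ioi 0) p) :
    ‖antiHankel s q p‖ ^ 2
      ≤ ‖q‖ ^ 2 / (2 * π) * (s.sgn * (inner ℂ (antiHankel s q p) p).re) := by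
  have hc := continuous_antiHankel s q
  have hcl : IsClosed {p : L2 X | ‖antiHankel s q p‖ ^ 2
      ≤ ‖q‖ ^ 2 / (2 * π) * (s.sgn * (inner ℂ (antiHankel s q p) p).re)} := by
    refine isClosed_le (by fun_prop) (continuous_const.mul (continuous_const.mul
      (Complex.continuous_re.comp ?_)))
    exact hc.inner continuous_id
  refine hcl.closure_subset (Metric.mem_closure_iff.2 fun ε hε => ?_)
  obtain ⟨p', h1, ⟨δ, hδ, h2⟩, h3⟩ := exists_wiener_suppIn_near hp hε
  exact ⟨p', norm_sq_antiHankel_le_of_suppIn s hq h1 hδ h2, by rwa [dist_eq_norm]⟩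

/-- `1 ∓ C_> q̄ D⁻¹ q` is injective below the critical mass. -/
lemma eq_zero_of_antiHankel_eq {s : Sign} {q p : L2 X} (hq : q ∈ phaseSpace X s)
    (hp : SuppIn (Ioi 0) p) (h : antiHankel s q p = p) : p = 0 := by
  have h1 := norm_sq_antiHankel_le s hq.1 hp
  rw [h, inner_self_eq_norm_sq_to_K] at h1
  have h2 : (((‖p‖ : ℂ)) ^ 2).re = ‖p‖ ^ 2 := by rw [← Complex.ofReal_pow, Complex.ofReal_re]
  have h3 : ‖p‖ ^ 2 ≤ ‖q‖ ^ 2 / (2 * π) * (s.sgn * ‖p‖ ^ 2) := by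
    have h1' : _ ≤ ‖q‖ ^ 2 / (2 * π) * (s.sgn * (((‖p‖ : ℂ)) ^ 2).re) := h1
    rwa [h2] at h1'
  have h4 : ‖p‖ ^ 2 = 0 := by
    have h5 := sq_nonneg ‖p‖
    cases s with
    | focusing =>
      have hmass : ‖q‖ ^ 2 < 2 * π := by
        have := hq.2
        rw [mass_eq, Sign.critMass, ENNReal.ofReal_lt_ofReal_iff Real.two_pi_pos] at this
        exact this
      have h6 : ‖q‖ ^ 2 / (2 * π) < 1 := (div_lt_one Real.two_pi_pos).2 hmass
      simp only [Sign.sgn, Sign.val, Complex.one_re, one_mul] at h3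
      nlinarith
    | defocusing =>
      have h6 : 0 ≤ ‖q‖ ^ 2 / (2 * π) := by positivity
      simp only [Sign.sgn, Sign.val, Complex.neg_re, Complex.one_re] at h3
      nlinarith
  simpa using h4

/-- The symplectic form is nondegenerate. -/
lemma Omega_injective {s : Sign} {q g : L2 X} (hq : q ∈ phaseSpace X s)
    (h : Omega s q g = 0) : g = 0 := by
  set F : X → ℝ := fun y => (conj (q y) * g y).re with hF
  set Q := mulAntideriv q F with hQ
  have hg : g = (2 * s.val * Complex.I) • Cplus Q := by
    rw [Omega, smul_eq_zero] at h
    have h1 := h.resolve_left Complex.I_ne_zero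
    rw [sub_eq_zero, Theta_eq, Cplus_smul, smul_smul] at h1
    exact h1
  set p := Cpos (star Q) with hp
  have hQp : Q = Cplus Q + star p := by
    have h1 := eq_Cpos_add_star (star Q)
    rw [star_star] at h1
    have h2 := congrArg star h1
    rw [star_add', star_star, star_star, add_comm] at h2
    exact h2
  have hgp : g = (2 * s.val * Complex.I) • (Q - star p) := by
    rw [hg]; congr 1; rw [eq_sub_iff_add_eq, ← hQp]
  have hFp : F =ᵐ[volume] pairing s q p := by
    have h1 : (g : X → ℂ) =ᵐ[volume] ((2 * s.val * Complex.I) • (Q - star p) : L2 X) := by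
      rw [← hgp]
    filter_upwards [h1, Lp.coeFn_smul (2 * s.val * Complex.I) (Q - star p),
      Lp.coeFn_sub Q (star p), coeFn_mulAntideriv q (integrable_re_conj_mul q g),
      coeFn_star' p] with y a1 a2 a3 a4 a5
    have a6 : Q y = q y * (antideriv F y : ℝ) := a4
    rw [hF, pairing]
    simp only
    rw [a1, a2, Pi.smul_apply, a3, Pi.sub_apply, a6, a5, smul_eq_mul]
    have hs : s.val = (s.sgn : ℂ) := s.coe_sgn.symm
    rw [hs]
    simp [Complex.mul_re, Complex.mul_im]
    ring
  have hQ' : Q = mulAntideriv q (pairing s q p) := mulAntideriv_congr q hFp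
  have hp0 : p = 0 := eq_zero_of_antiHankel_eq hq (SuppIn.Cpos _) (by
    rw [antiHankel, ← hQ'])
  have hQ0 : Q = 0 := by
    rw [← norm_le_zero_iff, hQ']
    refine (norm_mulAntideriv_le q (integrable_pairing s q p)).trans ?_
    have h1 := integral_abs_pairing_le s q p
    rw [hp0, norm_zero, mul_zero, mul_zero] at h1
    rw [hp0]
    have h2 : 1 / 2 * (∫ y, |pairing s q 0 y|) * ‖q‖ ≤ 1 / 2 * 0 * ‖q‖ := by gcongr
    simpa using h2
  have h0 : Cplus (0 : L2 X) = 0 := Cplus_of_mem (zero_mem _)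
  rw [hg, hQ0, h0, smul_zero]

end

end FourierModel

end CalogeroMoser

namespace CalogeroMoser

open AntiderivModel

/-- The pointwise identity behind `Re (q̄ v) = ∂ |m|²`. -/
lemma re_identity {s : Sign} {q m m' A B : ℂ} {κ c : ℝ} (h : q * conj m = A + conj B)
    (hm' : -(Complex.I * m') = q + -κ * m + s.val * (q * B)) :
    (m * conj m' + conj m * m').re = (conj q * (-(2 * Complex.I * m)
      + 2 * Complex.I * s.val * (m * A) - s.val * (2 * Complex.I * c) * q)).re := by
  have h' : conj q * m = conj A + B := by
    have := congrArg conj h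
    simpa using this
  have hI : Complex.I * Complex.I = -1 := Complex.I_mul_I
  have e1 : conj m * m' = Complex.I * ((A + conj B) - κ * (m * conj m)
      + s.val * ((A + conj B) * B)) := by
    linear_combination (Complex.I * (1 + s.val * B)) * h + Complex.I * conj m * hm'
      + conj m * m' * hI
  have e2 : conj q * (-(2 * Complex.I * m) + 2 * Complex.I * s.val * (m * A)
      - s.val * (2 * Complex.I * c) * q)
      = -(2 * Complex.I * (conj A + B)) + 2 * Complex.I * s.val * ((conj A + B) * A)
        - s.val * (2 * Complex.I * c) * (q * conj q) := by
    linear_combination (-2 * Complex.I + 2 * Complex.I * s.val * A) * h'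
  have e3 : (m * conj m').re = (conj m * m').re := by
    rw [← Complex.conj_re]; congr 1; simp
  rw [Complex.add_re, e3, e1, e2, Complex.mul_conj, Complex.mul_conj, ← Sign.coe_sgn]
  simp [Complex.mul_re, Complex.mul_im]
  ring

namespace FourierModel

section

variable {X Γ : Type} [MeasureSpace X] [GeometryData X] [AddCommGroup Γ]
  [MeasurableSpace Γ] [MeasurableAdd₂ Γ] [MeasurableNeg Γ] [fm : FourierModel X Γ]
  [SFinite (volume : Measure X)]

include fm

/-! ### The symplectic gradient of `β` -/

lemma D_mkappa {s : Sign} {q : L2 X} (hq : q ∈ phaseSpace X s) {κ : ℝ} (hκ : 1 ≤ κ) :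
    -(Complex.I • dx (mkappa s κ q)) = q + (-κ : ℂ) • mkappa s κ q
      + s.val • (q ⊙ Cplus (star q ⊙ mkappa s κ q)) := by
  have hspec := (mkappa_spec hq hκ).2
  rw [lax] at hspec
  linear_combination (norm := module) hspec

variable [am : AntiderivModel X]

include am

/-- The primitive of `Re (q̄ v)` is `|m|²` minus its mean. -/
lemma mulAntideriv_hamVec {s : Sign} {q : L2 X} (hq : q ∈ phaseSpace X s) {κ : ℝ} (hκ : 1 ≤ κ) :
    mulAntideriv q (fun y => (conj (q y) * hamVec (c₀ X) s κ q y).re)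
      = mkappa s κ q ⊙ (q ⊙ star (mkappa s κ q)) - (c₀ X * ‖mkappa s κ q‖ ^ 2 : ℝ) • q := by
  have hm := mkappa_mem_sobolevPlus hq hκ
  have hD := D_mkappa hq hκ
  have hsplit := mul_star_eq hq hκ
  have hWB := wiener_Cplus_star_mul hq.1 hm
  set v := hamVec (c₀ X) s κ q with hv
  rw [hamVec] at hv
  set m := mkappa s κ q with hmdef
  have hmW := wiener_of_sobolevPlus hm
  set A := Cpos (q ⊙ star m)
  set B := Cplus (star q ⊙ m)
  set m' := dx m with hm'
  have hder : IsDeriv (star m ⊙ m) (m ⊙ star m' + star m ⊙ m') :=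
    IsDeriv.mul (IsDeriv.star (isDeriv_dx hm)) (isDeriv_dx hm)
  have hg : ((m ⊙ star m' + star m ⊙ m' : L2 X) : X → ℂ) =ᵐ[volume]
      fun y => m y * conj (m' y) + conj (m y) * m' y := by
    filter_upwards [Lp.coeFn_add (m ⊙ star m') (star m ⊙ m'), coeFn_mul (hmW.memLp_mul (star m')),
      coeFn_mul (hmW.star.memLp_mul m'), coeFn_star' m, coeFn_star' m'] with y h1 h2 h3 h4 h5
    rw [h1, Pi.add_apply, h2, h3, h4, h5]
  have hgi : Integrable (m ⊙ star m' + star m ⊙ m' : L2 X) volume := by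
    refine Integrable.congr ?_ hg.symm
    refine Integrable.add ?_ (integrable_conj_mul m m')
    simpa only [mul_comm] using integrable_conj_mul m' m
  have hpair : (fun y => ((m ⊙ star m' + star m ⊙ m' : L2 X) y).re)
      =ᵐ[volume] fun y => (conj (q y) * v y).re := by
    have hD' : (-(Complex.I • m') : L2 X) =ᵐ[volume]
        (q + (-κ : ℂ) • m + s.val • (q ⊙ B) : L2 X) := by rw [hD]
    have hs' : (q ⊙ star m : L2 X) =ᵐ[volume] (A + star B : L2 X) := by rw [hsplit]
    have hv' : (v : X → ℂ) =ᵐ[volume] fun y => -(2 * Complex.I * m y)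
        + 2 * Complex.I * s.val * (m y * A y)
        - s.val * (2 * Complex.I * (c₀ X * ‖m‖ ^ 2 : ℝ)) * q y := by
      rw [hv]
      filter_upwards [Lp.coeFn_sub (-((2 * Complex.I) • m) + (2 * Complex.I * s.val) • (m ⊙ A))
          ((s.val * (2 * Complex.I * c₀ X) * (‖m‖ ^ 2 : ℝ)) • q),
        Lp.coeFn_add (-((2 * Complex.I) • m)) ((2 * Complex.I * s.val) • (m ⊙ A)),
        Lp.coeFn_neg ((2 * Complex.I) • m), Lp.coeFn_smul (2 * Complex.I) m,
        Lp.coeFn_smul (2 * Complex.I * s.val) (m ⊙ A), coeFn_mul (hmW.memLp_mul A),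
        Lp.coeFn_smul (s.val * (2 * Complex.I * c₀ X) * (‖m‖ ^ 2 : ℝ)) q]
        with y h1 h2 h3 h4 h5 h6 h7
      rw [h1, Pi.sub_apply, h2, Pi.add_apply, h3, Pi.neg_apply, h4, h5, h7, Pi.smul_apply,
        Pi.smul_apply, Pi.smul_apply, h6]
      simp only [smul_eq_mul]
      push_cast
      ring
    filter_upwards [hg, hD', hs', hv', Lp.coeFn_neg (Complex.I • m'), Lp.coeFn_smul Complex.I m',
      Lp.coeFn_add (q + (-κ : ℂ) • m) (s.val • (q ⊙ B)), Lp.coeFn_add q ((-κ : ℂ) • m),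
      Lp.coeFn_smul (-κ : ℂ) m, Lp.coeFn_smul s.val (q ⊙ B), coeFn_mul (hWB.memLp_mul' q),
      coeFn_mul (hmW.star.memLp_mul' q), coeFn_star' m, Lp.coeFn_add A (star B), coeFn_star' B]
      with y a1 a2 a3 a4 a5 a6 a7 a8 a9 a10 a11 a12 a13 a14 a15
    rw [a1, a4]
    refine re_identity (B := B y) (κ := κ) ?_ ?_
    · rw [a12, a14, a13, Pi.add_apply, a15] at a3
      exact a3
    · rw [a5, a7, Pi.neg_apply, Pi.add_apply, a8, Pi.add_apply, a6, a9, a10, Pi.smul_apply,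
        Pi.smul_apply, Pi.smul_apply, a11] at a2
      exact a2
  have hA := antideriv_deriv _ _ hder hgi
  have hmean : ∫ y, (star m ⊙ m) y = (‖m‖ ^ 2 : ℝ) := by
    have h1 : inner ℂ m m = ∫ y, (star m ⊙ m) y := by
      rw [inner_eq]
      refine integral_congr_ae ?_
      filter_upwards [coeFn_mul (hmW.star.memLp_mul m), coeFn_star' m] with y h1 h2
      rw [h1, h2]
    rw [← h1, inner_self_eq_norm_sq_to_K]
    simp
  rw [antideriv_congr _ _ hpair, hmean] at hA
  refine Lp.ext ?_
  filter_upwards [coeFn_mulAntideriv q (integrable_re_conj_mul q v), hA,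
    coeFn_mul (hmW.star.memLp_mul m), coeFn_star' m, coeFn_mul (hmW.memLp_mul (q ⊙ star m)),
    coeFn_mul (hmW.star.memLp_mul' q), Lp.coeFn_sub (m ⊙ (q ⊙ star m)) ((c₀ X * ‖m‖ ^ 2 : ℝ) • q),
    Lp.coeFn_smul (c₀ X * ‖m‖ ^ 2 : ℝ) q] with y h1 h2 h3 h4 h5 h6 h7 h8
  rw [h1, h2, h7, Pi.sub_apply, h5, h6, h8, Pi.smul_apply, h3, h4, mul_comm (conj (m y)),
    Complex.mul_conj, ← Complex.ofReal_mul, ← Complex.ofReal_sub, Complex.ofReal_re,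
    Complex.real_smul, mul_left_comm (m y), Complex.mul_conj]
  push_cast
  ring

/-- `Ω(q) v` is twice the Wirtinger derivative. -/
lemma Omega_hamVec {s : Sign} {q : L2 X} (hq : q ∈ phaseSpace X s) {κ : ℝ} (hκ : 1 ≤ κ) :
    Omega s q (hamVec (c₀ X) s κ q) = (2 : ℂ) • wirtinger s κ q := by
  have hm := mkappa_mem_sobolevPlus hq hκ
  have hmW := wiener_of_sobolevPlus hm
  have hsplit := mul_star_eq hq hκ
  have h1 : Cplus (mkappa s κ q ⊙ (q ⊙ star (mkappa s κ q)))
      = mkappa s κ q ⊙ Cpos (q ⊙ star (mkappa s κ q))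
        + Cplus (mkappa s κ q ⊙ Cminus (q ⊙ star (mkappa s κ q))) := by
    have h2 : Cplus (mkappa s κ q ⊙ Cpos (q ⊙ star (mkappa s κ q)))
        = mkappa s κ q ⊙ Cpos (q ⊙ star (mkappa s κ q)) :=
      Cplus_of_mem (hmW.mul_mem_plus hm.1 (Cpos_mem_plus _))
    rw [star_Cplus_star_mul hmW] at hsplit
    nth_rw 1 [hsplit]
    rw [mul_add_of_memLp (hmW.memLp_mul _) (hmW.memLp_mul _), Cplus_add, h2]
  rw [Omega, Theta_eq, mulAntideriv_hamVec hq hκ, Cplus_smul, Cplus_sub, h1, Cplus_real_smul,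
    Cplus_of_mem hq.1, hamVec, wirtinger, real_smul_eq]
  simp only [smul_sub, smul_add, smul_neg, smul_smul]
  push_cast
  have hI : Complex.I * Complex.I = -1 := Complex.I_mul_I
  match_scalars <;> first
    | ring1
    | linear_combination (-2) * hI
    | linear_combination (-2 * s.val) * hI

end

end FourierModel

end CalogeroMoser

namespace CalogeroMoser

open AntiderivModel

namespace FourierModel

section

variable {X Γ : Type} [MeasureSpace X] [GeometryData X] [AddCommGroup Γ]
  [MeasurableSpace Γ] [MeasurableAdd₂ Γ] [MeasurableNeg Γ] [fm : FourierModel X Γ]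
  [SFinite (volume : Measure X)]

include fm

section

variable [am : AntiderivModel X]

include am

lemma isSympGrad_hamVec {s : Sign} {q : L2 X} (hq : q ∈ phaseSpace X s) {κ : ℝ} (hκ : 1 ≤ κ) :
    IsSympGrad s (beta s κ) q (hamVec (c₀ X) s κ q) := by
  refine ⟨hamVec_mem_plus _ hq hκ, fun f hf => (hasDerivAt_beta hq hf hκ).congr_deriv ?_⟩
  rw [omega, Omega_hamVec hq hκ, inner_smul_right]
  generalize (inner ℂ f (wirtinger s κ q) : ℂ) = z
  apply Complex.ext <;> simp [two_mul]

lemma isSympGrad_iff {s : Sign} {q : L2 X} (hq : q ∈ phaseSpace X s) {κ : ℝ} (hκ : 1 ≤ κ)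
    (v : L2 X) : IsSympGrad s (beta s κ) q v ↔ v = hamVec (c₀ X) s κ q := by
  refine ⟨fun h => ?_, fun h => h ▸ isSympGrad_hamVec hq hκ⟩
  have h0 := isSympGrad_hamVec (X := X) hq hκ
  set v₀ := hamVec (c₀ X) s κ q
  have hd : v - v₀ ∈ hardyPlus (X := X) := sub_mem h.1 h0.1
  have h1 : ∀ f ∈ hardyPlus (X := X), (inner ℂ f (Omega s q (v - v₀))).re = 0 := by
    intro f hf
    have h2 := (h.2 f hf).unique (h0.2 f hf)
    rw [omega, omega, Complex.ofReal_inj] at h2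
    rw [Omega_sub, inner_sub_right, Complex.sub_re, h2, sub_self]
  have h3 := h1 _ (Omega_mem_plus s (q := q) hd)
  have h4 : Omega s q (v - v₀) = 0 := by
    rw [inner_self_eq_norm_sq_to_K] at h3
    have h5 : ((‖Omega s q (v - v₀)‖ : ℂ) ^ 2).re = 0 := h3
    rw [← Complex.ofReal_pow, Complex.ofReal_re] at h5
    simpa using h5
  exact sub_eq_zero.1 (Omega_injective hq h4)

/-- The mean of `q m̄` is `β` divided by the length of the torus, so replacing `C_>` by `C₊` in the
vector field costs a multiple of `β m`. -/
lemma mul_Cpos_eq {s : Sign} {q : L2 X} (hq : q ∈ phaseSpace X s) {κ : ℝ} (hκ : 1 ≤ κ) :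
    mkappa s κ q ⊙ Cpos (q ⊙ star (mkappa s κ q))
      = mkappa s κ q ⊙ Cplus (q ⊙ star (mkappa s κ q))
        - (c₀ X * beta s κ q) • mkappa s κ q := by
  have hmW := wiener_of_sobolevPlus (mkappa_mem_sobolevPlus hq hκ)
  have h1 : ∫ x, (q ⊙ star (mkappa s κ q)) x = beta s κ q := by
    have h2 : inner ℂ (mkappa s κ q) q = ∫ x, (q ⊙ star (mkappa s κ q)) x := by
      rw [inner_eq]
      refine integral_congr_ae ?_
      filter_upwards [coeFn_mul (hmW.star.memLp_mul' q), coeFn_star' (mkappa s κ q)] with x h1 h2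
      rw [h1, h2, mul_comm]
    rw [← h2, ← inner_conj_symm]
    exact Complex.conj_eq_iff_im.2 (beta_im hq hκ)
  have h3 := mul_zero_mode (q ⊙ star (mkappa s κ q)) (mkappa s κ q)
  rw [mul_sub_of_memLp (hmW.memLp_mul _) (hmW.memLp_mul _), h1] at h3
  rw [← h3, Cpos]
  abel

lemma hamVec_eq {s : Sign} {q : L2 X} (hq : q ∈ phaseSpace X s) {κ : ℝ} (hκ : 1 ≤ κ) :
    hamVec (c₀ X) s κ q = -((2 * Complex.I) • mkappa s κ q)
      + (2 * Complex.I * s.val) • (mkappa s κ q ⊙ Cplus (q ⊙ star (mkappa s κ q)))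
      - (s.val * (2 * Complex.I * c₀ X) * beta s κ q) • mkappa s κ q
      - (s.val * (2 * Complex.I * c₀ X) * (‖mkappa s κ q‖ ^ 2 : ℝ)) • q := by
  rw [hamVec, mul_Cpos_eq hq hκ]
  module

lemma peter_self {s : Sign} {q : L2 X} (hq : q ∈ phaseSpace X s) {κ : ℝ} (hκ : 1 ≤ κ) :
    peter (c₀ X) s κ q q = hamVec (c₀ X) s κ q := by
  rw [hamVec_eq hq hκ, peter, mul_comm' (star _) q]
  rfl

lemma solvesFlow_iff {s : Sign} {κ : ℝ} (hκ : 1 ≤ κ) {J : Set ℝ} {q : ℝ → L2 X}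
    (hq : ∀ t ∈ J, q t ∈ phaseSpace X s) :
    SolvesFlow s κ J q ↔ ∀ t ∈ J, HasDerivAt q (hamVec (c₀ X) s κ (q t)) t := by
  refine forall₂_congr fun t ht => ⟨?_, fun h => ⟨_, isSympGrad_hamVec (hq t ht) hκ, h⟩⟩
  rintro ⟨v, hv, h⟩
  rwa [(isSympGrad_iff (hq t ht) hκ v).1 hv] at h

end

/-! ### The Lax equation -/

lemma hasDerivAt_lax (s : Sign) {q : ℝ → L2 X} {d u : L2 X} {t : ℝ}
    (hq : ∀ᶠ τ in nhds t, q τ ∈ hardyPlus (X := X)) (hd : d ∈ hardyPlus (X := X))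
    (h : HasDerivAt q d t) (hu : u ∈ sobolevPlus X) :
    HasDerivAt (fun τ => lax s (q τ) u) (laxVariation s (q t) d u) t := by
  set w := -(Complex.I • dx u) + ((1 : ℝ) : ℂ) • u with hw
  have hG : freeResolvent X 1 w = u := freeResolvent_apply_of_sobolevPlus one_pos hu
  have hT : ∀ a b : L2 X, b ∈ hardyPlus (X := X) →
      hankelMap X a b w = a ⊙ Cplus (star b ⊙ u) := fun a b hb => by
    rw [hankelMap_apply, Cplus_of_mem hb, hG]
  have h1 := (hasDerivAt_clm_diag (hankelMap X) h).clm_apply (hasDerivAt_const t w)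
  have h2 := (h1.const_smul s.sgn).const_sub (-(Complex.I • dx u))
  have h3 : ∀ᶠ τ in nhds t, lax s (q τ) u
      = -(Complex.I • dx u) - s.sgn • hankelMap X (q τ) (q τ) w := by
    filter_upwards [hq] with τ hτ
    rw [lax, hT _ _ hτ, real_smul_eq, Sign.coe_sgn]
  refine (h2.congr_of_eventuallyEq h3).congr_deriv ?_
  rw [map_zero, add_zero, laxVariation, ← hT d (q t) hq.self_of_nhds, ← hT (q t) d hd,
    ← Sign.coe_sgn, ← real_smul_eq]
  rfl

lemma mem_plus_of_hasDerivAt {q : ℝ → L2 X} {d : L2 X} {t : ℝ}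
    (hq : ∀ᶠ τ in nhds t, q τ ∈ hardyPlus (X := X)) (h : HasDerivAt q d t) :
    d ∈ hardyPlus (X := X) := by
  have h1 : HasDerivAt (fun τ => Cplus (q τ)) (Cplus d) t :=
    ((hardyPlus (X := X)).starProjection.restrictScalars ℝ).hasFDerivAt.comp_hasDerivAt t h
  have h2 : HasDerivAt (fun τ => Cplus (q τ)) d t :=
    h.congr_of_eventuallyEq (hq.mono fun τ hτ => Cplus_of_mem hτ)
  rw [← h1.unique h2]
  exact Cplus_mem d

lemma laxVariation_sub (s : Sign) {q d e u : L2 X} (hq : q ∈ hardyPlus (X := X))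
    (hd : d ∈ hardyPlus (X := X)) (he : e ∈ hardyPlus (X := X)) (hu : u ∈ sobolevPlus X) :
    laxVariation s q (d - e) u = laxVariation s q d u - laxVariation s q e u := by
  have huW := wiener_of_sobolevPlus hu
  have hW := wiener_Cplus_star_mul hq hu
  rw [laxVariation, laxVariation, laxVariation, sub_mul_of_memLp (hW.memLp_mul' _)
    (hW.memLp_mul' _), star_sub', sub_mul_of_memLp (huW.memLp_mul' _) (huW.memLp_mul' _), Cplus_sub,
    mul_sub_of_memLp ((wiener_Cplus_star_mul hd hu).memLp_mul' _)
      ((wiener_Cplus_star_mul he hu).memLp_mul' _)]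
  module

lemma eventually_mem_plus {s : Sign} {J : Set ℝ} {q : ℝ → L2 X} (hJ : IsOpen J)
    (hq : ∀ t ∈ J, q t ∈ phaseSpace X s) {t : ℝ} (ht : t ∈ J) :
    ∀ᶠ τ in nhds t, q τ ∈ hardyPlus (X := X) :=
  Filter.eventually_of_mem (hJ.mem_nhds ht) fun τ hτ => (hq τ hτ).1

/-- The Lax equation for a differentiable curve says that `q' - v` acts trivially on `𝓛_q`. -/
lemma laxEquation_iff (c : ℝ) {s : Sign} {κ : ℝ} (hκ : 1 ≤ κ) {J : Set ℝ} (hJ : IsOpen J)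
    {q d : ℝ → L2 X} (hq : ∀ t ∈ J, q t ∈ phaseSpace X s) (hd : ∀ t ∈ J, HasDerivAt q (d t) t) :
    LaxEquation s (peter c s κ) J q ↔ ∀ t ∈ J, ∀ u ∈ sobolevPlus X,
      laxVariation s (q t) (d t - hamVec c s κ (q t)) u = 0 := by
  refine forall₂_congr fun t ht => forall₂_congr fun u hu => ?_
  have hev := eventually_mem_plus hJ hq ht
  have hdp := mem_plus_of_hasDerivAt hev (hd t ht)
  have h1 := hasDerivAt_lax s hev hdp (hd t ht) hu
  rw [peter_commutator c (hq t ht) hκ hu,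
    laxVariation_sub s (hq t ht).1 hdp (hamVec_mem_plus c (hq t ht) hκ) hu, sub_eq_zero]
  exact ⟨fun h => h1.unique h, fun h => h ▸ h1⟩

end

end FourierModel

end CalogeroMoser

namespace CalogeroMoser

open AntiderivModel

lemma one_add_mul_exp_neg_le {t : ℝ} (ht : 0 ≤ t) : (1 + t) * Real.exp (-t) ≤ 24 * ((1 + |t|) ^ 2)⁻¹ := by
  have h1 : (1 + t) ^ 3 ≤ 24 * Real.exp t := by
    have h2 := Real.sum_le_exp_of_nonneg ht 4
    simp only [Finset.sum_range_succ, Finset.sum_range_zero, Nat.factorial] at h2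
    norm_num at h2
    nlinarith [mul_nonneg ht ht]
  rw [abs_of_nonneg ht, Real.exp_neg, ← div_eq_mul_inv, ← div_eq_mul_inv, div_le_div_iff₀
    (Real.exp_pos _) (by positivity)]
  linarith [h1, show (1 + t) * (1 + t) ^ 2 = (1 + t) ^ 3 by ring]

namespace FourierModel

section

variable {X Γ : Type} [MeasureSpace X] [GeometryData X] [AddCommGroup Γ]
  [MeasurableSpace Γ] [MeasurableAdd₂ Γ] [MeasurableNeg Γ] [fm : FourierModel X Γ]
  [SFinite (volume : Measure X)]

include fm

/-! ### Directions that do not change the Lax operator -/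

/-- The Fourier transform `e^{-φ} e_{-ξ}(x)` on `φ ≥ 0`. -/
def szegoSymbol (x : X) : Γ → ℂ :=
  {ξ | 0 ≤ φ X ξ}.indicator fun ξ => (Real.exp (-φ X ξ) : ℂ) * e (-ξ) x

lemma measurable_szegoSymbol (x : X) : Measurable (szegoSymbol x : Γ → ℂ) := by
  refine Measurable.indicator ?_ (measurableSet_le_freq' 0)
  exact (Complex.measurable_ofReal.comp (Real.measurable_exp.comp measurable_φ.neg)).mul
    ((measurable_e_left x).comp measurable_neg)

lemma norm_szegoSymbol (x : X) (ξ : Γ) : ‖(szegoSymbol x : Γ → ℂ) ξ‖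
    = {ξ : Γ | 0 ≤ φ X ξ}.indicator (fun ξ => Real.exp (-φ X ξ)) ξ := by
  rw [szegoSymbol, norm_indicator_eq_indicator_norm]
  congr 1
  ext ξ
  rw [norm_mul, norm_e, mul_one, Complex.norm_real, Real.norm_eq_abs, abs_of_pos (Real.exp_pos _)]

lemma szegoSymbol_le (x : X) (ξ : Γ) :
    (1 + |φ X ξ|) * ‖(szegoSymbol x : Γ → ℂ) ξ‖ ≤ 24 * ((1 + |φ X ξ|) ^ 2)⁻¹ := by
  rw [norm_szegoSymbol]
  by_cases h : 0 ≤ φ X ξ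
  · rw [indicator_of_mem (s := {ξ | 0 ≤ φ X ξ}) h]
    have := one_add_mul_exp_neg_le h
    rwa [abs_of_nonneg h] at *
  · rw [indicator_of_notMem (s := {ξ | 0 ≤ φ X ξ}) h, mul_zero]; positivity

lemma norm_szegoSymbol_le_one (x : X) (ξ : Γ) : ‖(szegoSymbol x : Γ → ℂ) ξ‖ ≤ 1 := by
  rw [norm_szegoSymbol]
  by_cases h : 0 ≤ φ X ξ
  · rw [indicator_of_mem (s := {ξ | 0 ≤ φ X ξ}) h]
    exact Real.exp_le_one_iff.2 (by linarith)
  · rw [indicator_of_notMem (s := {ξ | 0 ≤ φ X ξ}) h]; exact zero_le_one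

lemma integrable_szegoSymbol (x : X) : Integrable (szegoSymbol x : Γ → ℂ) (ν X) := by
  refine (integrable_weight.const_mul 24).mono' (measurable_szegoSymbol x).aestronglyMeasurable
    (.of_forall fun ξ => (le_trans ?_ (szegoSymbol_le x ξ)))
  nlinarith [abs_nonneg (φ X ξ), norm_nonneg ((szegoSymbol x : Γ → ℂ) ξ)]

lemma memLp_freq_mul_szegoSymbol (x : X) :
    MemLp (fun ξ => (φ X ξ : ℂ) * (szegoSymbol x : Γ → ℂ) ξ) 2 (ν X) := by
  have h0 : Integrable (fun ξ => ((1 + |φ X ξ|) ^ 2)⁻¹) (ν X) := integrable_weight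
  refine (memLp_two_iff_integrable_sq_norm ?_).2 ?_
  · exact ((Complex.measurable_ofReal.comp measurable_φ).mul
      (measurable_szegoSymbol x)).aestronglyMeasurable
  · refine (h0.const_mul (24 ^ 2)).mono' ?_ (.of_forall fun ξ => ?_)
    · exact (((Complex.measurable_ofReal.comp measurable_φ).mul
        (measurable_szegoSymbol x)).norm.pow_const 2).aestronglyMeasurable
    · have h1 := szegoSymbol_le x ξ
      have h2 : ((1 + |φ X ξ|) ^ 2)⁻¹ ≤ 1 := inv_le_one_of_one_le₀ (by
        nlinarith [abs_nonneg (φ X ξ)])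
      have h3 : 0 ≤ ((1 + |φ X ξ|) ^ 2)⁻¹ := by positivity
      rw [norm_mul, Complex.norm_real, Real.norm_eq_abs, Real.norm_eq_abs,
        abs_of_nonneg (by positivity)]
      set a := |φ X ξ| * ‖(szegoSymbol x : Γ → ℂ) ξ‖ with ha
      have ha0 : 0 ≤ a := by positivity
      have h4 : a ≤ 24 * ((1 + |φ X ξ|) ^ 2)⁻¹ := by
        refine le_trans ?_ h1
        rw [ha]; gcongr; linarith
      calc a ^ 2 ≤ (24 * ((1 + |φ X ξ|) ^ 2)⁻¹) ^ 2 := by gcongr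
        _ = 24 ^ 2 * (((1 + |φ X ξ|) ^ 2)⁻¹ * ((1 + |φ X ξ|) ^ 2)⁻¹) := by ring
        _ ≤ 24 ^ 2 * (1 * ((1 + |φ X ξ|) ^ 2)⁻¹) := by gcongr
        _ = _ := by ring

lemma memLp_szegoSymbol (x : X) : MemLp (szegoSymbol x : Γ → ℂ) 2 (ν X) := by
  refine (memLp_two_iff_integrable_sq_norm (measurable_szegoSymbol x).aestronglyMeasurable).2 ?_
  refine (integrable_szegoSymbol x).norm.mono'
    ((measurable_szegoSymbol x).norm.pow_const 2).aestronglyMeasurable (.of_forall fun ξ => ?_)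
  rw [Real.norm_eq_abs, abs_of_nonneg (by positivity), pow_two]
  exact mul_le_of_le_one_left (norm_nonneg _) (norm_szegoSymbol_le_one x ξ)

/-- The reproducing kernel of the Hardy space at the point with boundary coordinate `x` and depth
one. -/
def szego (x : X) : L2 X := ofHat X (memLp_szegoSymbol x)

lemma U_szego (x : X) : (U (szego x) : Γ → ℂ) =ᵐ[ν X] szegoSymbol x := U_ofHat _

lemma szego_mem_sobolevPlus (x : X) : szego x ∈ sobolevPlus X := by
  refine ⟨mem_plus_iff.2 ?_, ofHat X ((memLp_freq_mul_szegoSymbol x).const_mul Complex.I),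
    (isDeriv_iff _ _).2 ?_⟩
  · filter_upwards [U_szego x] with ξ h1 h2
    rw [h1, szegoSymbol, indicator_of_notMem (s := {ξ | 0 ≤ φ X ξ}) h2]
  · filter_upwards [U_szego x, U_ofHat ((memLp_freq_mul_szegoSymbol x).const_mul Complex.I)]
      with ξ h1 h2
    rw [h1, h2, mul_assoc]

lemma szego_ne_zero (x : X) : ∀ᵐ y, (szego x : L2 X) y ≠ 0 := by
  have hw : Integrable (U (szego x) : Γ → ℂ) (ν X) :=
    (integrable_szegoSymbol x).congr (U_szego x).symm
  filter_upwards [inversion (szego x) hw] with y hy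
  have h1 : ∫ ξ, U (szego x) ξ * e ξ y ∂(ν X)
      = ∫ ξ in {ξ | 0 ≤ φ X ξ}, (Real.exp (-φ X ξ) : ℂ) * e (-ξ) x * e ξ y ∂(ν X) := by
    rw [← integral_indicator (measurableSet_le_freq' 0)]
    refine integral_congr_ae ?_
    filter_upwards [U_szego x] with ξ h
    rw [h, szegoSymbol]
    by_cases h : ξ ∈ {ξ | 0 ≤ φ X ξ}
    · rw [indicator_of_mem h, indicator_of_mem h]
    · rw [indicator_of_notMem h, indicator_of_notMem h, zero_mul]
  rw [hy, h1]
  exact poisson_ne_zero x y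

/-- `C₊(q̄ k) = ⟨q, k⟩ k` for a reproducing kernel `k`, which is an eigenvector of every
anti-analytic Toeplitz operator. -/
lemma Cplus_star_mul_szego {q : L2 X} (hq : q ∈ hardyPlus (X := X)) (x : X) :
    Cplus (star q ⊙ szego x) = (inner ℂ q (szego x) : ℂ) • szego x := by
  have hsob := szego_mem_sobolevPlus x
  have hW := wiener_of_sobolevPlus hsob
  refine ext_U ?_
  have hq' : ∀ᵐ ζ ∂(ν X), ζ ∉ {ξ : Γ | 0 ≤ φ X ξ} → U q ζ = 0 := mem_plus_iff.1 hq
  rw [mul_comm']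
  filter_upwards [U_Cplus (szego x ⊙ star q), U_mul hW (star q),
    U_smul (inner ℂ q (szego x) : ℂ) (szego x), U_szego x] with ξ h1 h2 h3 h4
  rw [h1, h3, h4]
  by_cases hξ : 0 ≤ φ X ξ
  · rw [indicator_of_mem (show ξ ∈ φ X ⁻¹' Ici 0 from hξ), h2, inner_eq_U]
    have hshift : ∫ η, U (szego x) η * U (star q) (ξ - η) ∂(ν X)
        = ∫ η, (szegoSymbol x : Γ → ℂ) η * conj (U q (η - ξ)) ∂(ν X) := by
      have hs : ∀ᵐ η ∂(ν X), U (star q) (ξ - η) = conj (U q (η - ξ)) := by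
        have := (Measure.measurePreserving_sub_left (ν X) ξ).quasiMeasurePreserving.ae (U_star q)
        filter_upwards [this] with η h
        rw [h, neg_sub]
      refine integral_congr_ae ?_
      filter_upwards [hs, U_szego x] with η a1 a2
      rw [a1, a2]
    have htr : ∫ η, (szegoSymbol x : Γ → ℂ) η * conj (U q (η - ξ)) ∂(ν X)
        = ∫ ζ, (szegoSymbol x : Γ → ℂ) (ζ + ξ) * conj (U q ζ) ∂(ν X) := by
      rw [← integral_add_right_eq_self _ ξ]
      simp only [add_sub_cancel_right]
    rw [hshift, htr, ← integral_mul_const]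
    refine integral_congr_ae ?_
    filter_upwards [hq', U_szego x] with ζ a1 a2
    rw [a2]
    by_cases hζ : 0 ≤ φ X ζ
    · have hsum : 0 ≤ φ X (ζ + ξ) := by rw [map_add]; positivity
      rw [szegoSymbol, indicator_of_mem (s := {ξ | 0 ≤ φ X ξ}) hξ,
        indicator_of_mem (s := {ξ | 0 ≤ φ X ξ}) hζ, indicator_of_mem (s := {ξ | 0 ≤ φ X ξ}) hsum,
        map_add, neg_add, neg_add, Real.exp_add, e_add]
      push_cast
      ring
    · rw [a1 hζ]; simp
  · rw [indicator_of_notMem (show ξ ∉ φ X ⁻¹' Ici 0 from hξ), szegoSymbol,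
      indicator_of_notMem (s := {ξ | 0 ≤ φ X ξ}) hξ, mul_zero]

/-- A nonzero element of the Hardy space does not vanish identically in the interior. -/
lemma exists_inner_szego_ne_zero {q : L2 X} (hq : q ∈ hardyPlus (X := X)) (hq0 : q ≠ 0) :
    ∃ x : X, (inner ℂ q (szego x) : ℂ) ≠ 0 := by
  by_contra! h
  rcases isEmpty_or_nonempty X with hX | ⟨⟨x₀⟩⟩
  · exact hq0 (Lp.ext (.of_forall fun x => isEmptyElim x))
  set b : Γ → ℂ := {ξ : Γ | 0 ≤ φ X ξ}.indicator fun ξ => (Real.exp (-φ X ξ) : ℂ) with hbdef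
  have hb : Measurable b :=
    (Complex.measurable_ofReal.comp (Real.measurable_exp.comp measurable_φ.neg)).indicator
      (measurableSet_le_freq' 0)
  have hbs : ∀ x ξ, b ξ * e ξ x = conj ((szegoSymbol x : Γ → ℂ) ξ) := fun x ξ => by
    simp only [hbdef, szegoSymbol]
    by_cases h : ξ ∈ {ξ | 0 ≤ φ X ξ}
    · rw [indicator_of_mem h, indicator_of_mem h, map_mul, Complex.conj_ofReal, e_neg,
        Complex.conj_conj]
    · rw [indicator_of_notMem h, indicator_of_notMem h, zero_mul, map_zero]
  have hbn : ∀ ξ, ‖b ξ‖ = ‖(szegoSymbol x₀ : Γ → ℂ) ξ‖ := fun ξ => by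
    rw [← Complex.norm_conj ((szegoSymbol x₀ : Γ → ℂ) ξ), ← hbs, norm_mul, norm_e, mul_one]
  have hC : ∀ ξ : Γ, ‖b ξ‖ ≤ 1 := fun ξ => (hbn ξ).trans_le (norm_szegoSymbol_le_one x₀ ξ)
  have hUf := U_mult hb hC q
  set f := mult X b q with hf
  have hb2 : MemLp b 2 (ν X) :=
    (memLp_szegoSymbol x₀).of_le hb.aestronglyMeasurable (.of_forall fun ξ => (hbn ξ).le)
  have hfW : Wiener f := Wiener.of_ae (hb2.integrable_mul (memLp_U q)) hUf
  have hf0 : f = 0 := by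
    refine Lp.ext ?_
    filter_upwards [inversion f hfW, Lp.coeFn_zero ℂ 2 (volume : Measure X)] with x h1 h2
    rw [h1, h2, Pi.zero_apply]
    have h3 : ∫ ξ, U f ξ * e ξ x ∂(ν X) = conj (inner ℂ q (szego x)) := by
      rw [inner_eq_U, ← integral_conj]
      refine integral_congr_ae ?_
      filter_upwards [hUf, U_szego x] with ξ a1 a2
      rw [a1, a2, map_mul, Complex.conj_conj, ← hbs]
      ring
    rw [h3, h x, map_zero]
  refine hq0 (ext_U ?_)
  have h0 : (U (0 : L2 X) : Γ → ℂ) =ᵐ[ν X] 0 := by rw [map_zero]; exact Lp.coeFn_zero _ _ _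
  have hq' : ∀ᵐ ζ ∂(ν X), ζ ∉ {ξ : Γ | 0 ≤ φ X ξ} → U q ζ = 0 := mem_plus_iff.1 hq
  rw [hf0] at hUf
  filter_upwards [hUf, h0, hq'] with ξ h1 h2 h3
  rw [h2] at h1 ⊢
  by_cases hξ : ξ ∈ {ξ : Γ | 0 ≤ φ X ξ}
  · rw [hbdef, indicator_of_mem hξ] at h1
    have h4 : ((Real.exp (-φ X ξ) : ℝ) : ℂ) ≠ 0 := by exact_mod_cast (Real.exp_pos _).ne'
    exact (mul_eq_zero.1 h1.symm).resolve_left h4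
  · exact h3 hξ

end

end FourierModel

end CalogeroMoser

namespace CalogeroMoser

open AntiderivModel

/-! ### Rigidity of the Lax operator -/

/-- A continuous function on an interval has a `C¹` primitive there. -/
lemma exists_hasDerivAt_neg {J : Set ℝ} (hJ : IsOpen J) (hJc : J.OrdConnected) {α : ℝ → ℝ}
    (hα : ContinuousOn α J) :
    ∃ θ : ℝ → ℝ, ContDiffOn ℝ 1 θ J ∧ ∀ t ∈ J, HasDerivAt θ (-α t) t := by
  rcases J.eq_empty_or_nonempty with hJe | ⟨t₀, ht₀⟩
  · subst hJe
    exact ⟨0, contDiffOn_empty, fun t ht => absurd ht (notMem_empty t)⟩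
  have hd : ∀ t ∈ J, HasDerivAt (fun t => -∫ τ in t₀..t, α τ) (-α t) t := fun t ht => by
    have hint : IntervalIntegrable α volume t₀ t :=
      (hα.mono (hJc.uIcc_subset ht₀ ht)).intervalIntegrable
    exact (intervalIntegral.integral_hasDerivAt_right hint
      (hα.stronglyMeasurableAtFilter hJ t ht) (hα.continuousAt (hJ.mem_nhds ht))).neg
  refine ⟨_, ?_, hd⟩
  rw [contDiffOn_one_iff_derivWithin hJ.uniqueDiffOn]
  refine ⟨fun t ht => (hd t ht).differentiableAt.differentiableWithinAt, ?_⟩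
  refine hα.neg.congr fun t ht => ?_
  rw [derivWithin_of_isOpen hJ ht, (hd t ht).deriv]
  rfl

lemma phase_mul_conj (a : ℝ) :
    Complex.exp (Complex.I * a) * conj (Complex.exp (Complex.I * a)) = 1 := by
  rw [Complex.mul_conj, Complex.normSq_eq_norm_sq, mul_comm, Complex.norm_exp_ofReal_mul_I]
  simp

namespace FourierModel

section

variable {X Γ : Type} [MeasureSpace X] [GeometryData X] [AddCommGroup Γ]
  [MeasurableSpace Γ] [MeasurableAdd₂ Γ] [MeasurableNeg Γ] [fm : FourierModel X Γ]
  [SFinite (volume : Measure X)]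

include fm

lemma mul_eq_zero_of_ae_ne_zero {f g : L2 X} (hf : Wiener f) (hf0 : ∀ᵐ y, f y ≠ 0)
    (h : g ⊙ f = 0) : g = 0 := by
  refine Lp.ext ?_
  have h' : (g ⊙ f : X → ℂ) =ᵐ[volume] (0 : L2 X) := by rw [h]
  filter_upwards [hf0, h', coeFn_mul (hf.memLp_mul' g), Lp.coeFn_zero ℂ 2 (volume : Measure X)]
    with y h1 h2 h3 h4
  rw [h3, h4] at h2
  rw [h4]
  exact (mul_eq_zero.1 h2).resolve_right h1

lemma laxVariation_smul {s : Sign} {q : L2 X} (c : ℂ) (u : L2 X) :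
    laxVariation s q (c • q) u = -((s.val * (c + conj c)) • (q ⊙ Cplus (star q ⊙ u))) := by
  rw [laxVariation, smul_mul', star_smul', smul_mul', Cplus_smul, mul_smul']
  module

/-- A direction `e ∈ L²₊` that leaves the Lax operator at `q ≠ 0` unchanged to first order is an
imaginary multiple of `q`. It suffices to test with reproducing kernels. -/
lemma exists_eq_smul_of_laxVariation_eq_zero {s : Sign} {q e : L2 X} (hq : q ∈ hardyPlus (X := X))
    (hq0 : q ≠ 0) (he : e ∈ hardyPlus (X := X))
    (h : ∀ u ∈ sobolevPlus X, laxVariation s q e u = 0) :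
    e = (Complex.I * ((inner ℂ q e : ℂ).im / ‖q‖ ^ 2 : ℝ)) • q := by
  obtain ⟨x, hx⟩ := exists_inner_szego_ne_zero hq hq0
  have hsob := szego_mem_sobolevPlus x
  have hkW := wiener_of_sobolevPlus hsob
  have hs0 : s.val ≠ 0 := fun h0 => by
    have := Sign.norm_val s; rw [h0, norm_zero] at this; exact zero_ne_one this
  set k := szego x
  set c : ℂ := inner ℂ q k with hc
  obtain ⟨l, hl⟩ : ∃ l : ℂ, e = l • q := by
    have h1 := h k hsob
    rw [laxVariation, Cplus_star_mul_szego hq, Cplus_star_mul_szego he, neg_eq_zero, smul_eq_zero]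
      at h1
    have h2 := h1.resolve_left hs0
    rw [mul_smul', mul_smul', ← smul_mul', ← smul_mul',
      ← add_mul_of_memLp (hkW.memLp_mul' _) (hkW.memLp_mul' _)] at h2
    have h3 := mul_eq_zero_of_ae_ne_zero hkW (szego_ne_zero x) h2
    refine ⟨-(c⁻¹ * inner ℂ e k), ?_⟩
    have h4 : c • e = -((inner ℂ e k : ℂ) • q) := eq_neg_of_add_eq_zero_left h3
    rw [neg_smul, mul_smul, ← smul_neg, ← h4, inv_smul_smul₀ hx]
  have hlc : l + conj l = 0 := by
    have h1 := h k hsob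
    rw [hl, laxVariation_smul, neg_eq_zero, smul_eq_zero, Cplus_star_mul_szego hq, mul_smul',
      smul_eq_zero] at h1
    rcases h1 with h1 | h1 | h1
    · exact (mul_eq_zero.1 h1).resolve_left hs0
    · exact absurd h1 hx
    · exact absurd (mul_eq_zero_of_ae_ne_zero hkW (szego_ne_zero x) h1) hq0
  have hre : l.re = 0 := by
    have := congrArg Complex.re hlc
    simp at this
    linarith
  have hn : ‖q‖ ^ 2 ≠ 0 := by simpa using hq0
  have him : (inner ℂ q e : ℂ).im = l.im * ‖q‖ ^ 2 := by
    rw [hl, inner_smul_right, inner_self_eq_norm_sq_to_K]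
    simp [← Complex.ofReal_pow, Complex.mul_im]
  rw [him, mul_div_cancel_right₀ _ hn]
  conv_lhs => rw [hl]
  congr 1
  apply Complex.ext <;> simp [hre]

/-- The mass is conserved: `∫ Re (q̄ v) = 0`. -/
lemma re_inner_hamVec (c : ℝ) {s : Sign} {q : L2 X} (hq : q ∈ phaseSpace X s) {κ : ℝ}
    (hκ : 1 ≤ κ) : (inner ℂ q (hamVec c s κ q)).re = 0 := by
  have hm := mkappa_mem_sobolevPlus hq hκ
  have hmW := wiener_of_sobolevPlus hm
  have hsplit := mul_star_eq hq hκ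
  have hβ := beta_im hq hκ
  change (inner ℂ q (mkappa s κ q) : ℂ).im = 0 at hβ
  rw [hamVec]
  set m := mkappa s κ q
  set A := Cpos (q ⊙ star m) with hA
  have h1 : inner ℂ q (m ⊙ A) = (‖A‖ ^ 2 : ℝ) := by
    rw [mul_comm', mul_comm' A, inner_mul_right (hmW.memLp_mul A) (hmW.star.memLp_mul q),
      mul_comm' _ q]
    have h2 : Cpos A = A := Cpos_of_suppIn (SuppIn.Cpos _)
    have h3 : inner ℂ (q ⊙ star m) A = inner ℂ A A := by
      rw [← h2, inner_Cpos, h2]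
    rw [h3, inner_self_eq_norm_sq_to_K]
    simp
  rw [inner_sub_right, inner_add_right, inner_neg_right, inner_smul_right,
    inner_smul_right, inner_smul_right, h1, inner_self_eq_norm_sq_to_K, ← Sign.coe_sgn]
  simp only [Complex.sub_re, Complex.add_re, Complex.neg_re]
  simp [Complex.mul_re, Complex.mul_im, hβ, ← Complex.ofReal_pow]

/-! ### Phase covariance -/

section

variable {z : ℂ} (hz : z * conj z = 1)

include hz

lemma lax_phase (s : Sign) (q u : L2 X) : lax s (z • q) u = lax s q u := by
  rw [lax, lax, star_smul', smul_mul', smul_mul', Cplus_smul, mul_smul', smul_smul z, hz, one_smul]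

lemma phase_mem_phaseSpace {s : Sign} {q : L2 X} (hq : q ∈ phaseSpace X s) :
    z • q ∈ phaseSpace X s := by
  have hn : ‖z‖ = 1 := by
    have h1 := congrArg norm hz
    rw [norm_mul, Complex.norm_conj, norm_one] at h1
    nlinarith [norm_nonneg z]
  refine ⟨Submodule.smul_mem _ _ hq.1, ?_⟩
  have h := hq.2
  rw [mass_eq] at h ⊢
  rwa [norm_smul, hn, one_mul]

lemma mkappa_phase {s : Sign} {q : L2 X} (hq : q ∈ phaseSpace X s) {κ : ℝ} (hκ : 1 ≤ κ) :
    mkappa s κ (z • q) = z • mkappa s κ q := by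
  have h := mkappa_spec hq hκ
  refine resolv_eq (phase_mem_phaseSpace hz hq) hκ (sobolevPlus_smul h.1 z) ?_
  rw [lax_phase hz, lax_smul s h.1]
  nth_rw 4 [← h.2]
  module

lemma hamVec_phase (c : ℝ) {s : Sign} {q : L2 X} (hq : q ∈ phaseSpace X s) {κ : ℝ}
    (hκ : 1 ≤ κ) : hamVec c s κ (z • q) = z • hamVec c s κ q := by
  have hn : ‖z‖ = 1 := by
    have h1 := congrArg norm hz
    rw [norm_mul, Complex.norm_conj, norm_one] at h1
    nlinarith [norm_nonneg z]
  have hp : (z • q) ⊙ star (z • mkappa s κ q) = q ⊙ star (mkappa s κ q) := by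
    rw [star_smul', mul_smul', smul_mul', smul_smul, mul_comm, hz, one_smul]
  rw [hamVec, hamVec, mkappa_phase hz hq hκ, hp, smul_mul', norm_smul, hn, one_mul]
  module

end

/-! ### Continuity of the vector field -/

/-- The real bilinear map `(w, f) ↦ ((D + 1)⁻¹ w) f`. -/
def mulFreeResolvent (X : Type) {Γ : Type} [MeasureSpace X] [GeometryData X] [AddCommGroup Γ]
    [MeasurableSpace Γ] [MeasurableAdd₂ Γ] [MeasurableNeg Γ] [FourierModel X Γ]
    [SFinite (volume : Measure X)] : L2 X →L[ℝ] L2 X →L[ℝ] L2 X :=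
  LinearMap.mkContinuous₂
    (LinearMap.mk₂ ℝ (fun w f => freeResolvent X 1 w ⊙ f)
      (fun w₁ w₂ f => by
        rw [map_add, add_mul_of_memLp ((wiener_freeResolvent w₁).1.memLp_mul _)
          ((wiener_freeResolvent w₂).1.memLp_mul _)])
      (fun c w f => by rw [real_smul_eq, map_smul, smul_mul', real_smul_eq])
      (fun w f₁ f₂ => mul_add_of_memLp ((wiener_freeResolvent w).1.memLp_mul _)
        ((wiener_freeResolvent w).1.memLp_mul _))
      (fun c w f => mul_real_smul _ _ _))
    2 (fun w f => by
      have h := wiener_freeResolvent (X := X) w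
      refine (h.1.norm_mul_le f).trans ?_
      gcongr
      exact h.2)

lemma continuous_star' : Continuous (star : L2 X → L2 X) := by
  have : Isometry (star : L2 X → L2 X) := Isometry.of_dist_eq fun f g => by
    rw [dist_eq_norm, dist_eq_norm, ← star_sub', norm_star']
  exact this.continuous

lemma continuous_Cpos : Continuous (Cpos : L2 X → L2 X) := by
  unfold Cpos
  exact continuous_id.sub (hardyMinus (X := X)).starProjection.continuous

lemma continuousOn_hamVec (c : ℝ) {s : Sign} {κ : ℝ} (hκ : 1 ≤ κ) :
    ContinuousOn (hamVec (X := X) c s κ) (phaseSpace X s) := by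
  have hw : ContinuousOn (density (X := X) s κ) (phaseSpace X s) := fun q hq =>
    (contDiffAt_density hq hκ).continuousAt.continuousWithinAt
  have hm : ContinuousOn (mkappa (X := X) s κ) (phaseSpace X s) :=
    ((freeResolvent X 1).continuous.comp_continuousOn hw).congr fun q hq => mkappa_eq hq hκ
  have hmul : ∀ F : L2 X → L2 X, ContinuousOn F (phaseSpace X s) →
      ContinuousOn (fun q => mkappa s κ q ⊙ F q) (phaseSpace X s) := fun F hF => by
    have h1 : ContinuousOn (fun q => mulFreeResolvent X (density s κ q) (F q)) (phaseSpace X s) :=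
      ((mulFreeResolvent X).continuous.comp_continuousOn hw).clm_apply hF
    refine h1.congr fun q hq => ?_
    change mkappa s κ q ⊙ F q = freeResolvent X 1 (density s κ q) ⊙ F q
    rw [mkappa_eq hq hκ]
  have hqm : ContinuousOn (fun q : L2 X => q ⊙ star (mkappa s κ q)) (phaseSpace X s) := by
    refine (continuous_star'.comp_continuousOn (hmul star continuous_star'.continuousOn)).congr
      fun q hq => ?_
    have h1 := star_star_mul (wiener_of_sobolevPlus (mkappa_mem_sobolevPlus hq hκ)) q
    rw [mul_comm'] at h1
    exact h1.symm
  have hA := hmul _ (continuous_Cpos.comp_continuousOn hqm)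
  have hmu : ContinuousOn (fun q : L2 X => s.val * (2 * Complex.I * c)
      * ((‖mkappa s κ q‖ ^ 2 : ℝ) : ℂ)) (phaseSpace X s) :=
    continuousOn_const.mul (Complex.continuous_ofReal.comp_continuousOn (hm.norm.pow 2))
  exact (((hm.const_smul (2 * Complex.I)).neg).add (hA.const_smul (2 * Complex.I * s.val))).sub
    (hmu.smul continuousOn_id)

lemma hamVec_zero (c : ℝ) {s : Sign} {κ : ℝ} (hκ : 1 ≤ κ) (h0 : (0 : L2 X) ∈ phaseSpace X s) :
    hamVec (X := X) c s κ 0 = 0 := by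
  have hm : mkappa (X := X) s κ 0 = 0 := by
    have hz : (0 : L2 X) ∈ sobolevPlus X := by
      simpa using sobolevPlus_smul (mkappa_mem_sobolevPlus h0 hκ) 0
    refine resolv_eq h0 hκ hz ?_
    have := lax_smul s (q := (0 : L2 X)) hz 0
    rw [zero_smul, zero_smul] at this
    rw [this, smul_zero, add_zero]
  have h1 : (0 : L2 X) ⊙ Cpos (0 ⊙ star (0 : L2 X)) = 0 := by
    have := smul_mul' (0 : L2 X) (Cpos (0 ⊙ star (0 : L2 X))) 0
    rwa [zero_smul, zero_smul] at this
  rw [hamVec, hm, h1]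
  simp

/-! ### The converse of the Lax pair -/

lemma hasDerivAt_phase {θ : ℝ → ℝ} {q : ℝ → L2 X} {a : ℝ} {d : L2 X} {t : ℝ}
    (hθ : HasDerivAt θ a t) (hq : HasDerivAt q d t) :
    HasDerivAt (fun t => Complex.exp (Complex.I * θ t) • q t)
      (Complex.exp (Complex.I * θ t) • (d + (Complex.I * a) • q t)) t := by
  have h1 : HasDerivAt (fun t => Complex.exp (Complex.I * θ t))
      (Complex.exp (Complex.I * θ t) * (Complex.I * a)) t := (hθ.ofReal_comp.const_mul _).cexp
  refine (h1.smul hq).congr_deriv ?_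
  module

/-- The mass of a solution of the Lax equation is constant. -/
lemma norm_sq_eq_of_lax (c : ℝ) {s : Sign} {κ : ℝ} (hκ : 1 ≤ κ) {J : Set ℝ} (hJ : IsOpen J)
    (hJc : J.OrdConnected) {q d : ℝ → L2 X} (hq : ∀ t ∈ J, q t ∈ phaseSpace X s)
    (hd : ∀ t ∈ J, HasDerivAt q (d t) t)
    (h : ∀ t ∈ J, ∀ u ∈ sobolevPlus X,
      laxVariation s (q t) (d t - hamVec c s κ (q t)) u = 0) :
    ∀ t ∈ J, ∀ t' ∈ J, ‖q t‖ ^ 2 = ‖q t'‖ ^ 2 := by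
  have hre : ∀ t ∈ J, (inner ℂ (q t) (d t)).re = 0 := fun t ht => by
    by_cases h0 : q t = 0
    · rw [h0, inner_zero_left, Complex.zero_re]
    have hdp := mem_plus_of_hasDerivAt (eventually_mem_plus hJ hq ht) (hd t ht)
    have h1 := exists_eq_smul_of_laxVariation_eq_zero (hq t ht).1 h0
      (sub_mem hdp (hamVec_mem_plus c (hq t ht) hκ)) (h t ht)
    rw [sub_eq_iff_eq_add] at h1
    rw [h1, inner_add_right, Complex.add_re, re_inner_hamVec c (hq t ht) hκ, inner_smul_right,
      inner_self_eq_norm_sq_to_K, add_zero, mul_assoc, Complex.I_mul_re]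
    simp [← Complex.ofReal_pow]
  have hder : ∀ t ∈ J, HasDerivAt (fun t => ‖q t‖ ^ 2) 0 t := fun t ht => by
    have h1 := (hd t ht).inner ℂ (hd t ht)
    have h2 := (Complex.reCLM.hasFDerivAt.comp_hasDerivAt t h1)
    have h3 : (Complex.reCLM ∘ fun t => (inner ℂ (q t) (q t) : ℂ)) = fun t => ‖q t‖ ^ 2 := by
      funext t
      simp only [Function.comp_apply, Complex.reCLM_apply]
      rw [inner_self_eq_norm_sq_to_K]
      simp [← Complex.ofReal_pow]
    rw [h3] at h2
    refine h2.congr_deriv ?_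
    have h4 : (inner ℂ (d t) (q t) : ℂ).re = 0 := by
      rw [← inner_conj_symm, Complex.conj_re]; exact hre t ht
    simp [hre t ht, h4]
  intro t ht t' ht'
  refine (hJ.is_const_of_deriv_eq_zero hJc.isPreconnected
    (fun t ht => (hder t ht).differentiableAt.differentiableWithinAt)
    (fun t ht => (hder t ht).deriv) ht ht')

/-- A `C¹` curve solves the Lax equation exactly when a change of phase turns it into a solution of
the flow. -/
lemma laxEquation_iff_exists_phase [am : AntiderivModel X] {s : Sign} {κ : ℝ} (hκ : 1 ≤ κ)
    {J : Set ℝ} (hJ : IsOpen J) (hJc : J.OrdConnected) {q : ℝ → L2 X}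
    (hq : ∀ t ∈ J, q t ∈ phaseSpace X s) (hC : ContDiffOn ℝ 1 q J) :
    LaxEquation s (peter (c₀ X) s κ) J q ↔ ∃ θ : ℝ → ℝ, ContDiffOn ℝ 1 θ J ∧
      SolvesFlow s κ J (fun t => Complex.exp (Complex.I * θ t) • q t) := by
  have hd : ∀ t ∈ J, HasDerivAt q (deriv q t) t := fun t ht =>
    ((hC.differentiableOn one_ne_zero).differentiableAt (hJ.mem_nhds ht)).hasDerivAt
  have hdc : ContinuousOn (deriv q) J := hC.continuousOn_deriv_of_isOpen hJ le_rfl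
  have hqp : ∀ θ : ℝ → ℝ, ∀ t ∈ J, Complex.exp (Complex.I * θ t) • q t ∈ phaseSpace X s :=
    fun θ t ht => phase_mem_phaseSpace (phase_mul_conj _) (hq t ht)
  rw [laxEquation_iff (c₀ X) hκ hJ hq hd]
  constructor
  · intro h
    -- As the mass is constant, the denominator of `α` does not depend on time.
    have hmass := norm_sq_eq_of_lax (c₀ X) hκ hJ hJc hq hd h
    set e : ℝ → L2 X := fun t => deriv q t - hamVec (c₀ X) s κ (q t) with he
    set α : ℝ → ℝ := fun t => (inner ℂ (q t) (e t) : ℂ).im / ‖q t‖ ^ 2 with hα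
    have hec : ContinuousOn e J := hdc.sub
      ((continuousOn_hamVec (c₀ X) hκ).comp hC.continuousOn fun t ht => hq t ht)
    have hαc : ContinuousOn α J := by
      rcases J.eq_empty_or_nonempty with hJe | ⟨t₀, ht₀⟩
      · rw [hJe]; exact continuousOn_empty _
      have h1 : ContinuousOn (fun t => (inner ℂ (q t) (e t) : ℂ).im / ‖q t₀‖ ^ 2) J :=
        (Complex.continuous_im.comp_continuousOn (hC.continuousOn.inner hec)).div_const _
      refine h1.congr fun t ht => ?_
      rw [hα]
      simp only
      rw [hmass t ht t₀ ht₀]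
    have heq : ∀ t ∈ J, e t = (Complex.I * α t) • q t := fun t ht => by
      by_cases h0 : q t = 0
      · -- A curve that vanishes once vanishes identically.
        have hzero : ∀ t' ∈ J, q t' = 0 := fun t' ht' => by
          have := hmass t' ht' t ht
          rw [h0, norm_zero] at this
          simpa using this
        have h1 : deriv q t = 0 := by
          have h2 : q =ᶠ[nhds t] fun _ => 0 := Filter.eventually_of_mem (hJ.mem_nhds ht) hzero
          rw [h2.deriv_eq, deriv_const]
        have h3 : (0 : L2 X) ∈ phaseSpace X s := h0 ▸ hq t ht
        rw [he]
        simp only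
        rw [h1, h0, hamVec_zero _ hκ h3, sub_zero, smul_zero]
      · have hdp := mem_plus_of_hasDerivAt (eventually_mem_plus hJ hq ht) (hd t ht)
        exact exists_eq_smul_of_laxVariation_eq_zero (hq t ht).1 h0
          (sub_mem hdp (hamVec_mem_plus (c₀ X) (hq t ht) hκ)) (h t ht)
    obtain ⟨θ, hθ, hθd⟩ := exists_hasDerivAt_neg hJ hJc hαc
    refine ⟨θ, hθ, (solvesFlow_iff hκ (hqp θ)).2 fun t ht => ?_⟩
    refine (hasDerivAt_phase (hθd t ht) (hd t ht)).congr_deriv ?_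
    rw [hamVec_phase (phase_mul_conj _) _ (hq t ht) hκ]
    congr 1
    have h1 := heq t ht
    rw [he] at h1
    simp only at h1
    rw [sub_eq_iff_eq_add] at h1
    rw [h1]
    push_cast
    module
  · rintro ⟨θ, hθ, hflow⟩ t ht u hu
    have hθd : HasDerivAt θ (deriv θ t) t :=
      ((hθ.differentiableOn one_ne_zero).differentiableAt (hJ.mem_nhds ht)).hasDerivAt
    have h1 := ((solvesFlow_iff hκ (hqp θ)).1 hflow t ht).unique (hasDerivAt_phase hθd (hd t ht))
    rw [hamVec_phase (phase_mul_conj _) _ (hq t ht) hκ] at h1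
    have h2 := (smul_right_injective _ (Complex.exp_ne_zero _)) h1
    have h3 : deriv q t - hamVec (c₀ X) s κ (q t) = (Complex.I * (-deriv θ t : ℝ)) • q t := by
      rw [h2]
      push_cast
      module
    rw [h3, laxVariation_smul]
    simp

end

end FourierModel

end CalogeroMoser

namespace CalogeroMoser

open AntiderivModel

/-! ### The proposition for an arbitrary geometry -/

namespace FourierModel

section

variable {X Γ : Type} [MeasureSpace X] [GeometryData X] [AddCommGroup Γ]
  [MeasurableSpace Γ] [MeasurableAdd₂ Γ] [MeasurableNeg Γ] [fm : FourierModel X Γ]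
  [SFinite (volume : Measure X)] [am : AntiderivModel X]

include fm am

/-- The proposition for an arbitrary geometry, with the weight `c₀` of the mean as a parameter. -/
theorem proposition_of_model (s : Sign) {κ : ℝ} (hκ : 1 ≤ κ) :
    (∀ q ∈ phaseSpace X s,
        (∀ u ∈ sobolevPlus X, MemLp u ⊤ volume ∧
          MemLp (fun x => q x * Cplus (star q ⊙ u) x) 2 volume) ∧
        (∀ f ∈ hardyPlus (X := X), ∃! u, u ∈ sobolevPlus X ∧ lax s q u + (κ : ℂ) • u = f) ∧
        (∀ u ∈ sobolevPlus X, peter (c₀ X) s κ q u ∈ sobolevPlus X) ∧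
        (beta s κ q).im = 0 ∧
        (∀ a, IsWirtingerBar (beta s κ) q a ↔
          a = mkappa s κ q
            + s.val • Cplus (mkappa s κ q ⊙ Cminus (q ⊙ star (mkappa s κ q)))) ∧
        (∀ v, IsSympGrad s (beta s κ) q v ↔
          v = -((2 * Complex.I) • mkappa s κ q)
            + (2 * Complex.I * s.val) •
                (mkappa s κ q ⊙ Cplus (q ⊙ star (mkappa s κ q)))
            - (s.val * (2 * Complex.I * c₀ X) * beta s κ q) • mkappa s κ q
            - (s.val * (2 * Complex.I * c₀ X) * (‖mkappa s κ q‖ ^ 2 : ℝ)) • q)) ∧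
      ContDiffOn ℝ 1 (fun q : hardyPlus (X := X) => beta s κ (q : L2 X))
        {q | (q : L2 X) ∈ phaseSpace X s} ∧
      ∀ (J : Set ℝ) (q : ℝ → L2 X), IsOpen J → J.OrdConnected →
        (∀ t ∈ J, q t ∈ phaseSpace X s) →
        (SolvesFlow s κ J q ↔ ∀ t ∈ J, HasDerivAt q (peter (c₀ X) s κ (q t) (q t)) t) ∧
        (SolvesFlow s κ J q → LaxEquation s (peter (c₀ X) s κ) J q) ∧
        (ContDiffOn ℝ 1 q J →
          (LaxEquation s (peter (c₀ X) s κ) J q ↔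
            ∃ θ : ℝ → ℝ, ContDiffOn ℝ 1 θ J ∧
              SolvesFlow s κ J (fun t => Complex.exp (Complex.I * θ t) • q t))) := by
  refine ⟨fun q hq => ⟨fun u hu => ⟨(wiener_of_sobolevPlus hu).memLp_top,
    memLp_mul_Cplus hq.1 hu q⟩, fun f hf => ?_, fun u hu => peter_mem_sobolevPlus _ hq hκ hu,
    beta_im hq hκ, isWirtingerBar_iff hq hκ, fun v => ?_⟩, contDiffOn_beta s hκ,
    fun J q hJ hJc hq => ⟨?_, fun h => ?_, laxEquation_iff_exists_phase hκ hJ hJc hq⟩⟩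
  · obtain ⟨u, hu, h⟩ := exists_lax_eq hq hκ hf
    exact ⟨u, ⟨hu, h⟩, fun v hv => lax_resolvent_unique hq hκ hv.1 hu (hv.2.trans h.symm)⟩
  · rw [isSympGrad_iff hq hκ, hamVec_eq hq hκ]
  · rw [solvesFlow_iff hκ hq]
    exact forall₂_congr fun t ht => by rw [peter_self (hq t ht) hκ]
  · refine (laxEquation_iff (c₀ X) hκ hJ hq ((solvesFlow_iff hκ hq).1 h)).2 fun t ht u hu => ?_
    have hv := hamVec_mem_plus (c₀ X) (hq t ht) hκ
    rw [laxVariation_sub s (hq t ht).1 hv hv hu, sub_self]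

end

end FourierModel

end CalogeroMoser

namespace CalogeroMoser

/-! ### The Fourier transform on `L²(ℝ)` -/

open VectorFourier in
/-- The inverse Fourier integral is symmetric for the bilinear pairing. -/
lemma integral_fourierInv_mul {g χ : ℝ → ℂ} (hg : Integrable g) (hχ : Integrable χ) :
    ∫ ξ, (𝓕⁻ χ : ℝ → ℂ) ξ * g ξ = ∫ x, χ x * (𝓕⁻ g : ℝ → ℂ) x := by
  have h := integral_fourierIntegral_smul_eq_flip (μ := volume) (ν := volume)
    (L := -innerₗ ℝ) (e := Real.fourierChar) Real.continuous_fourierChar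
    (by simpa using! continuous_inner.neg) hχ hg
  have hflip : (-innerₗ ℝ).flip = -innerₗ ℝ := by
    ext; simp
  rw [hflip] at h
  exact h

/-- The Fourier inversion formula for a square integrable function with integrable transform. Both
sides have the same pairing with every test function. -/
lemma ae_eq_fourierInv (f : L2 ℝ) (hf : Integrable (𝓕 f : L2 ℝ)) :
    (f : ℝ → ℂ) =ᵐ[volume] (𝓕⁻ ((𝓕 f : L2 ℝ) : ℝ → ℂ)) := by
  have hcont : Continuous (𝓕⁻ ((𝓕 f : L2 ℝ) : ℝ → ℂ)) :=
    VectorFourier.fourierIntegral_continuous Real.continuous_fourierChar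
      (by simpa using! continuous_inner.neg) hf
  refine ae_eq_of_integral_contDiff_smul_eq
    ((Lp.memLp f).locallyIntegrable (by norm_num)) hcont.locallyIntegrable fun ψ hψ hs => ?_
  have hs' : HasCompactSupport (fun x => (ψ x : ℂ)) := hs.comp_left (g := fun r : ℝ => (r : ℂ)) rfl
  let χ : SchwartzMap ℝ ℂ := hs'.toSchwartzMap (Complex.ofRealCLM.contDiff.comp hψ)
  have hχ : ∀ x, χ x = ψ x := fun x => rfl
  have h1 := congrArg (fun T : TemperedDistribution ℝ ℂ => T χ)
    (Lp.fourierInv_toTemperedDistribution_eq (𝓕 f : L2 ℝ))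
  have h0 : (𝓕⁻ (𝓕 f : L2 ℝ) : L2 ℝ) = f := (Lp.fourierTransformₗᵢ ℝ ℂ).symm_apply_apply f
  simp only [TemperedDistribution.fourierInv_apply, Lp.toTemperedDistribution_apply, h0] at h1
  have h2 := integral_fourierInv_mul hf χ.integrable
  rw [← SchwartzMap.fourierInv_coe] at h2
  simp only [smul_eq_mul] at h1
  calc ∫ x, ψ x • f x = ∫ x, χ x * f x := by simp only [hχ, Complex.real_smul]
    _ = ∫ x, χ x * (𝓕⁻ ((𝓕 f : L2 ℝ) : ℝ → ℂ)) x := by rw [← h1, h2]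
    _ = _ := by simp only [hχ, Complex.real_smul]

/-- On `L¹ ∩ L²` the Fourier transform is given by the Fourier integral: both sides have the same
pairing with every test function. -/
lemma fourier_ae_eq (f : L2 ℝ) (hf : Integrable f) :
    (𝓕 f : L2 ℝ) =ᵐ[volume] (𝓕 (f : ℝ → ℂ) : ℝ → ℂ) := by
  have hcont : Continuous (𝓕 (f : ℝ → ℂ) : ℝ → ℂ) :=
    VectorFourier.fourierIntegral_continuous Real.continuous_fourierChar
      (by simpa using! continuous_inner) hf
  refine ae_eq_of_integral_contDiff_smul_eq
    ((Lp.memLp _).locallyIntegrable (by norm_num)) hcont.locallyIntegrable fun ψ hψ hs => ?_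
  have hs' : HasCompactSupport (fun x => (ψ x : ℂ)) := hs.comp_left (g := fun r : ℝ => (r : ℂ)) rfl
  let χ : SchwartzMap ℝ ℂ := hs'.toSchwartzMap (Complex.ofRealCLM.contDiff.comp hψ)
  have hχ : ∀ x, χ x = ψ x := fun x => rfl
  have h1 := congrArg (fun T : TemperedDistribution ℝ ℂ => T χ)
    (Lp.fourier_toTemperedDistribution_eq f)
  simp only [TemperedDistribution.fourier_apply, Lp.toTemperedDistribution_apply] at h1
  have h2 := VectorFourier.integral_fourierIntegral_smul_eq_flip (μ := volume) (ν := volume)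
    (L := innerₗ ℝ) (e := Real.fourierChar) Real.continuous_fourierChar
    (by simpa using! continuous_inner) χ.integrable hf
  rw [flip_innerₗ] at h2
  change ∫ ξ, (𝓕 (χ : ℝ → ℂ) : ℝ → ℂ) ξ • f ξ = ∫ x, χ x • (𝓕 (f : ℝ → ℂ) : ℝ → ℂ) x at h2
  rw [← SchwartzMap.fourier_coe, h1] at h2
  simpa only [hχ, Complex.real_smul, smul_eq_mul] using h2

end CalogeroMoser

namespace CalogeroMoser

/-! ### The Fourier model of the line -/

/-- The character `x ↦ e^{2πixξ}` of the line. -/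
def lineChar (ξ x : ℝ) : ℂ := (Real.fourierChar (x * ξ) : ℂ)

lemma lineChar_eq (ξ x : ℝ) : lineChar ξ x = Complex.exp (2 * π * Complex.I * (x * ξ)) := by
  rw [lineChar, Real.fourierChar_apply]
  congr 1
  push_cast
  ring

lemma continuous_lineChar : Continuous (Function.uncurry lineChar) := by
  have h : Function.uncurry lineChar
      = fun p : ℝ × ℝ => Complex.exp (2 * π * Complex.I * (p.2 * p.1)) := by
    ext p; exact lineChar_eq _ _
  rw [h]
  fun_prop

/-- The integral is that of `e^{cξ}` over the half-line, with `Re c < 0`. -/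
lemma line_poisson_ne_zero (x y : ℝ) :
    ∫ ξ in {ξ : ℝ | 0 ≤ 2 * π * ξ}, (Real.exp (-(2 * π * ξ)) : ℂ) * lineChar (-ξ) x * lineChar ξ y
      ≠ 0 := by
  have hset : {ξ : ℝ | 0 ≤ 2 * π * ξ} = Ici 0 := by
    ext ξ
    exact mul_nonneg_iff_of_pos_left Real.two_pi_pos
  set c : ℂ := -(2 * π) + 2 * π * Complex.I * (y - x) with hc
  have hre : c.re = -(2 * π) := by simp [hc]
  have hre' : c.re < 0 := by rw [hre]; linarith [Real.two_pi_pos]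
  have hint : ∀ ξ : ℝ, (Real.exp (-(2 * π * ξ)) : ℂ) * lineChar (-ξ) x * lineChar ξ y
      = Complex.exp (c * ξ) := by
    intro ξ
    rw [lineChar_eq, lineChar_eq, Complex.ofReal_exp, ← Complex.exp_add, ← Complex.exp_add, hc]
    congr 1
    push_cast
    ring
  simp only [hint]
  rw [hset, integral_Ici_eq_integral_Ioi, integral_exp_mul_complex_Ioi hre' 0]
  have hc0 : c ≠ 0 := by
    intro h
    rw [h] at hre'
    simp at hre'
  simp [hc0]

/-- The dual of the line is the line with the characters `e^{2πixξ}` and Lebesgue measure `dξ`; the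
frequency of `ξ` is `2πξ`. -/
instance : FourierModel ℝ ℝ where
  ν := volume
  sigmaFinite := inferInstance
  leftInvariant := inferInstance
  negInvariant := inferInstance
  φ := AddMonoidHom.mulLeft (2 * π)
  measurable_φ := by
    change Measurable fun ξ : ℝ => 2 * π * ξ
    fun_prop
  e := lineChar
  measurable_e := continuous_lineChar.measurable
  e_add ξ η x := by
    simp only [lineChar_eq, ← Complex.exp_add]
    congr 1
    push_cast
    ring
  norm_e ξ x := Circle.norm_coe _
  U := Lp.fourierTransformₗᵢ ℝ ℂ
  inversion f hf := by
    filter_upwards [ae_eq_fourierInv f hf] with x hx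
    rw [hx, Real.fourierInv_eq]
    refine integral_congr_ae (.of_forall fun ξ => ?_)
    simp only [lineChar, Circle.smul_def, smul_eq_mul, RCLike.inner_apply, conj_trivial]
    rw [mul_comm]
    rfl
  mem_plus f := by
    have h : ∀ ξ : ℝ, 2 * π * ξ < 0 ↔ ξ ∈ Iio (0 : ℝ) := fun ξ =>
      by rw [mem_Iio, ← not_le, ← not_le, mul_nonneg_iff_of_pos_left Real.two_pi_pos]
    change (∀ᵐ ξ : ℝ, ξ ∈ Iio (0 : ℝ) → (𝓕 f : L2 ℝ) ξ = 0) ↔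
      ∀ᵐ ξ : ℝ, 2 * π * ξ < 0 → (𝓕 f : L2 ℝ) ξ = 0
    simp only [h]
  mem_minus f := by
    have h : ∀ ξ : ℝ, 0 < 2 * π * ξ ↔ ξ ∈ Ioi (0 : ℝ) := fun ξ =>
      mul_pos_iff_of_pos_left Real.two_pi_pos
    change (∀ᵐ ξ : ℝ, ξ ∈ Ioi (0 : ℝ) → (𝓕 f : L2 ℝ) ξ = 0) ↔
      ∀ᵐ ξ : ℝ, 0 < 2 * π * ξ → (𝓕 f : L2 ℝ) ξ = 0
    simp only [h]
  isDeriv_iff f g := by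
    have h : ∀ ξ : ℝ, Complex.I * ((2 * π * ξ : ℝ) : ℂ) = 2 * π * Complex.I * ξ := fun ξ => by
      push_cast; ring
    change (∀ᵐ ξ : ℝ, (𝓕 g : L2 ℝ) ξ = 2 * π * Complex.I * ξ * (𝓕 f : L2 ℝ) ξ) ↔
      ∀ᵐ ξ : ℝ, (𝓕 g : L2 ℝ) ξ = Complex.I * ((2 * π * ξ : ℝ) : ℂ) * (𝓕 f : L2 ℝ) ξ
    simp only [h]
  measure_pos_le a ha := by
    refine (measure_mono (t := Ioc 0 (a / (2 * π))) fun ξ hξ => ?_).trans_eq (by simp)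
    exact ⟨(mul_pos_iff_of_pos_left Real.two_pi_pos).1 hξ.1,
      (le_div_iff₀' Real.two_pi_pos).2 hξ.2⟩
  measure_nonneg_le a ha := by
    refine (measure_mono (t := Icc 0 (a / (2 * π))) fun ξ hξ => ?_).trans ?_
    · exact ⟨(mul_nonneg_iff_of_pos_left Real.two_pi_pos).1 hξ.1,
        (le_div_iff₀' Real.two_pi_pos).2 hξ.2⟩
    · rw [Real.volume_Icc, sub_zero]
      gcongr
      linarith
  poisson_ne_zero := line_poisson_ne_zero

end CalogeroMoser

namespace CalogeroMoser

open Filter Topology FourierModel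

/-! ### The antiderivative on the line -/

lemma measurable_sign : Measurable Real.sign := by
  unfold Real.sign
  exact Measurable.ite measurableSet_Iio measurable_const
    (Measurable.ite measurableSet_Ioi measurable_const measurable_const)

/-- The Fourier transform of the indicator function of `(a, b]`. The factor `2πiξ` avoids the
division by `ξ`. -/
lemma conj_fourier_indicator_mul {a b : ℝ} (hab : a ≤ b) (ξ : ℝ) :
    conj ((𝓕 ((Ioc a b).indicator (1 : ℝ → ℂ)) : ℝ → ℂ) ξ) * (2 * π * Complex.I * ξ)
      = lineChar ξ b - lineChar ξ a := by
  have h1 : conj ((𝓕 ((Ioc a b).indicator (1 : ℝ → ℂ)) : ℝ → ℂ) ξ)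
      = ∫ x in a..b, lineChar ξ x := by
    rw [Real.fourier_eq, ← integral_conj, intervalIntegral.integral_of_le hab,
      ← integral_indicator measurableSet_Ioc]
    refine integral_congr_ae (.of_forall fun x => ?_)
    by_cases hx : x ∈ Ioc a b
    · simp [hx, lineChar, Circle.smul_def, ← Circle.coe_inv_eq_conj, AddChar.map_neg_eq_inv, mul_comm]
    · simp [hx]
  have h2 : ∀ x : ℝ, HasDerivAt (lineChar ξ) (lineChar ξ x * (2 * π * Complex.I * ξ)) x := by
    intro x
    have h3 : lineChar ξ = fun x : ℝ => Complex.exp (2 * π * Complex.I * ξ * (x : ℂ)) := by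
      ext x
      rw [lineChar_eq]
      congr 1
      ring
    have h4 : HasDerivAt (fun x : ℝ => 2 * π * Complex.I * ξ * (x : ℂ))
        (2 * π * Complex.I * ξ) x := by
      simpa using (Complex.ofRealCLM.hasDerivAt (x := x)).const_mul (2 * π * Complex.I * ξ)
    rw [h3]
    exact h4.cexp
  have hc : Continuous (lineChar ξ) := continuous_iff_continuousAt.2 fun x => (h2 x).continuousAt
  rw [h1, ← intervalIntegral.integral_mul_const]
  exact intervalIntegral.integral_eq_sub_of_hasDerivAt (fun x _ => h2 x)
    ((hc.mul continuous_const).intervalIntegrable _ _)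

/-- The fundamental theorem of calculus for the continuous representative of a function with square
integrable distributional derivative. -/
lemma line_integral_deriv {f g : L2 ℝ} (h : IsDeriv f g) {a b : ℝ} (hab : a ≤ b) :
    ∫ y in a..b, g y = (𝓕⁻ ((𝓕 f : L2 ℝ) : ℝ → ℂ) : ℝ → ℂ) b
      - (𝓕⁻ ((𝓕 f : L2 ℝ) : ℝ → ℂ) : ℝ → ℂ) a := by
  have hfin : volume (Ioc a b) ≠ ⊤ := by simp
  set w : L2 ℝ := indicatorConstLp 2 measurableSet_Ioc hfin (1 : ℂ) with hw
  have hwe : (w : ℝ → ℂ) =ᵐ[volume] (Ioc a b).indicator (1 : ℝ → ℂ) := indicatorConstLp_coeFn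
  have hwi : Integrable (w : ℝ → ℂ) :=
    ((integrable_indicator_iff measurableSet_Ioc).2 (integrableOn_const hfin)).congr hwe.symm
  have hFw : (𝓕 w : L2 ℝ) =ᵐ[volume] (𝓕 ((Ioc a b).indicator (1 : ℝ → ℂ)) : ℝ → ℂ) := by
    refine (fourier_ae_eq w hwi).trans (.of_forall fun ξ => ?_)
    exact Real.fourier_congr_ae hwe ξ
  have hW : Integrable ((𝓕 f : L2 ℝ) : ℝ → ℂ) := IsDeriv.wiener h
  have hchar : ∀ x : ℝ, Integrable (fun ξ => lineChar ξ x * (𝓕 f : L2 ℝ) ξ) := fun x => by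
    refine hW.bdd_mul (c := 1) ?_ (.of_forall fun ξ => (Circle.norm_coe _).le)
    exact (continuous_lineChar.comp (by fun_prop :
      Continuous fun ξ : ℝ => (ξ, x))).aestronglyMeasurable
  have hinv : ∀ x : ℝ, (𝓕⁻ ((𝓕 f : L2 ℝ) : ℝ → ℂ) : ℝ → ℂ) x
      = ∫ ξ, lineChar ξ x * (𝓕 f : L2 ℝ) ξ := by
    intro x
    rw [Real.fourierInv_eq]
    refine integral_congr_ae (.of_forall fun ξ => ?_)
    simp [lineChar, Circle.smul_def]
  rw [intervalIntegral.integral_of_le hab, ← L2.inner_indicatorConstLp_one (𝕜 := ℂ)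
    measurableSet_Ioc hfin g, ← Lp.inner_fourier_eq, inner_eq, hinv, hinv,
    ← integral_sub (hchar b) (hchar a)]
  refine integral_congr_ae ?_
  filter_upwards [hFw, h] with ξ h1 h2
  rw [h1, h2, ← mul_assoc, conj_fourier_indicator_mul hab, sub_mul]

/-- The fundamental theorem of calculus on both half-lines; `f` vanishes at infinity by the
Riemann--Lebesgue lemma. -/
lemma line_antideriv_deriv {f g : L2 ℝ} (h : IsDeriv f g) (hg : Integrable (g : ℝ → ℂ)) :
    ∀ᵐ x, antideriv (fun y => (g y).re) x = (f x).re := by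
  set F : ℝ → ℂ := 𝓕⁻ ((𝓕 f : L2 ℝ) : ℝ → ℂ) with hF
  have hzero : Tendsto F (cocompact ℝ) (𝓝 0) := by
    rw [hF, Real.fourierInv_eq_fourier_comp_neg]
    exact Real.zero_at_infty_fourier _
  have htop : Tendsto F atTop (𝓝 0) := hzero.mono_left atTop_le_cocompact
  have hbot : Tendsto F atBot (𝓝 0) := hzero.mono_left atBot_le_cocompact
  filter_upwards [ae_eq_fourierInv f (IsDeriv.wiener h)] with x hx
  have h1 : ∫ y in Ioi x, g y = -F x := by
    refine tendsto_nhds_unique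
      (intervalIntegral_tendsto_integral_Ioi x hg.integrableOn tendsto_id) ?_
    have : Tendsto (fun b => F b - F x) atTop (𝓝 (0 - F x)) := htop.sub_const _
    rw [zero_sub] at this
    refine this.congr' ?_
    filter_upwards [eventually_ge_atTop x] with b hb
    exact (line_integral_deriv h hb).symm
  have h2 : ∫ y in Iic x, g y = F x := by
    refine tendsto_nhds_unique
      (intervalIntegral_tendsto_integral_Iic x hg.integrableOn tendsto_id) ?_
    have : Tendsto (fun a => F x - F a) atBot (𝓝 (F x - 0)) := hbot.const_sub _
    rw [sub_zero] at this
    refine this.congr' ?_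
    filter_upwards [eventually_le_atBot x] with a ha
    exact (line_integral_deriv h ha).symm
  have hgr : Integrable (fun y => (g y).re) := hg.re
  have hsm : Integrable (fun y => Real.sign (x - y) * (g y).re) := by
    refine hgr.bdd_mul (c := 1) ?_ (.of_forall fun y => ?_)
    · exact (measurable_sign.comp (measurable_const.sub measurable_id)).aestronglyMeasurable
    · rcases Real.sign_apply_eq (x - y) with h | h | h <;> simp [h]
  have h5 : ∫ y in Iio x, Real.sign (x - y) * (g y).re = ∫ y in Iio x, (g y).re :=
    setIntegral_congr_fun measurableSet_Iio fun y hy => by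
      simp only [Real.sign_of_pos (sub_pos.2 (mem_Iio.1 hy)), one_mul]
  have h6 : ∫ y in Ioi x, Real.sign (x - y) * (g y).re = ∫ y in Ioi x, -(g y).re :=
    setIntegral_congr_fun measurableSet_Ioi fun y hy => by
      simp only [Real.sign_of_neg (sub_neg.2 (mem_Ioi.1 hy)), neg_one_mul]
  change 1 / 2 * ∫ y, Real.sign (x - y) * (g y).re = _
  rw [← integral_add_compl measurableSet_Iic hsm, compl_Iic, integral_Iic_eq_integral_Iio,
    h5, h6, ← integral_Iic_eq_integral_Iio, integral_neg]
  have h3 := congrArg Complex.re h1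
  have h4 := congrArg Complex.re h2
  rw [← RCLike.re_eq_complex_re, ← integral_re hg.integrableOn] at h3 h4
  simp only [RCLike.re_eq_complex_re] at h3 h4
  rw [h3, h4, hx]
  simp
  ring

lemma line_Cplus (f : L2 ℝ) : Cplus f = f - Cminus f := by
  refine ext_U (Γ := ℝ) ?_
  have h0 : ∀ᵐ ξ ∂(ν ℝ : Measure ℝ), ξ ≠ 0 := Measure.ae_ne volume 0
  filter_upwards [U_Cplus f, U_Cpos f, h0] with ξ h1 h2 h3
  change (U (Cplus f) : ℝ → ℂ) ξ = (U (Cpos f) : ℝ → ℂ) ξ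
  have h4 : (φ ℝ : ℝ →+ ℝ) ξ ≠ 0 := mul_ne_zero Real.two_pi_pos.ne' h3
  rw [h1, h2]
  by_cases h : 0 < (φ ℝ : ℝ →+ ℝ) ξ
  · simp [h, h.le]
  · simp [h, not_le.2 (lt_of_le_of_ne (not_lt.1 h) h4)]

instance : AntiderivModel ℝ where
  c₀ := 0
  mul_zero_mode f g := by
    rw [line_Cplus, sub_self]
    simp only [Complex.ofReal_zero, zero_mul, zero_smul]
    simpa using mul_smul' g g 0
  antideriv_deriv f g h hg := by
    filter_upwards [line_antideriv_deriv h hg] with x hx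
    simp [hx]
  abs_antideriv_le F hF x := by
    change |1 / 2 * ∫ y, Real.sign (x - y) * F y| ≤ _
    rw [abs_mul, abs_of_nonneg (by norm_num : (0 : ℝ) ≤ 1 / 2)]
    gcongr
    refine (abs_integral_le_integral_abs).trans (integral_mono_of_nonneg
      (.of_forall fun y => abs_nonneg _) hF.abs (.of_forall fun y => ?_))
    change |Real.sign (x - y) * F y| ≤ |F y|
    rw [abs_mul]
    rcases Real.sign_apply_eq (x - y) with h | h | h <;> simp [h]
  aestronglyMeasurable_antideriv F hF := by
    refine AEStronglyMeasurable.const_mul ?_ _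
    have h : AEStronglyMeasurable (fun p : ℝ × ℝ => Real.sign (p.1 - p.2) * F p.2)
        (volume.prod volume) :=
      (measurable_sign.comp
        (measurable_fst.sub measurable_snd)).aestronglyMeasurable.mul hF.1.comp_snd
    exact h.integral_prod_right'
  antideriv_sub F G hF hG x := by
    have key : ∀ {H : ℝ → ℝ}, Integrable H →
        Integrable (fun y => Real.sign (x - y) * H y) := fun {H} hH => by
      refine hH.bdd_mul (c := 1) ?_ (.of_forall fun y => ?_)
      · exact (measurable_sign.comp (measurable_const.sub measurable_id)).aestronglyMeasurable
      · rcases Real.sign_apply_eq (x - y) with h | h | h <;> simp [h]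
    change 1 / 2 * ∫ y, Real.sign (x - y) * (F y - G y) = (1 / 2 * ∫ y, Real.sign (x - y) * F y)
      - 1 / 2 * ∫ y, Real.sign (x - y) * G y
    simp only [mul_sub (Real.sign _)]
    rw [integral_sub (key hF) (key hG), mul_sub]
  antideriv_congr F G h := by
    ext x
    change 1 / 2 * ∫ y, Real.sign (x - y) * F y = 1 / 2 * ∫ y, Real.sign (x - y) * G y
    congr 1
    refine integral_congr_ae ?_
    filter_upwards [h] with y hy
    rw [hy]

end CalogeroMoser

namespace CalogeroMoser

/-! ### Fourier series on `L²(𝕋)` -/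

/-- The measure on the dual group `ℤ` of the torus, `(2π)⁻¹` times the counting measure. -/
def torusDual : Measure ℤ := ENNReal.ofReal (1 / (2 * π)) • Measure.count

lemma ae_torusDual_iff {p : ℤ → Prop} : (∀ᵐ n ∂torusDual, p n) ↔ ∀ n, p n := by
  have h : ENNReal.ofReal (1 / (2 * π)) ≠ 0 := by
    rw [Ne, ENNReal.ofReal_eq_zero, not_le]; positivity
  rw [torusDual, Measure.ae_ennreal_smul_measure_iff h, ae_iff, Measure.count_eq_zero_iff,
    Set.eq_empty_iff_forall_notMem]
  simp

lemma integrable_torusDual_iff {E : Type*} [NormedAddCommGroup E] {a : ℤ → E} :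
    Integrable a torusDual ↔ Summable fun n => ‖a n‖ := by
  have h : ENNReal.ofReal (1 / (2 * π)) ≠ 0 := by
    rw [Ne, ENNReal.ofReal_eq_zero, not_le]; positivity
  rw [torusDual, integrable_smul_measure h ENNReal.ofReal_ne_top, integrable_count_iff]

lemma integral_torusDual {E : Type*} [NormedAddCommGroup E] [NormedSpace ℝ E] [CompleteSpace E]
    {a : ℤ → E} (ha : Integrable a torusDual) :
    ∫ n, a n ∂torusDual = (1 / (2 * π)) • ∑' n, a n := by
  have h : ENNReal.ofReal (1 / (2 * π)) ≠ 0 := by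
    rw [Ne, ENNReal.ofReal_eq_zero, not_le]; positivity
  rw [torusDual, integrable_smul_measure h ENNReal.ofReal_ne_top] at ha
  rw [torusDual, integral_smul_measure, ENNReal.toReal_ofReal (by positivity),
    integral_countable ha]
  simp [Measure.real]

lemma memLp_torusDual_iff {a : ℤ → ℂ} :
    MemLp a 2 torusDual ↔ Summable fun n => ‖a n‖ ^ 2 := by
  rw [memLp_two_iff_integrable_sq_norm (by fun_prop : Measurable a).aestronglyMeasurable,
    integrable_torusDual_iff]
  simp

/-- The class of a function on the torus with respect to the Haar probability measure. -/
def toHaar (f : L2 Torus) : Lp ℂ 2 (AddCircle.haarAddCircle (T := 2 * π)) :=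
  (Lp.memLp f).haarAddCircle.toLp f

lemma ae_haar_iff {p : Torus → Prop} :
    (∀ᵐ x ∂AddCircle.haarAddCircle (T := 2 * π), p x) ↔ ∀ᵐ x, p x := by
  rw [AddCircle.volume_eq_smul_haarAddCircle, Measure.ae_ennreal_smul_measure_iff]
  rw [Ne, ENNReal.ofReal_eq_zero, not_le]
  exact Real.two_pi_pos

lemma coeFn_toHaar (f : L2 Torus) :
    (toHaar f : Torus → ℂ) =ᵐ[AddCircle.haarAddCircle (T := 2 * π)] f :=
  (Lp.memLp f).haarAddCircle.coeFn_toLp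

lemma fourierCoeff_toHaar (f : L2 Torus) (n : ℤ) :
    fourierCoeff (toHaar f : Torus → ℂ) n = fourierCoeff (f : Torus → ℂ) n :=
  congrFun (fourierCoeff_congr_ae (coeFn_toHaar f)) n

lemma hasSum_sq_coeff (f : L2 Torus) :
    HasSum (fun n => ‖fourierCoeff (f : Torus → ℂ) n‖ ^ 2) ((2 * π)⁻¹ * ‖f‖ ^ 2) := by
  have h := hasSum_sq_fourierCoeff (toHaar f)
  simp only [fourierCoeff_toHaar] at h
  convert! h using 1
  have h1 : ∫ x, ‖(toHaar f : Torus → ℂ) x‖ ^ 2 ∂AddCircle.haarAddCircle (T := 2 * π)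
      = ∫ x, ‖f x‖ ^ 2 ∂AddCircle.haarAddCircle (T := 2 * π) := by
    refine integral_congr_ae ?_
    filter_upwards [coeFn_toHaar f] with x hx
    rw [hx]
  have h2 : ((‖f‖ ^ 2 : ℝ) : ℂ) = ((∫ x, ‖f x‖ ^ 2 : ℝ) : ℂ) := by
    have h3 := inner_self_eq_norm_sq_to_K (𝕜 := ℂ) f
    rw [inner_eq] at h3
    rw [← integral_complex_ofReal]
    push_cast
    refine h3.symm.trans (integral_congr_ae (.of_forall fun x => ?_))
    simp only
    rw [mul_comm, Complex.mul_conj, Complex.normSq_eq_norm_sq]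
    push_cast
    rfl
  rw [h1, AddCircle.integral_haarAddCircle, Complex.ofReal_injective h2, smul_eq_mul]

lemma memLp_coeff (f : L2 Torus) :
    MemLp (fun n => 2 * π * fourierCoeff (f : Torus → ℂ) n) 2 torusDual := by
  rw [memLp_torusDual_iff]
  simp only [norm_mul, mul_pow]
  exact (hasSum_sq_coeff f).summable.mul_left _

lemma fourierCoeff_add' (f g : L2 Torus) (n : ℤ) : fourierCoeff ((f + g : L2 Torus) : Torus → ℂ) n
    = fourierCoeff (f : Torus → ℂ) n + fourierCoeff (g : Torus → ℂ) n := by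
  simp only [fourierCoeff_eq_inner, inner_add_right, mul_add]

lemma fourierCoeff_smul' (c : ℂ) (f : L2 Torus) (n : ℤ) :
    fourierCoeff ((c • f : L2 Torus) : Torus → ℂ) n = c * fourierCoeff (f : Torus → ℂ) n := by
  simp only [fourierCoeff_eq_inner, inner_smul_right]
  ring

/-- The coefficient map `f ↦ (2π f̂(n))ₙ`, as a linear isometry. -/
def torusTransform : L2 Torus →ₗᵢ[ℂ] Lp ℂ 2 torusDual where
  toFun f := (memLp_coeff f).toLp _
  map_add' f g := by
    rw [← MemLp.toLp_add]
    congr 1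
    ext n
    change 2 * π * fourierCoeff ((f + g : L2 Torus) : Torus → ℂ) n = _
    rw [fourierCoeff_add', mul_add]
    rfl
  map_smul' c f := by
    rw [RingHom.id_apply, ← MemLp.toLp_const_smul]
    congr 1
    ext n
    change 2 * π * fourierCoeff ((c • f : L2 Torus) : Torus → ℂ) n = _
    rw [fourierCoeff_smul', mul_left_comm]
    rfl
  norm_map' f := by
    change ‖(memLp_coeff f).toLp _‖ = ‖f‖
    have h3 := inner_self_eq_norm_sq_to_K (𝕜 := ℂ) ((memLp_coeff f).toLp _)
    rw [L2.inner_def] at h3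
    have h4 : ∫ n, inner ℂ ((memLp_coeff f).toLp _ n) ((memLp_coeff f).toLp _ n) ∂torusDual
        = ∫ n, (((2 * π) ^ 2 * ‖fourierCoeff (f : Torus → ℂ) n‖ ^ 2 : ℝ) : ℂ) ∂torusDual := by
      refine integral_congr_ae ?_
      filter_upwards [(memLp_coeff f).coeFn_toLp] with n hn
      rw [hn, inner_self_eq_norm_sq_to_K]
      simp [mul_pow, abs_of_pos Real.pi_pos]
    have hs := (hasSum_sq_coeff f).mul_left ((2 * π) ^ 2)
    have hi : Integrable (fun n => (2 * π) ^ 2 * ‖fourierCoeff (f : Torus → ℂ) n‖ ^ 2)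
        torusDual := by
      rw [integrable_torusDual_iff]
      exact hs.summable.norm
    rw [h4, integral_complex_ofReal, integral_torusDual hi, hs.tsum_eq] at h3
    have h5 : 1 / (2 * π) * ((2 * π) ^ 2 * ((2 * π)⁻¹ * ‖f‖ ^ 2)) = ‖f‖ ^ 2 := by
      have := Real.pi_pos
      field_simp
    have h6 : ‖(memLp_coeff f).toLp _‖ ^ 2 = ‖f‖ ^ 2 := by
      rw [smul_eq_mul, h5] at h3
      refine Complex.ofReal_injective ?_
      push_cast at h3 ⊢
      exact h3.symm
    exact (sq_eq_sq₀ (norm_nonneg _) (norm_nonneg _)).1 h6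

lemma torusTransform_apply (f : L2 Torus) (n : ℤ) :
    torusTransform f n = 2 * π * fourierCoeff (f : Torus → ℂ) n :=
  ae_torusDual_iff.1 (memLp_coeff f).coeFn_toLp n

/-- By the Riesz--Fischer theorem. -/
lemma surjective_torusTransform : Function.Surjective torusTransform := by
  intro a
  have ha := memLp_torusDual_iff.1 (Lp.memLp a)
  have hp : (2 * π : ℂ) ≠ 0 := by exact_mod_cast Real.two_pi_pos.ne'
  have hb : Memℓp (fun n => (2 * π : ℂ)⁻¹ * a n) 2 := by
    refine memℓp_gen ?_
    have : Summable fun n => ‖(2 * π : ℂ)⁻¹‖ ^ 2 * ‖a n‖ ^ 2 := ha.mul_left _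
    simpa [mul_pow] using this
  let F := (fourierBasis (T := 2 * π)).repr.symm ⟨_, hb⟩
  let f : L2 Torus := (Lp.memLp F).of_haarAddCircle.toLp F
  have hf : (f : Torus → ℂ) =ᵐ[AddCircle.haarAddCircle (T := 2 * π)] F :=
    ae_haar_iff.2 (Lp.memLp F).of_haarAddCircle.coeFn_toLp
  refine ⟨f, Lp.ext (.of_forall fun n => ?_)⟩
  rw [torusTransform_apply, congrFun (fourierCoeff_congr_ae hf) n, ← fourierBasis_repr,
    LinearIsometryEquiv.apply_symm_apply]
  change 2 * π * ((2 * π : ℂ)⁻¹ * a n) = a n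
  rw [← mul_assoc, mul_inv_cancel₀ hp, one_mul]

/-- A function on the torus with summable Fourier coefficients is the sum of its Fourier series. -/
lemma ae_hasSum_fourier {f : L2 Torus} (hf : Summable (fourierCoeff (f : Torus → ℂ))) :
    ∀ᵐ x, HasSum (fun n => fourierCoeff (f : Torus → ℂ) n * fourier n x) (f x) := by
  have h1 := hasSum_fourier_series_L2 (toHaar f)
  simp only [fourierCoeff_toHaar] at h1
  have h2 : Summable fun n => fourierCoeff (f : Torus → ℂ) n • (fourier n : C(Torus, ℂ)) := by
    refine .of_norm ?_
    simp_rw [norm_smul, fourier_norm, mul_one]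
    exact hf.norm
  obtain ⟨F, hF⟩ := h2
  have h3 := (ContinuousMap.toLp (E := ℂ) 2 (AddCircle.haarAddCircle (T := 2 * π)) ℂ).hasSum hF
  have h4 : toHaar f = ContinuousMap.toLp (E := ℂ) 2 AddCircle.haarAddCircle ℂ F := by
    refine h1.unique ?_
    simpa only [map_smul] using! h3
  rw [← ae_haar_iff]
  filter_upwards [coeFn_toHaar f, ContinuousMap.coeFn_toLp (p := 2) (𝕜 := ℂ)
    AddCircle.haarAddCircle F] with x h5 h6
  rw [← h5, h4, h6]
  exact (ContinuousMap.evalCLM ℂ x).hasSum hF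

/-- A geometric series with ratio of modulus `e⁻¹`. -/
lemma torus_poisson_ne_zero (x y : Torus) :
    ∫ n in {n : ℤ | 0 ≤ (n : ℝ)}, (Real.exp (-(n : ℝ)) : ℂ) * fourier (-n) x * fourier n y
      ∂torusDual ≠ 0 := by
  set z : ℂ := (Real.exp (-1) : ℂ) * fourier (-1) x * fourier 1 y with hz
  have hz1 : ‖z‖ < 1 := by
    have h1 : ∀ (n : ℤ) (x : Torus), ‖fourier n x‖ = 1 := fun n x => Circle.norm_coe _
    rw [hz, norm_mul, norm_mul, h1, h1, mul_one, mul_one, Complex.norm_real,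
      Real.norm_of_nonneg (Real.exp_pos _).le]
    exact Real.exp_lt_one_iff.2 (by norm_num)
  have hpow : ∀ n : ℕ, (Real.exp (-((n : ℤ) : ℝ)) : ℂ) * fourier (-(n : ℤ)) x * fourier (n : ℤ) y
      = z ^ n := by
    intro n
    induction n with
    | zero => simp
    | succ k ih =>
      have e1 : (-((k + 1 : ℕ) : ℤ)) = -(k : ℤ) + -1 := by push_cast; ring
      have e2 : (((k + 1 : ℕ) : ℤ)) = (k : ℤ) + 1 := by push_cast; ring
      rw [pow_succ, ← ih, e1, e2, fourier_add, fourier_add, hz]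
      push_cast
      rw [neg_add, Complex.exp_add]
      ring
  have hsum := summable_geometric_of_norm_lt_one hz1
  set G : ℤ → ℂ := {n : ℤ | 0 ≤ (n : ℝ)}.indicator fun n =>
    (Real.exp (-(n : ℝ)) : ℂ) * fourier (-n) x * fourier n y with hG
  have hGn : ∀ n : ℕ, G n = z ^ n := fun n => by
    rw [hG, indicator_of_mem (by simp), hpow]
  have hsupp : ∀ n ∉ range ((↑) : ℕ → ℤ), G n = 0 := fun n hn => by
    rw [hG, indicator_of_notMem]
    intro h
    have h0 : (0 : ℤ) ≤ n := by exact_mod_cast h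
    exact hn ⟨n.toNat, Int.toNat_of_nonneg h0⟩
  have hS : HasSum G (1 - z)⁻¹ := by
    rw [← Nat.cast_injective.hasSum_iff hsupp]
    simp only [Function.comp_def, hGn]
    exact hasSum_geometric_of_norm_lt_one hz1
  have hi : Integrable G torusDual := integrable_torusDual_iff.2 hS.summable.norm
  rw [← integral_indicator (measurableSet_le (by fun_prop) (by fun_prop)), ← hG,
    integral_torusDual hi, hS.tsum_eq]
  refine smul_ne_zero (by positivity) (inv_ne_zero (sub_ne_zero.2 fun h => ?_))
  rw [← h] at hz1
  simp at hz1

end CalogeroMoser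

namespace CalogeroMoser

/-! ### The Fourier model of the torus -/

lemma torusDual_le {s : Set ℤ} {t : Finset ℤ} (h : s ⊆ t) {a : ℝ} (ha : (t.card : ℝ) ≤ a) :
    torusDual s ≤ ENNReal.ofReal (a / (2 * π)) := by
  refine (measure_mono h).trans ?_
  rw [torusDual, Measure.smul_apply, Measure.count_apply_finset, smul_eq_mul,
    ← ENNReal.ofReal_natCast, ← ENNReal.ofReal_mul (by positivity), one_div_mul_eq_div]
  gcongr

/-- The dual of the torus is `ℤ`; the frequency of `n` is `n`. -/
instance : FourierModel Torus ℤ where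
  ν := torusDual
  sigmaFinite := by
    refine Measure.sigmaFinite_of_countable (S := range fun n : ℤ => {n})
      (countable_range _) ?_ (by ext n; simp)
    rintro _ ⟨n, rfl⟩
    rw [torusDual, Measure.smul_apply, Measure.count_singleton]
    simp
  leftInvariant := by
    rw [torusDual]
    infer_instance
  negInvariant := ⟨by rw [torusDual, Measure.neg, Measure.map_smul, ← Measure.neg,
    Measure.neg_eq_self]⟩
  φ := Int.castAddHom ℝ
  measurable_φ := by fun_prop
  e n x := fourier n x
  measurable_e := measurable_from_prod_countable_right fun n => (fourier n).continuous.measurable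
  e_add _ _ _ := fourier_add
  norm_e _ _ := Circle.norm_coe _
  U := LinearIsometryEquiv.ofSurjective torusTransform surjective_torusTransform
  inversion f hf := by
    simp only [LinearIsometryEquiv.coe_ofSurjective] at hf ⊢
    have hp : (2 * π : ℂ) ≠ 0 := by exact_mod_cast Real.two_pi_pos.ne'
    have h1 : Summable (fourierCoeff (f : Torus → ℂ)) := by
      have h2 := (integrable_torusDual_iff.1 hf).of_norm.mul_left (2 * π : ℂ)⁻¹
      refine h2.congr fun n => ?_
      rw [torusTransform_apply, ← mul_assoc, inv_mul_cancel₀ hp, one_mul]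
    filter_upwards [ae_hasSum_fourier h1] with x hx
    have h3 := hx.mul_left (2 * π : ℂ)
    have h4 : (fun n : ℤ => torusTransform f n * fourier n x)
        = fun n => 2 * π * (fourierCoeff (f : Torus → ℂ) n * fourier n x) := by
      ext n
      rw [torusTransform_apply, mul_assoc]
    rw [h4, integral_torusDual (integrable_torusDual_iff.2 h3.summable.norm), h3.tsum_eq,
      Complex.real_smul]
    push_cast
    field_simp
  mem_plus f := by
    simp only [LinearIsometryEquiv.coe_ofSurjective, ae_torusDual_iff, torusTransform_apply]
    change (∀ n < 0, _) ↔ _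
    simp [Real.pi_ne_zero]
  mem_minus f := by
    simp only [LinearIsometryEquiv.coe_ofSurjective, ae_torusDual_iff, torusTransform_apply]
    change (∀ n, 0 < n → _) ↔ _
    simp [Real.pi_ne_zero]
  isDeriv_iff f g := by
    simp only [LinearIsometryEquiv.coe_ofSurjective, ae_torusDual_iff, torusTransform_apply]
    change (∀ n : ℤ, fourierCoeff (g : Torus → ℂ) n
      = Complex.I * n * fourierCoeff (f : Torus → ℂ) n) ↔ _
    have hp : (2 * π : ℂ) ≠ 0 := by exact_mod_cast Real.two_pi_pos.ne'
    refine forall_congr' fun n => ?_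
    rw [mul_left_comm _ (2 * π : ℂ), mul_right_inj' hp]
    simp
  measure_pos_le a ha := by
    refine torusDual_le (t := Finset.Ioc 0 ⌊a⌋) (fun n hn => ?_) ?_
    · have h1 : (0 : ℝ) < n := hn.1
      have h2 : (n : ℝ) ≤ a := hn.2
      rw [Finset.coe_Ioc]
      exact ⟨by exact_mod_cast h1, Int.le_floor.2 h2⟩
    · have h := Int.floor_le a
      have h0 := Int.floor_nonneg.2 ha
      rw [Int.card_Ioc, sub_zero]
      calc ((⌊a⌋.toNat : ℕ) : ℝ) = ((⌊a⌋.toNat : ℤ) : ℝ) := (Int.cast_natCast _).symm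
        _ ≤ a := by rwa [Int.toNat_of_nonneg h0]
  measure_nonneg_le a ha := by
    refine torusDual_le (t := Finset.Icc 0 ⌊a⌋) (fun n hn => ?_) ?_
    · have h1 : (0 : ℝ) ≤ n := hn.1
      have h2 : (n : ℝ) ≤ a := hn.2
      rw [Finset.coe_Icc]
      exact ⟨by exact_mod_cast h1, Int.le_floor.2 h2⟩
    · have h := Int.floor_le a
      have h0 := Int.floor_nonneg.2 ha
      rw [Int.card_Icc, sub_zero]
      calc (((⌊a⌋ + 1).toNat : ℕ) : ℝ) = (((⌊a⌋ + 1).toNat : ℤ) : ℝ) := (Int.cast_natCast _).symm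
        _ ≤ a + 1 := by
          rw [Int.toNat_of_nonneg (by lia)]
          push_cast
          linarith
  poisson_ne_zero := torus_poisson_ne_zero

end CalogeroMoser

namespace CalogeroMoser

open FourierModel

/-! ### The antiderivative on the torus -/

/-- The sawtooth `1 - y / π` for `0 < y ≤ 2π`, the kernel of `2 ∂̃⁻¹` on the torus. -/
def sawtooth : Torus → ℝ := AddCircle.liftIoc (2 * π) 0 fun y => 1 - y / π

lemma sawtooth_coe {y : ℝ} (hy : y ∈ Ioc 0 (2 * π)) : sawtooth (y : Torus) = 1 - y / π :=
  AddCircle.liftIoc_zero_coe_apply hy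

lemma measurable_sawtooth : Measurable sawtooth := by
  have h : Measurable fun y : ℝ => 1 - y / π := by fun_prop
  exact h.comp (measurable_subtype_coe.comp
    (AddCircle.measurePreserving_equivIoc (T := 2 * π) (a := 0)).measurable)

lemma abs_sawtooth_le (y : Torus) : |sawtooth y| ≤ 1 := by
  obtain ⟨x, hx, rfl⟩ : ∃ x ∈ Ioc (0 : ℝ) (2 * π), (x : Torus) = y := by
    refine ⟨AddCircle.equivIoc (2 * π) 0 y, ?_, AddCircle.coe_equivIoc⟩
    simpa using (AddCircle.equivIoc (2 * π) 0 y).2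
  rw [sawtooth_coe hx, abs_le]
  have h1 : x / π ≤ 2 := (div_le_iff₀ Real.pi_pos).2 hx.2
  have h2 : 0 ≤ x / π := div_nonneg hx.1.le Real.pi_pos.le
  constructor <;> linarith

lemma integral_sawtooth_mul {E : Type*} [NormedAddCommGroup E] [NormedSpace ℝ E] (F : Torus → E) :
    ∫ y in (0 : ℝ)..(2 * π), (1 - y / π) • F y = ∫ y : Torus, sawtooth y • F y := by
  have h := AddCircle.intervalIntegral_preimage (2 * π) 0 fun y : Torus => sawtooth y • F y
  rw [zero_add] at h
  rw [← h]
  refine intervalIntegral.integral_congr_ae (.of_forall fun y hy => ?_)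
  rw [uIoc_of_le Real.two_pi_pos.le] at hy
  rw [sawtooth_coe hy]

lemma torus_antideriv_eq (F : Torus → ℝ) (x : Torus) :
    antideriv F x = 1 / 2 * ∫ y : Torus, sawtooth (x - y) * F y := by
  have h := integral_sawtooth_mul fun y : Torus => F (x - y)
  simp only [smul_eq_mul] at h
  change 1 / 2 * ∫ y in (0 : ℝ)..(2 * π), (1 - y / π) * F (x - (y : Torus)) = _
  rw [h, ← integral_sub_left_eq_self (fun y : Torus => sawtooth (x - y) * F y) volume x]
  simp only [sub_sub_cancel]

lemma integrable_sawtooth_mul {F : Torus → ℝ} (hF : Integrable F) (x : Torus) :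
    Integrable fun y => sawtooth (x - y) * F y := by
  refine hF.bdd_mul (c := 1) ?_ (.of_forall fun y => abs_sawtooth_le _)
  exact (measurable_sawtooth.comp (measurable_const.sub measurable_id)).aestronglyMeasurable

lemma integral_fourier_neg (n : ℤ) :
    ∫ y in (0 : ℝ)..(2 * π), fourier (-n) (y : Torus) = if n = 0 then 2 * π else 0 := by
  have h := AddCircle.intervalIntegral_preimage (2 * π) 0 fun y : Torus => fourier (-n) y
  rw [zero_add] at h
  have h1 := congrFun (fourierCoeff_fourier (T := 2 * π) 0) n
  rw [fourierCoeff, AddCircle.integral_haarAddCircle] at h1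
  simp only [fourier_zero, smul_eq_mul, mul_one] at h1
  rw [inv_smul_eq_iff₀ Real.two_pi_pos.ne'] at h1
  rw [h, h1, Pi.single_apply]
  split_ifs <;> simp

/-- The Fourier coefficients of the sawtooth, from an integration by parts. -/
lemma integral_sawtooth_fourier (n : ℤ) :
    Complex.I * n * ∫ y : Torus, sawtooth y • fourier (-n) y = if n = 0 then 0 else 2 := by
  rw [← integral_sawtooth_mul]
  have hp : (π : ℂ) ≠ 0 := by exact_mod_cast Real.pi_ne_zero
  have hc : Continuous fun y : ℝ => fourier (-n) (y : Torus) := by fun_prop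
  have hd : ∀ y : ℝ, HasDerivAt (fun y : ℝ => ((1 - y / π : ℝ) : ℂ) * fourier (-n) (y : Torus))
      (-(1 / π : ℂ) * fourier (-n) (y : Torus)
        - Complex.I * n * ((1 - y / π : ℝ) • fourier (-n) (y : Torus))) y := by
    intro y
    have h1 : HasDerivAt (fun y : ℝ => ((1 - y / π : ℝ) : ℂ)) (-(1 / π : ℝ) : ℂ) y := by
      have h2 : HasDerivAt (fun y : ℝ => 1 - y / π) (-(1 / π)) y :=
        ((hasDerivAt_id y).div_const π).const_sub 1
      simpa using h2.ofReal_comp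
    refine (h1.mul (hasDerivAt_fourier_neg (2 * π) n y)).congr_deriv ?_
    rw [Complex.real_smul]
    push_cast
    field_simp
    ring
  have h3 := intervalIntegral.integral_eq_sub_of_hasDerivAt (a := 0) (b := 2 * π)
    (fun y _ => hd y) (Continuous.intervalIntegrable (by fun_prop) _ _)
  rw [intervalIntegral.integral_sub (Continuous.intervalIntegrable (by fun_prop) _ _)
    (Continuous.intervalIntegrable (by fun_prop) _ _), intervalIntegral.integral_const_mul,
    intervalIntegral.integral_const_mul, integral_fourier_neg] at h3
  have h4 : ((2 * π : ℝ) : Torus) = 0 := AddCircle.coe_period _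
  rw [h4] at h3
  simp only [QuotientAddGroup.mk_zero, fourier_eval_zero] at h3
  split_ifs at h3 ⊢ with hn
  · simp [hn]
  · push_cast at h3
    rw [mul_zero, zero_sub, mul_div_assoc, div_self hp] at h3
    linear_combination -h3

lemma torus_U (f : L2 Torus) (n : ℤ) :
    (U f : ℤ → ℂ) n = 2 * π * fourierCoeff (f : Torus → ℂ) n :=
  torusTransform_apply f n

lemma fourierCoeff_zero_eq (f : L2 Torus) :
    fourierCoeff (f : Torus → ℂ) 0 = ((1 / (2 * π) : ℝ) : ℂ) * ∫ x, f x := by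
  rw [fourierCoeff, AddCircle.integral_haarAddCircle]
  simp

lemma summable_coeff_of_isDeriv {f g : L2 Torus} (h : IsDeriv f g) :
    Summable (fourierCoeff (f : Torus → ℂ)) := by
  have hp : (2 * π : ℂ) ≠ 0 := by exact_mod_cast Real.two_pi_pos.ne'
  have h2 := (integrable_torusDual_iff.1 (IsDeriv.wiener h)).of_norm.mul_left (2 * π : ℂ)⁻¹
  refine h2.congr fun n => ?_
  rw [torus_U, ← mul_assoc, inv_mul_cancel₀ hp, one_mul]

/-- Parseval's identity for the translates of the sawtooth and a derivative. -/
lemma integral_sawtooth_deriv {f g : L2 Torus} (h : IsDeriv f g) :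
    ∀ᵐ x, ∫ y : Torus, (sawtooth (x - y) : ℂ) * g y
      = 2 * (f x - fourierCoeff (f : Torus → ℂ) 0) := by
  filter_upwards [ae_hasSum_fourier (summable_coeff_of_isDeriv h)] with x hx
  have hmeas : Measurable fun y => (sawtooth (x - y) : ℂ) :=
    Complex.measurable_ofReal.comp
      (measurable_sawtooth.comp (measurable_const.sub measurable_id))
  have hmem : MemLp (fun y => (sawtooth (x - y) : ℂ)) 2 volume := by
    refine MemLp.of_bound hmeas.aestronglyMeasurable 1 (.of_forall fun y => ?_)
    rw [Complex.norm_real]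
    exact abs_sawtooth_le _
  have hcoe := hmem.coeFn_toLp
  have h1 : ∫ y : Torus, (sawtooth (x - y) : ℂ) * g y = inner ℂ (hmem.toLp _) g := by
    rw [inner_eq]
    refine integral_congr_ae ?_
    filter_upwards [hcoe] with y hy
    rw [hy, Complex.conj_ofReal]
  have h2 : ∀ n : ℤ, conj (fourierCoeff (hmem.toLp _ : Torus → ℂ) n)
      = (2 * π : ℂ)⁻¹ * (fourier n x * ∫ y : Torus, sawtooth y • fourier (-n) y) := by
    intro n
    rw [fourierCoeff, AddCircle.integral_haarAddCircle, ← integral_const_mul,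
      ← integral_sub_left_eq_self (fun y : Torus => fourier n x * sawtooth y • fourier (-n) y)
        volume x, Complex.real_smul, map_mul, Complex.conj_ofReal, ← integral_conj]
    push_cast
    congr 1
    refine integral_congr_ae ?_
    filter_upwards [hcoe] with y hy
    rw [hy, smul_eq_mul, map_mul, Complex.conj_ofReal, ← fourier_neg, neg_neg, sub_eq_add_neg x y,
      Complex.real_smul]
    have h3 : fourier (-n) (x + -y) = fourier (-n) x * fourier n y := by
      simp [fourier_apply, AddCircle.toCircle_add, smul_add, AddCircle.toCircle_neg]
    rw [h3, ← sub_eq_add_neg]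
    have h4 : fourier n x * fourier (-n) x = (1 : ℂ) := by
      rw [← fourier_add, add_neg_cancel, fourier_zero]
    linear_combination (-(sawtooth (x - y) : ℂ) * fourier n y) * h4
  have h5 : ∀ n : ℤ, conj ((U (hmem.toLp _ : L2 Torus) : ℤ → ℂ) n) * (U g : ℤ → ℂ) n
      = 2 * π * (2 * (fourierCoeff (f : Torus → ℂ) n * fourier n x
          - if n = 0 then fourierCoeff (f : Torus → ℂ) 0 else 0)) := by
    intro n
    have hp : (π : ℂ) ≠ 0 := by exact_mod_cast Real.pi_ne_zero
    have h6 := integral_sawtooth_fourier n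
    rw [torus_U, torus_U, map_mul, h2, show fourierCoeff (g : Torus → ℂ) n
      = Complex.I * n * fourierCoeff (f : Torus → ℂ) n from h n]
    have h7 : conj (2 * π : ℂ) = 2 * π := by
      exact_mod_cast Complex.conj_ofReal (2 * π)
    rw [h7]
    calc _ = 2 * π * (Complex.I * n * ∫ y : Torus, sawtooth y • fourier (-n) y)
          * (fourierCoeff (f : Torus → ℂ) n * fourier n x) := by field_simp
      _ = _ := by
        rw [h6]
        split_ifs with hn
        · simp [hn]
        · ring
  have h8 : HasSum (fun n : ℤ => 2 * π * (2 * (fourierCoeff (f : Torus → ℂ) n * fourier n x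
      - if n = 0 then fourierCoeff (f : Torus → ℂ) 0 else 0)))
      (2 * π * (2 * (f x - fourierCoeff (f : Torus → ℂ) 0))) :=
    ((hx.sub (hasSum_ite_eq (0 : ℤ) _)).mul_left 2).mul_left _
  have h9 : inner ℂ (hmem.toLp _) g = ∫ n, 2 * π * (2 * (fourierCoeff (f : Torus → ℂ) n
      * fourier n x - if n = 0 then fourierCoeff (f : Torus → ℂ) 0 else 0)) ∂torusDual := by
    rw [inner_eq_U]
    exact integral_congr_ae (.of_forall h5)
  rw [h1, h9, integral_torusDual (integrable_torusDual_iff.2 h8.summable.norm), h8.tsum_eq,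
    Complex.real_smul]
  push_cast
  field_simp

/-- On the torus the two projections overlap in the constants. -/
lemma torus_Cplus_sub (f : L2 Torus) :
    (Cplus f - (f - Cminus f) : L2 Torus) =ᵐ[volume] fun _ => fourierCoeff (f : Torus → ℂ) 0 := by
  have hp : (2 * π : ℂ) ≠ 0 := by exact_mod_cast Real.two_pi_pos.ne'
  have h : ∀ n, fourierCoeff ((Cplus f - (f - Cminus f) : L2 Torus) : Torus → ℂ) n
      = if n = 0 then fourierCoeff (f : Torus → ℂ) 0 else 0 := by
    intro n
    refine mul_left_cancel₀ hp ?_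
    have h1 := ae_torusDual_iff.1 (U_Cplus f) n
    have h2 := ae_torusDual_iff.1 (U_Cpos f) n
    have h3 := ae_torusDual_iff.1 (U_sub (Cplus f) (Cpos f)) n
    rw [← torus_U]
    refine h3.trans ?_
    beta_reduce
    rw [h1, h2]
    have hφ : (φ Torus : ℤ →+ ℝ) n = n := rfl
    rcases lt_trichotomy n 0 with hn | hn | hn
    · simp [hφ, hn.ne, not_le.2 hn, not_lt.2 hn.le]
    · subst hn
      simp [torus_U]
    · simp [hφ, hn.ne', hn, hn.le]
  have hs : Summable (fourierCoeff ((Cplus f - (f - Cminus f) : L2 Torus) : Torus → ℂ)) := by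
    rw [funext h]
    exact (hasSum_ite_eq (0 : ℤ) _).summable
  filter_upwards [ae_hasSum_fourier hs] with x hx
  simp only [h] at hx
  refine hx.unique ?_
  convert hasSum_ite_eq (0 : ℤ) (fourierCoeff (f : Torus → ℂ) 0) using 2 with n
  split_ifs with hn
  · simp [hn]
  · simp

instance : AntiderivModel Torus where
  c₀ := 1 / (2 * π)
  mul_zero_mode f g := by
    rw [← fourierCoeff_zero_eq]
    have h : toL2 ((fourierCoeff (f : Torus → ℂ) 0 • g : L2 Torus) : Torus → ℂ)
        = fourierCoeff (f : Torus → ℂ) 0 • g := Lp.ext (coeFn_toL2 (Lp.memLp _))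
    rw [← h]
    refine toL2_congr ?_
    filter_upwards [torus_Cplus_sub f, Lp.coeFn_smul (fourierCoeff (f : Torus → ℂ) 0) g]
      with x h1 h2
    rw [h1, h2, Pi.smul_apply, smul_eq_mul, mul_comm]
  antideriv_deriv f g h hg := by
    rw [← fourierCoeff_zero_eq]
    filter_upwards [integral_sawtooth_deriv h] with x hx
    have hi : Integrable fun y : Torus => (sawtooth (x - y) : ℂ) * g y := by
      refine hg.bdd_mul (c := 1) ?_ (.of_forall fun y => ?_)
      · exact (Complex.measurable_ofReal.comp
          (measurable_sawtooth.comp (measurable_const.sub measurable_id))).aestronglyMeasurable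
      · rw [Complex.norm_real]
        exact abs_sawtooth_le _
    have h1 := congrArg Complex.re hx
    rw [← RCLike.re_eq_complex_re, ← integral_re hi] at h1
    simp only [RCLike.re_eq_complex_re, Complex.re_ofReal_mul] at h1
    rw [torus_antideriv_eq, h1, Complex.mul_re]
    simp
  abs_antideriv_le F hF x := by
    rw [torus_antideriv_eq, abs_mul, abs_of_nonneg (by norm_num : (0 : ℝ) ≤ 1 / 2)]
    gcongr
    refine abs_integral_le_integral_abs.trans (integral_mono_of_nonneg
      (.of_forall fun y => abs_nonneg _) hF.abs (.of_forall fun y => ?_))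
    change |sawtooth (x - y) * F y| ≤ |F y|
    rw [abs_mul]
    exact mul_le_of_le_one_left (abs_nonneg _) (abs_sawtooth_le _)
  aestronglyMeasurable_antideriv F hF := by
    rw [funext (torus_antideriv_eq F)]
    refine AEStronglyMeasurable.const_mul ?_ _
    have h : AEStronglyMeasurable (fun p : Torus × Torus => sawtooth (p.1 - p.2) * F p.2)
        (volume.prod volume) :=
      (measurable_sawtooth.comp
        (measurable_fst.sub measurable_snd)).aestronglyMeasurable.mul hF.1.comp_snd
    exact h.integral_prod_right'
  antideriv_sub F G hF hG x := by
    simp only [torus_antideriv_eq, mul_sub (sawtooth _)]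
    rw [integral_sub (integrable_sawtooth_mul hF x) (integrable_sawtooth_mul hG x), mul_sub]
  antideriv_congr F G h := by
    ext x
    rw [torus_antideriv_eq, torus_antideriv_eq]
    congr 1
    refine integral_congr_ae ?_
    filter_upwards [h] with y hy
    rw [hy]

end CalogeroMoser

namespace CalogeroMoser

/-! ### The line and the torus -/

lemma line_weight : AntiderivModel.c₀ ℝ = 0 := rfl

lemma torus_weight : AntiderivModel.c₀ Torus = 1 / (2 * π) := rfl

lemma peter_zero : peter (X := ℝ) 0 = peterLine := by
  ext1 s; ext1 κ; ext1 q; ext1 f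
  simp only [peter, peterLine, Complex.ofReal_zero, mul_zero, zero_mul, zero_smul, sub_zero]

lemma two_mul_I_mul_torus_weight :
    2 * Complex.I * ((1 / (2 * π) : ℝ) : ℂ) = Complex.I / π := by
  have hp : (π : ℂ) ≠ 0 := by exact_mod_cast Real.pi_ne_zero
  push_cast
  field_simp

lemma peter_torus_weight : peter (X := Torus) (1 / (2 * π)) = peterTorus := by
  ext1 s; ext1 κ; ext1 q; ext1 f
  simp only [peter, peterTorus, two_mul_I_mul_torus_weight]

end CalogeroMoser

end

theorem proposition5p1 (s : Sign) (κ : ℝ) (hκ : 1 ≤ κ) :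
    -- the line
    ((∀ q ∈ phaseSpace ℝ s,
        -- the objects are well defined at `q`
        (∀ u ∈ sobolevPlus ℝ, MemLp u ⊤ volume ∧
          MemLp (fun x => q x * Cplus (star q ⊙ u) x) 2 volume) ∧
        (∀ f ∈ hardyPlus (X := ℝ), ∃! u, u ∈ sobolevPlus ℝ ∧ lax s q u + (κ : ℂ) • u = f) ∧
        (∀ u ∈ sobolevPlus ℝ, peterLine s κ q u ∈ sobolevPlus ℝ) ∧
        (beta s κ q).im = 0 ∧
        -- the Wirtinger derivative
        (∀ a, IsWirtingerBar (beta s κ) q a ↔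
          a = mkappa s κ q
            + s.val • Cplus (mkappa s κ q ⊙ Cminus (q ⊙ star (mkappa s κ q)))) ∧
        -- the symplectic gradient
        (∀ v, IsSympGrad s (beta s κ) q v ↔
          v = -((2 * Complex.I) • mkappa s κ q)
            + (2 * Complex.I * s.val) •
                (mkappa s κ q ⊙ Cplus (q ⊙ star (mkappa s κ q))))) ∧
      ContDiffOn ℝ 1 (fun q : hardyPlus (X := ℝ) => beta s κ (q : L2 ℝ))
        {q | (q : L2 ℝ) ∈ phaseSpace ℝ s} ∧
      ∀ (J : Set ℝ) (q : ℝ → L2 ℝ), IsOpen J → J.OrdConnected →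
        (∀ t ∈ J, q t ∈ phaseSpace ℝ s) →
        (SolvesFlow s κ J q ↔ ∀ t ∈ J, HasDerivAt q (peterLine s κ (q t) (q t)) t) ∧
        (SolvesFlow s κ J q → LaxEquation s (peterLine s κ) J q) ∧
        (ContDiffOn ℝ 1 q J →
          (LaxEquation s (peterLine s κ) J q ↔
            ∃ θ : ℝ → ℝ, ContDiffOn ℝ 1 θ J ∧
              SolvesFlow s κ J (fun t => Complex.exp (Complex.I * θ t) • q t)))) ∧
    -- the torus
    ((∀ q ∈ phaseSpace Torus s,
        -- the objects are well defined at `q`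
        (∀ u ∈ sobolevPlus Torus, MemLp u ⊤ volume ∧
          MemLp (fun x => q x * Cplus (star q ⊙ u) x) 2 volume) ∧
        (∀ f ∈ hardyPlus (X := Torus),
          ∃! u, u ∈ sobolevPlus Torus ∧ lax s q u + (κ : ℂ) • u = f) ∧
        (∀ u ∈ sobolevPlus Torus, peterTorus s κ q u ∈ sobolevPlus Torus) ∧
        (beta s κ q).im = 0 ∧
        -- the Wirtinger derivative
        (∀ a, IsWirtingerBar (beta s κ) q a ↔
          a = mkappa s κ q
            + s.val • Cplus (mkappa s κ q ⊙ Cminus (q ⊙ star (mkappa s κ q)))) ∧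
        -- the symplectic gradient
        (∀ v, IsSympGrad s (beta s κ) q v ↔
          v = -((2 * Complex.I) • mkappa s κ q)
            + (2 * Complex.I * s.val) •
                (mkappa s κ q ⊙ Cplus (q ⊙ star (mkappa s κ q)))
            - (s.val * (Complex.I / π) * beta s κ q) • mkappa s κ q
            - (s.val * (Complex.I / π) * (‖mkappa s κ q‖ ^ 2 : ℝ)) • q)) ∧
      ContDiffOn ℝ 1 (fun q : hardyPlus (X := Torus) => beta s κ (q : L2 Torus))
        {q | (q : L2 Torus) ∈ phaseSpace Torus s} ∧
      ∀ (J : Set ℝ) (q : ℝ → L2 Torus), IsOpen J → J.OrdConnected →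
        (∀ t ∈ J, q t ∈ phaseSpace Torus s) →
        (SolvesFlow s κ J q ↔ ∀ t ∈ J, HasDerivAt q (peterTorus s κ (q t) (q t)) t) ∧
        (SolvesFlow s κ J q → LaxEquation s (peterTorus s κ) J q) ∧
        (ContDiffOn ℝ 1 q J →
          (LaxEquation s (peterTorus s κ) J q ↔
            ∃ θ : ℝ → ℝ, ContDiffOn ℝ 1 θ J ∧
              SolvesFlow s κ J (fun t => Complex.exp (Complex.I * θ t) • q t)))) := by
  refine ⟨?_, ?_⟩
  · have h := FourierModel.proposition_of_model (X := ℝ) s hκ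
    simpa only [line_weight, peter_zero, Complex.ofReal_zero, mul_zero, zero_mul, zero_smul,
      sub_zero] using h
  · have h := FourierModel.proposition_of_model (X := Torus) s hκ
    simpa only [torus_weight, peter_torus_weight, two_mul_I_mul_torus_weight] using h
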